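/- Setting. $G$ is a connected graph (loops and parallel edges allowed) embedded without crossings on the oriented flat torus $\mathbb T=\mathbb R^2/\mathbb Z^2$ so that all faces are triangles; the embedding is given by its rotation system and by the crossings of the edges with the two orbits: the meridian (first orbit, directed upwards) and the horizon (second orbit, directed to the right), two simple closed curves that avoid the vertices and that cross each other exactly once. The homotopy class of a closed walk $C$ is $(m(C),h(C))\in\mathbb Z^2$, where $m(C)$ is the number of times that $C$ crosses the meridian from left to right and $h(C)$ the number of times that the horizon crosses $C$ from left to right (both counted algebraically); $C$ is contractible iff its class is $(0,0)$. The first and second orbits have the classes $(0,1)$ and $(1,0)$, and a cycle is $i$-orbital if it has the class of the $i$th orbit. $G$ is a properly triangulated toroidal (PTT) graph if all its loops, pairs of parallel edges and separating triangles (triangles that do not bound a face) are non-contractible. A (toroidal) regular edge labeling (REL) $\mathcal L=(L_1,L_2)$ of $G$ colours each edge blue ($L_1$) or red ($L_2$) and directs it, such that clockwise around every vertex there are four non-empty groups: incoming blue, incoming red, outgoing blue, outgoing red edges. $L_i(G)$ is the directed subgraph formed by $L_i$; cycles and closed walks in it are directed. Its dual is directed so that dual edges cross the edges of $L_i(G)$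 from left to right. $\mathcal L$ is realizable if, for both $i\in\{1,2\}$, every edge of $L_i(G)$ lies on a cycle of $L_i(G)$; it is orbital if, for both $i$, every edge of $L_i(G)$ lies on an $i$-orbital cycle of $L_i(G)$. A closed walk is weakly simple if it visits each vertex at most twice and does not cross itself (and is not a shorter closed walk run through repeatedly); it is simple if it visits each vertex at most once. A feedback closed walk in $L_i(G)$ is a non-contractible weakly simple closed walk of $L_i(G)$ that crosses every directed cycle of the dual of $L_i(G)$. Lemma. Let $\mathcal L$ be a realizable REL of a PTT graph $G$ on $\mathbb T$. For each $i\in\{1,2\}$, a feedback closed walk $C$ in $L_i(G)$ exists and can be found in linear time. Moreover, if $\mathcal L$ is orbital, then $C$ can be chosen (and found in linear time) to be simple and $i$-orbital. Here linear time means: for each $i$ there are a fixed program of a random access machine with unit-cost instructions (addition, subtraction, comparison, indirect access) and a constant $c$ such that on every such input the program computes such a walk $C$ (simple and $i$-orbital if $\mathcal L$ is orbital) in at most $cN$ steps, computing only numbers at most $cN$, where $N$ is the number of half-edges of $G$ plus the number of crossings of edges with the two orbits. -/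

import Mathlib

namespace TorusREL

/-! ### Triangulated graphs on the torus, given by a rotation system

A dart is an edge together with one of its two directions. Vertices are the orbits of `rot`, edges
the orbits of `rev`, and faces the orbits of `rot ∘ rev`. Loops and parallel edges are allowed. -/

/-- A connected triangulated graph on the oriented torus. `rot d` is the dart that follows `d` in
clockwise order around the tail of `d`; `rev d` is the reversed dart. -/
structure TorusTriangulation (D : Type) where
  rot : Equiv.Perm D
  rev : Equiv.Perm D
  rev_rev : ∀ d, rev (rev d) = d
  rev_ne : ∀ d, rev d ≠ d
  nonempty : Nonempty D
  connected : ∀ a b : D, Relation.ReflTransGen (fun x y => y = rot x ∨ y = rev x) a b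
  /-- Euler characteristic zero: `|V| + |F| = |E|`. -/
  euler : Nat.card (Quotient (Equiv.Perm.SameCycle.setoid rot))
      + Nat.card (Quotient (Equiv.Perm.SameCycle.setoid (rev.trans rot)))
    = Nat.card (Quotient (Equiv.Perm.SameCycle.setoid rev))
  /-- Every face has exactly three sides. -/
  face_three : ∀ d, rot (rev (rot (rev (rot (rev d))))) = d
  face_ne : ∀ d, rot (rev d) ≠ d

namespace TorusTriangulation

variable {D : Type} (G : TorusTriangulation D)

/-- `G.face d` follows `d` on the (counterclockwise) boundary of the face to the left of `d`. -/
def face : Equiv.Perm D := G.rev.trans G.rot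

/-- The two darts have the same tail. -/
def SameVertex (a b : D) : Prop := G.rot.SameCycle a b

/-- The two darts have the same face to their left. -/
def SameFace (a b : D) : Prop := G.face.SameCycle a b

/-- The darts `a`, `b`, `c` are distinct, have the same tail, and one meets `b` before `c`
when going clockwise from `a`. -/
def Clockwise (a b c : D) : Prop :=
  ∃ i j : ℕ, 0 < i ∧ i < j ∧ G.rot^[i] a = b ∧ G.rot^[j] a = c ∧
    ∀ k, 0 < k → k ≤ j → G.rot^[k] a ≠ a

/-! A point in the interior of an edge is written `(d, t)`, where `t` is its coordinate along the
dart `d` (increasing from the tail of `d` to its head). The same point is `(rev d, -t)`. As a point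
of the boundary of a face, `(d, t)` belongs to the face to the left of `d`. -/

/-- Going counterclockwise around a face from its boundary point `A`, one meets `B` before `C`
(and both before returning to `A`). -/
def Between (A B C : D × ℤ) : Prop :=
  ∃ p q : ℕ, p ≤ 3 ∧ q ≤ 3 ∧ G.face^[p] A.1 = B.1 ∧ G.face^[q] A.1 = C.1 ∧
    (p = 0 → A.2 < B.2) ∧ (p = 3 → B.2 < A.2) ∧
    (q = 0 → A.2 < C.2) ∧ (q = 3 → C.2 < A.2) ∧
    (p < q ∨ (p = q ∧ B.2 < C.2))

/-- The chord from `x.1` to `x.2` of a face crosses the chord from `y.1` to `y.2` of the same face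
from its left to its right. (Seen from `y`, the counterclockwise arc from `y.1` to `y.2` is on
the right.) -/
def ChordCrosses (x y : (D × ℤ) × (D × ℤ)) : Prop :=
  G.Between y.1 x.2 y.2 ∧ ¬ G.Between y.1 x.1 y.2

end TorusTriangulation

/-! ### The embedding on the flat torus -/

/-- The two sides of the flat torus, drawn as closed curves that avoid the vertices:
the meridian (index `0`, directed upwards) and the horizon (index `1`, directed to the right).
Curve `o` crosses `len o` times an edge; its `k`th crossing goes over the dart `dart o k` from the
left to the right, at coordinate `pos o k`. Indices are cyclic. After its `k`th crossing it
runs along a chord of the face to the right of `dart o k`, to its crossing number `k + 1`. -/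
structure Orbits {D : Type} (G : TorusTriangulation D) where
  len : Fin 2 → ℕ
  dart : Fin 2 → ℕ → D
  pos : Fin 2 → ℕ → ℤ
  len_pos : ∀ o, 0 < len o
  dart_add : ∀ o k, dart o (k + len o) = dart o k
  pos_add : ∀ o k, pos o (k + len o) = pos o k
  linked : ∀ o k, G.SameFace (G.rev (dart o k)) (dart o (k + 1))
  /-- The crossings with edges are distinct points. -/
  separate : ∀ o k o' k', k < len o → k' < len o' →
    ((dart o k = dart o' k' ∧ pos o k = pos o' k') ∨
      (dart o k = G.rev (dart o' k') ∧ pos o k = - pos o' k')) → o = o' ∧ k = k'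
  /-- Neither curve crosses itself. -/
  simple : ∀ o k l, k < len o → l < len o → ¬ G.ChordCrosses
    ((G.rev (dart o k), - pos o k), (dart o (k + 1), pos o (k + 1)))
    ((G.rev (dart o l), - pos o l), (dart o (l + 1), pos o (l + 1)))
  /-- The horizon crosses the meridian exactly once from left to right ... -/
  cross_once : ∃! kl : ℕ × ℕ, kl.1 < len 1 ∧ kl.2 < len 0 ∧ G.ChordCrosses
    ((G.rev (dart 1 kl.1), - pos 1 kl.1), (dart 1 (kl.1 + 1), pos 1 (kl.1 + 1)))
    ((G.rev (dart 0 kl.2), - pos 0 kl.2), (dart 0 (kl.2 + 1), pos 0 (kl.2 + 1)))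
  /-- ... and never from right to left. -/
  no_cross_back : ∀ k l, k < len 0 → l < len 1 → ¬ G.ChordCrosses
    ((G.rev (dart 0 k), - pos 0 k), (dart 0 (k + 1), pos 0 (k + 1)))
    ((G.rev (dart 1 l), - pos 1 l), (dart 1 (l + 1), pos 1 (l + 1)))

/-- A closed sequence of darts, with cyclic indices. -/
structure ClosedSeq (D : Type) where
  len : ℕ
  dart : ℕ → D
  len_pos : 0 < len
  dart_add : ∀ k, dart (k + len) = dart k

namespace Orbits

variable {D : Type} [DecidableEq D] {G : TorusTriangulation D} (O : Orbits G)

/-- How often curve `o` crosses the dart `d` from left to right. -/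
def count (o : Fin 2) (d : D) : ℕ :=
  ((Finset.range (O.len o)).filter (fun k => O.dart o k = d)).card

/-- The algebraic crossing numbers `(m, h)` of a dart: how often it crosses the meridian from
left to right, and how often the horizon crosses it from left to right (each minus the number of
crossings in the opposite direction). -/
def dartClass (d : D) : ℤ × ℤ :=
  ((O.count 0 (G.rev d) : ℤ) - O.count 0 d, (O.count 1 d : ℤ) - O.count 1 (G.rev d))

/-- The homotopy class `(m, h)` of a closed walk. The walk is contractible if and only if it
is `(0, 0)`. -/
def homotopyClass (w : ClosedSeq D) : ℤ × ℤ :=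
  ∑ k ∈ Finset.range w.len, O.dartClass (w.dart k)

/-- The homotopy class of the `i`th orbit: `(0, 1)` for the meridian, `(1, 0)` for the horizon. -/
def orbitClass (i : Fin 2) : ℤ × ℤ := if i = 0 then (0, 1) else (1, 0)

/-- Properly triangulated toroidal graph: all loops, parallel edges and separating triangles (closed
walks of three edges that do not bound a face) are non-contractible. -/
structure IsPTT : Prop where
  loop : ∀ d, G.SameVertex d (G.rev d) → O.dartClass d ≠ 0
  parallel : ∀ d e, G.SameVertex d e → G.SameVertex (G.rev d) (G.rev e) → d ≠ e → d ≠ G.rev e →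
    O.dartClass d - O.dartClass e ≠ 0
  triangle : ∀ a b c, G.SameVertex (G.rev a) b → G.SameVertex (G.rev b) c →
    G.SameVertex (G.rev c) a →
    ¬ (G.face a = b ∧ G.face b = c ∧ G.face c = a) →
    ¬ (G.face (G.rev c) = G.rev b ∧ G.face (G.rev b) = G.rev a ∧ G.face (G.rev a) = G.rev c) →
    O.dartClass a + O.dartClass b + O.dartClass c ≠ 0

end Orbits

/-! ### Regular edge labelings -/

/-- The four kinds of edges at a vertex, in clockwise order: incoming blue (`0`), incoming red (`1`),
outgoing blue (`2`), outgoing red (`3`). Colour `0` is blue, colour `1` is red. -/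
def edgeKind (color : Fin 2) (out : Bool) : ZMod 4 :=
  (if color = 0 then 0 else 1) + (if out then 2 else 0)

/-- A toroidal regular edge labeling: `color d` is the colour of the edge of `d`, and `out d` says
that this edge is directed from the tail of `d` to its head. -/
structure REL {D : Type} (G : TorusTriangulation D) where
  color : D → Fin 2
  out : D → Bool
  color_rev : ∀ d, color (G.rev d) = color d
  out_rev : ∀ d, out (G.rev d) = !(out d)
  /-- Clockwise around a vertex, the kind stays the same or changes to the next one (cyclically). -/
  step : ∀ d, edgeKind (color (G.rot d)) (out (G.rot d)) = edgeKind (color d) (out d) ∨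
    edgeKind (color (G.rot d)) (out (G.rot d)) = edgeKind (color d) (out d) + 1
  /-- At every vertex each of the four changes occurs exactly once. -/
  turn : ∀ v, ∀ j : ZMod 4, ∃! d, G.SameVertex v d ∧ edgeKind (color d) (out d) = j ∧
    edgeKind (color (G.rot d)) (out (G.rot d)) = j + 1

namespace ClosedSeq

variable {D : Type} (w : ClosedSeq D) (G : TorusTriangulation D)

/-- Each vertex is visited at most once. -/
def IsSimple : Prop :=
  ∀ p q, p < w.len → q < w.len → G.SameVertex (w.dart p) (w.dart q) → p = q

/-- Each vertex is visited at most twice. -/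
def AtMostTwice : Prop :=
  ∀ v, {p | p < w.len ∧ G.SameVertex v (w.dart p)}.ncard ≤ 2

/-- The directed walk crosses itself at a maximal common subpath of two of its passes: the passes
enter through the different darts `p` and `q`, share the next `l` darts (possibly `l = 0`, a single
vertex), then leave through different darts, and the second pass enters on one side of the first
one and leaves on the other. -/
def CrossesItself : Prop :=
  ∃ p q l : ℕ, w.dart p ≠ w.dart q ∧ G.SameVertex (w.dart (p + 1)) (w.dart (q + 1)) ∧
    (∀ j < l, w.dart (p + 1 + j) = w.dart (q + 1 + j)) ∧
    w.dart (p + 1 + l) ≠ w.dart (q + 1 + l) ∧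
    ¬ (G.Clockwise (G.rev (w.dart p)) (G.rev (w.dart q)) (w.dart (p + 1)) ↔
      G.Clockwise (G.rev (w.dart (p + l))) (w.dart (q + 1 + l)) (w.dart (p + 1 + l)))

/-- The walk repeats a shorter closed walk. -/
def IsRepetition : Prop := ∃ r, 0 < r ∧ r < w.len ∧ ∀ k, w.dart (k + r) = w.dart k

/-- Weakly simple: each vertex is visited at most twice and the walk does not cross itself. A walk
that runs twice around the same cycle is not weakly simple (it is not close to a
simple closed curve). -/
def IsWeaklySimple : Prop := w.AtMostTwice G ∧ ¬ w.CrossesItself G ∧ ¬ w.IsRepetition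

end ClosedSeq

namespace REL

variable {D : Type} {G : TorusTriangulation D} (L : REL G)

/-- `d` is a directed edge of the graph `L_i(G)`. -/
def IsArc (i : Fin 2) (d : D) : Prop := L.color d = i ∧ L.out d = true

/-- `w` is a (directed) closed walk in `L_i(G)`. -/
def IsClosedWalk (i : Fin 2) (w : ClosedSeq D) : Prop :=
  ∀ k, L.IsArc i (w.dart k) ∧ G.SameVertex (G.rev (w.dart k)) (w.dart (k + 1))

/-- `w` is a (directed) cycle in `L_i(G)`. -/
def IsCycle (i : Fin 2) (w : ClosedSeq D) : Prop := L.IsClosedWalk i w ∧ w.IsSimple G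

/-- The darts `a` and `b` have the same face of `L_i(G)` to their left. The faces of `L_i(G)` arise
from those of `G` by joining them across all edges of the other colour. -/
def SameFaceOf (i : Fin 2) (a b : D) : Prop :=
  Relation.EqvGen (fun x y => y = G.face x ∨ (L.color x ≠ i ∧ y = G.rev x)) a b

/-- `w` lists the arcs of `L_i(G)` that are crossed by a directed cycle of the dual of `L_i(G)`.
The dual arc of `d` leads from the face left of `d` to the face right of `d`. -/
def IsDualCycle (i : Fin 2) (w : ClosedSeq D) : Prop :=
  (∀ k, L.IsArc i (w.dart k) ∧ L.SameFaceOf i (G.rev (w.dart k)) (w.dart (k + 1))) ∧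
  ∀ p q, p < w.len → q < w.len → L.SameFaceOf i (w.dart p) (w.dart q) → p = q

/-- No edge is lonely: every edge of `L_i(G)` lies on a cycle of `L_i(G)`, for both `i`. -/
def Realizable : Prop :=
  ∀ i d, L.IsArc i d → ∃ w, L.IsCycle i w ∧ ∃ k, w.dart k = d

variable [DecidableEq D] (O : Orbits G)

/-- Every edge of `L_i(G)` lies on a cycle of `L_i(G)` that is parallel to the `i`th orbit, for
both `i`. -/
def Orbital : Prop :=
  ∀ i d, L.IsArc i d →
    ∃ w, L.IsCycle i w ∧ O.homotopyClass w = Orbits.orbitClass i ∧ ∃ k, w.dart k = d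

/-- Feedback closed walk of `L_i(G)`. A cycle of the dual of `L_i(G)` meets `L_i(G)` only where it
crosses an arc, so it is crossed by `w` if and only if the two have an arc in common. -/
structure IsFeedback (i : Fin 2) (w : ClosedSeq D) : Prop where
  closedWalk : L.IsClosedWalk i w
  weaklySimple : w.IsWeaklySimple G
  nonContractible : O.homotopyClass w ≠ 0
  crosses : ∀ c, L.IsDualCycle i c → ∃ p q, w.dart p = c.dart q

end REL

/-! ### Random access machine with unit-cost instructions -/

/-- A state: the values of the registers, and arrays of numbers indexed by numbers. -/
structure State where
  reg : ℕ → ℕ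
  mem : ℕ → ℕ → ℕ

inductive Test where
  | lt (x y : ℕ)
  | eq (x y : ℕ)

def Test.Holds : Test → State → Prop
  | .lt x y, s => s.reg x < s.reg y
  | .eq x y, s => s.reg x = s.reg y

/-- Programs. Below, `x`, `y`, `z` name registers and `a` names an array; a program mentions only
finitely many of them. -/
inductive Program where
  | skip
  /-- `x := n` -/
  | const (x n : ℕ)
  /-- `x := y` -/
  | move (x y : ℕ)
  /-- `x := y + z` -/
  | add (x y z : ℕ)
  /-- `x := y - z`, or `0` if `y < z` -/
  | sub (x y z : ℕ)
  /-- `x := a[y]` -/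
  | load (x a y : ℕ)
  /-- `a[x] := y` -/
  | store (a x y : ℕ)
  | seq (P Q : Program)
  | ite (b : Test) (P Q : Program)
  | while (b : Test) (P : Program)

namespace State

def setReg (s : State) (x n : ℕ) : State := { s with reg := Function.update s.reg x n }

def setMem (s : State) (a k n : ℕ) : State :=
  { s with mem := Function.update s.mem a (Function.update (s.mem a) k n) }

end State

/-- `Exec W P s s' t`: started in state `s`, the program `P` halts in state `s'` after `t` steps,
where every instruction and every test counts one step, and no number greater than `W` is
ever computed (the machine has words of about `log W` bits). -/
inductive Exec (W : ℕ) : Program → State → State → ℕ → Prop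
  | skip (s) : Exec W .skip s s 1
  | const (s x n) : n ≤ W → Exec W (.const x n) s (s.setReg x n) 1
  | move (s x y) : Exec W (.move x y) s (s.setReg x (s.reg y)) 1
  | add (s x y z) : s.reg y + s.reg z ≤ W →
      Exec W (.add x y z) s (s.setReg x (s.reg y + s.reg z)) 1
  | sub (s x y z) : Exec W (.sub x y z) s (s.setReg x (s.reg y - s.reg z)) 1
  | load (s x a y) : Exec W (.load x a y) s (s.setReg x (s.mem a (s.reg y))) 1
  | store (s a x y) : Exec W (.store a x y) s (s.setMem a (s.reg x) (s.reg y)) 1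
  | seq {P Q s s' s'' t t'} : Exec W P s s' t → Exec W Q s' s'' t' →
      Exec W (.seq P Q) s s'' (t + t')
  | ite_true {b P Q s s' t} : b.Holds s → Exec W P s s' t → Exec W (.ite b P Q) s s' (t + 1)
  | ite_false {b P Q s s' t} : ¬ b.Holds s → Exec W Q s s' t → Exec W (.ite b P Q) s s' (t + 1)
  | while_true {b P s s' s'' t t'} : b.Holds s → Exec W P s s' t →
      Exec W (.while b P) s' s'' t' → Exec W (.while b P) s s'' (t + t' + 1)
  | while_false {b P s} : ¬ b.Holds s → Exec W (.while b P) s s 1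

/-- The array with entries `f 0, …, f (n - 1)`, followed by zeros. -/
def arrayOf {n : ℕ} (f : Fin n → ℕ) (k : ℕ) : ℕ := if h : k < n then f ⟨k, h⟩ else 0

/-- The size of the planarization of `G` and the two orbits, up to constant factors: the number of
darts plus the number of crossings of edges with orbits. -/
def inputSize {n : ℕ} {G : TorusTriangulation (Fin n)} (O : Orbits G) : ℕ :=
  n + O.len 0 + O.len 1

/-- The input: registers `0`, `1`, `2` hold the number of darts and the numbers of crossings of
meridian and horizon with edges; arrays `0` and `1` hold the rotation system, arrays `2` and `3`
colours and orientations, and arrays `4` and `5` the darts that are crossed by meridian and horizon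
(from left to right), in the order along these curves. -/
def inputState {n : ℕ} {G : TorusTriangulation (Fin n)} (O : Orbits G) (L : REL G) : State where
  reg := fun
    | 0 => n
    | 1 => O.len 0
    | 2 => O.len 1
    | _ => 0
  mem := fun
    | 0 => arrayOf fun d => (G.rot d : ℕ)
    | 1 => arrayOf fun d => (G.rev d : ℕ)
    | 2 => arrayOf fun d => (L.color d : ℕ)
    | 3 => arrayOf fun d => if L.out d then 1 else 0
    | 4 => arrayOf fun k : Fin (O.len 0) => (O.dart 0 k : ℕ)
    | 5 => arrayOf fun k : Fin (O.len 1) => (O.dart 1 k : ℕ)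
    | _ => fun _ => 0

/-- The output: register `0` holds the length of `w`, array `6` its darts. -/
def State.Outputs {n : ℕ} (s : State) (w : ClosedSeq (Fin n)) : Prop :=
  s.reg 0 = w.len ∧ ∀ k < w.len, s.mem 6 k = (w.dart k : ℕ)

end TorusREL

/-! The classes of the directed closed walks of `L_i(G)` generate a cone in the homology of the
torus. A cycle of the dual defines a linear functional that is nonnegative on this cone and, by
realizability, positive somewhere on it. A closed walk with no arc on the dual cycle has value zero,
so a closed walk whose class lies in the relative interior of the cone meets every dual cycle
(`REL.exists_common_arc`).

Topology enters through rational cohomology. By a dimension count with the Euler characteristic, the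
crossing numbers with the two orbits span the first cohomology (`IsCocycle.decomposition`,
`form_crossing`). A cycle pushed off to its left is therefore cohomologous to a combination of them
whose coefficients are read off from its class (`REL.IsCycle.push_eq`), and signed crossings can be
counted locally. At a vertex the two colours alternate, so arcs of one colour cross a cycle of the
other colour in one direction only. With realizability this makes all directed closed walks of one
colour non-contractible and the classes of cycles primitive.

The boundary of the cone is reached by a cycle `a` that always leaves through the leftmost arc and a
cycle `b` that always enters through the leftmost arc: no arc of colour `i` leaves `a` to the left
or reaches `b` from the left. If their classes are parallel, all classes are parallel and `a` is a
solution. Otherwise take `p` parallel copies of `a` and `q` of `b`, and let them exchange their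
continuations so that they never cross. A single strand of this system has a class parallel to `p[a]
+ q[b]` (`Strands.sum_weighted`), hence in the interior of the cone. For `p = q = 1` a strand visits
a vertex at most twice and is weakly simple.

In the orbital case `p` and `q` are chosen so that `p[a] + q[b]` does not intersect the `i`th orbit;
this sum is then the determinant of `[a]` and `[b]` times the orbit class. The determinant is at
least `p + q` (`Strands.orbital_bounds`), which forces a strand to be simple
(`Strands.isSimple_walk`); primitivity and the direction of orbital cycles then identify its class.
Every object involved is obtained by traversing orbits of maps on the darts, so a constant number of
linear loops suffices. -/

namespace TorusREL

/-! ### Simplicial cohomology of the torus and its intersection form. -/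

namespace TorusTriangulation

variable {D : Type} (G : TorusTriangulation D)

theorem face_apply (d : D) : G.face d = G.rot (G.rev d) := rfl

theorem face_face_face (d : D) : G.face (G.face (G.face d)) = d := G.face_three d

theorem face_rev (d : D) : G.face (G.rev d) = G.rot d := by
  rw [face_apply, G.rev_rev]

theorem face_face (d : D) : G.face (G.face d) = G.rev (G.rot.symm d) := by
  apply G.face.injective
  rw [face_face_face, face_rev, Equiv.apply_symm_apply]

/-- Simplicial cocycles of the triangulation. -/
structure IsCocycle (α : D → ℚ) : Prop where
  anti : ∀ d, α (G.rev d) = - α d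
  closed : ∀ d, α d + α (G.face d) + α (G.face (G.face d)) = 0

variable {G}

theorem IsCocycle.add {α β : D → ℚ} (hα : G.IsCocycle α) (hβ : G.IsCocycle β) :
    G.IsCocycle (fun d => α d + β d) where
  anti d := by simp only [hα.anti, hβ.anti]; ring
  closed d := by linear_combination hα.closed d + hβ.closed d

theorem IsCocycle.smul {α : D → ℚ} (u : ℚ) (hα : G.IsCocycle α) :
    G.IsCocycle (fun d => u * α d) where
  anti d := by simp only [hα.anti]; ring
  closed d := by linear_combination u * hα.closed d

/-- The coboundary of a function on the vertices. -/
theorem isCocycle_coboundary {f : D → ℚ} (hf : ∀ d, f (G.rot d) = f d) :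
    G.IsCocycle (fun d => f (G.rev d) - f d) where
  anti d := by simp only [G.rev_rev]; ring
  closed d := by
    have h (d) : f (G.face d) = f (G.rev d) := hf _
    have h3 := h (G.face (G.face d))
    rw [G.face_face_face] at h3
    linear_combination -h3 - h d - h (G.face d)

theorem const_of_invariant {X : Type*} {f : D → X} (h₁ : ∀ d, f (G.rot d) = f d)
    (h₂ : ∀ d, f (G.rev d) = f d) (a b : D) : f a = f b := by
  induction G.connected a b with
  | refl => rfl
  | tail _ h ih => rcases h with rfl | rfl <;> simp [ih, h₁, h₂]

/-- A circulation `π`, pushed off to the left, is dual to the cocycle `d ↦ ℓ (rev d) - ℓ d`. -/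
theorem isCocycle_push {π ℓ : D → ℚ}
    (h : ∀ d, ℓ d - ℓ (G.rot d) = π (G.rot d) - π (G.rev d)) :
    G.IsCocycle (fun d => ℓ (G.rev d) - ℓ d) where
  anti d := by simp only [G.rev_rev]; ring
  closed d := by
    have h' (d) : ℓ (G.rev d) - ℓ (G.face d) = π (G.face d) - π d := by
      have := h (G.rev d)
      rw [G.rev_rev] at this
      exact this
    have h3 := h' (G.face (G.face d))
    rw [G.face_face_face] at h3
    linear_combination h3 + h' d + h' (G.face d)

section Quotients

variable (G)

abbrev Vertices := Quotient (Equiv.Perm.SameCycle.setoid G.rot)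
abbrev Faces := Quotient (Equiv.Perm.SameCycle.setoid (G.rev.trans G.rot))
abbrev Edges := Quotient (Equiv.Perm.SameCycle.setoid G.rev)

/-- Sums of a coboundary, a dual coboundary, and multiples of `μ` and `η`. -/
def decompose (μ η : D → ℚ) :
    ((G.Vertices → ℚ) × (G.Faces → ℚ) × ℚ × ℚ) →ₗ[ℚ] (D → ℚ) where
  toFun x d := x.1 ⟦G.rev d⟧ - x.1 ⟦d⟧ + (x.2.1 ⟦d⟧ - x.2.1 ⟦G.rev d⟧)
    + x.2.2.1 * μ d + x.2.2.2 * η d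
  map_add' x y := by ext d; simp; ring
  map_smul' c x := by ext d; simp; ring

variable {G}

theorem Vertices.rot (f : G.Vertices → ℚ) (d : D) : f ⟦G.rot d⟧ = f ⟦d⟧ := by
  congr 1
  exact Quotient.sound (Equiv.Perm.sameCycle_apply_left.2 (Equiv.Perm.SameCycle.refl _ _))

theorem Faces.face (f : G.Faces → ℚ) (d : D) : f ⟦G.face d⟧ = f ⟦d⟧ := by
  congr 1
  exact Quotient.sound (Equiv.Perm.sameCycle_apply_left.2 (Equiv.Perm.SameCycle.refl _ _))

theorem sameCycle_rev {a b : D} (h : G.rev.SameCycle a b) : b = a ∨ b = G.rev a := by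
  obtain ⟨k, rfl⟩ := h
  have h2 : G.rev ^ (2 : ℤ) = 1 := by
    ext d; simp [pow_two, zpow_ofNat, G.rev_rev]
  obtain ⟨m, rfl | rfl⟩ := k.even_or_odd'
  · left; simp [zpow_mul, h2]
  · right; simp [zpow_add, zpow_mul, h2]

theorem anti_eq_zero_of_edges {α : D → ℚ} (hα : ∀ d, α (G.rev d) = - α d)
    (h : ∀ e : G.Edges, α e.out = 0) (d : D) : α d = 0 := by
  have h1 : G.rev.SameCycle (⟦d⟧ : G.Edges).out d :=
    Quotient.mk_out (s := Equiv.Perm.SameCycle.setoid G.rev) d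
  rcases sameCycle_rev h1 with h2 | h2
  · rw [h2]; exact h _
  · rw [h2, hα, h, neg_zero]

variable {μ η : D → ℚ}

theorem decompose_anti (hμ : G.IsCocycle μ) (hη : G.IsCocycle η) (x) (d : D) :
    G.decompose μ η x (G.rev d) = - G.decompose μ η x d := by
  simp [decompose, G.rev_rev, hμ.anti, hη.anti]; ring

end Quotients

variable [Fintype D]

variable (G) in
/-- The intersection form: (three times) the antisymmetrized cup product. -/
def form (α β : D → ℚ) : ℚ := ∑ d, (α d * β (G.face d) - α (G.face d) * β d)

theorem form_swap (α β : D → ℚ) : G.form α β = - G.form β α := by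
  simp only [form, ← Finset.sum_neg_distrib]
  exact Finset.sum_congr rfl fun d _ => by ring

theorem form_self (α : D → ℚ) : G.form α α = 0 := by
  have := G.form_swap α α; linarith

theorem form_add (α α' β : D → ℚ) :
    G.form (fun d => α d + α' d) β = G.form α β + G.form α' β := by
  simp only [form, ← Finset.sum_add_distrib]
  exact Finset.sum_congr rfl fun d _ => by ring

theorem form_smul (u : ℚ) (α β : D → ℚ) : G.form (fun d => u * α d) β = u * G.form α β := by
  simp only [form, Finset.mul_sum]
  exact Finset.sum_congr rfl fun d _ => by ring

theorem form_eq (α β : D → ℚ) :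
    G.form α β = ∑ d, α d * (β (G.face d) - β (G.face (G.face d))) := by
  have h : ∑ d, α (G.face d) * β d = ∑ d, α d * β (G.face (G.face d)) := by
    rw [← Equiv.sum_comp G.face (fun d => α d * β (G.face (G.face d)))]
    simp only [face_face_face]
  simp only [form, Finset.sum_sub_distrib, h, mul_sub]

/-- Closedness of `β` on the two faces along an edge turns face neighbours into rotation neighbours.
Since `ℓ` is arbitrary on darts, this serves both coboundaries of vertex functions and cycles pushed
off to one side. -/
theorem form_corner {α β ℓ : D → ℚ} (hβ : G.IsCocycle β)
    (hα : ∀ d, α d = ℓ (G.rev d) - ℓ d) :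
    G.form α β = 2 * ∑ d, ℓ d * (β (G.rot d) - β (G.rot.symm d)) := by
  have h (γ : D → ℚ) : ∑ d, ℓ (G.rev d) * γ d = ∑ d, ℓ d * γ (G.rev d) := by
    rw [← Equiv.sum_comp G.rev (fun d => ℓ d * γ (G.rev d))]
    simp only [G.rev_rev]
  rw [form_eq]
  simp only [hα, sub_mul, Finset.sum_sub_distrib]
  rw [h (fun d => β (G.face d) - β (G.face (G.face d))), ← Finset.sum_sub_distrib, Finset.mul_sum]
  refine Finset.sum_congr rfl fun d _ => ?_
  have h1 := hβ.closed d
  have h2 := hβ.closed (G.rev d)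
  have h3 : β (G.face (G.face d)) = - β (G.rot.symm d) := by rw [face_face, hβ.anti]
  simp only [G.face_rev, hβ.anti] at h2 ⊢
  linear_combination ℓ d * (2 * h3 - h1 - h2)

/-- In the corner formula, the differences of `β` cancel around each vertex because `f` is constant
there. Hence `form` depends only on cohomology classes. -/
theorem form_coboundary {f β : D → ℚ} (hf : ∀ d, f (G.rot d) = f d) (hβ : G.IsCocycle β) :
    G.form (fun d => f (G.rev d) - f d) β = 0 := by
  rw [form_corner hβ (fun d => rfl)]
  simp only [mul_sub, Finset.sum_sub_distrib]
  rw [← Equiv.sum_comp G.rot (fun d => f d * β (G.rot.symm d)),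
    ← Equiv.sum_comp G.rot.symm (fun d => f d * β (G.rot d))]
  have h (d) : f (G.rot.symm d) = f d := by simpa using (hf (G.rot.symm d)).symm
  simp [h, hf]

/-- Poincaré duality at the level of cochains: pairing with the dual cocycle of a circulation is
integration along it. The factor 6 comes from three corners per face and the antisymmetrization; it
reappears in `form_crossing` and cancels. -/
theorem form_push {π ℓ β : D → ℚ} (hβ : G.IsCocycle β)
    (h : ∀ d, ℓ d - ℓ (G.rot d) = π (G.rot d) - π (G.rev d)) :
    G.form (fun d => ℓ (G.rev d) - ℓ d) β = 6 * ∑ d, π d * β d := by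
  have e1 : ∑ d, ℓ d * β (G.rot d) = ∑ d, ℓ (G.rot.symm d) * β d := by
    rw [← Equiv.sum_comp G.rot.symm (fun d => ℓ d * β (G.rot d))]; simp
  have e2 : ∑ d, ℓ d * β (G.rot.symm d) = ∑ d, ℓ (G.rot d) * β d := by
    rw [← Equiv.sum_comp G.rot (fun d => ℓ d * β (G.rot.symm d))]; simp
  have e3 : ∑ d, π (G.rot d) * β d = ∑ d, π d * β (G.rot.symm d) := by
    rw [← Equiv.sum_comp G.rot (fun d => π d * β (G.rot.symm d))]; simp
  have e4 : ∑ d, π (G.rev d) * β d = - ∑ d, π d * β d := by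
    rw [← Equiv.sum_comp G.rev (fun d => π d * β d), ← Finset.sum_neg_distrib]
    exact Finset.sum_congr rfl fun d _ => by rw [hβ.anti]; ring
  have e5 : ∑ d, π (G.rev (G.rot.symm d)) * β d = ∑ d, π d * β (G.face d) := by
    rw [← Equiv.sum_comp G.face (fun d => π (G.rev (G.rot.symm d)) * β d)]
    simp only [← face_face, face_face_face]
  have e6 (d) : ℓ (G.rot.symm d) - ℓ d = π d - π (G.rev (G.rot.symm d)) := by
    simpa using h (G.rot.symm d)
  have e7 : ∑ d, π d * β (G.rot.symm d) - ∑ d, π d * β (G.face d) = ∑ d, π d * β d := by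
    rw [← Finset.sum_sub_distrib]
    refine Finset.sum_congr rfl fun d _ => ?_
    have h1 := hβ.closed d
    rw [face_face, hβ.anti] at h1
    linear_combination (- π d) * h1
  rw [form_corner hβ (fun d => rfl)]
  simp only [mul_sub, Finset.sum_sub_distrib]
  have e8 : ∑ d, ℓ (G.rot.symm d) * β d - ∑ d, ℓ (G.rot d) * β d =
      ∑ d, π d * β d - ∑ d, π (G.rev (G.rot.symm d)) * β d
        + (∑ d, π (G.rot d) * β d - ∑ d, π (G.rev d) * β d) := by
    simp only [← Finset.sum_sub_distrib, ← Finset.sum_add_distrib]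
    exact Finset.sum_congr rfl fun d _ => by linear_combination β d * (e6 d + h d)
  rw [e1, e2]
  linear_combination 2 * e8 + 2 * (e3 - e4 - e5) + 2 * e7

/-- A cocycle that is also a dual coboundary vanishes. -/
theorem IsCocycle.eq_zero_of_dual {c g : D → ℚ} (hc : G.IsCocycle c)
    (hg : ∀ d, g (G.face d) = g d) (h : ∀ d, c d = g d - g (G.rev d)) (d : D) : c d = 0 := by
  have e1 : ∑ d, g d * c (G.face d) = ∑ d, g d * c d := by
    rw [← Equiv.sum_comp G.face (fun d => g d * c d)]; simp only [hg]
  have e2 : ∑ d, g d * c (G.face (G.face d)) = ∑ d, g d * c d := by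
    rw [← e1, ← Equiv.sum_comp G.face (fun d => g d * c (G.face d))]; simp only [hg]
  have e3 : ∑ d, g d * c d = 0 := by
    have : ∑ d, g d * (c d + c (G.face d) + c (G.face (G.face d))) = 0 := by
      simp [hc.closed]
    simp only [mul_add, Finset.sum_add_distrib, e1, e2] at this
    linarith
  have e4 : ∑ d, g (G.rev d) * c d = - ∑ d, g d * c d := by
    rw [← Equiv.sum_comp G.rev (fun d => g d * c d), ← Finset.sum_neg_distrib]
    exact Finset.sum_congr rfl fun d _ => by rw [hc.anti]; ring
  -- Summation by parts makes the squared norm of `c` a pairing of `g` with the face sums of `c`,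
  -- which vanish. Positivity of squares over `ℚ` finishes.
  have e5 : ∑ d, c d * c d = 0 := by
    have : ∑ d, c d * c d = ∑ d, g d * c d - ∑ d, g (G.rev d) * c d := by
      rw [← Finset.sum_sub_distrib]
      exact Finset.sum_congr rfl fun d _ => by linear_combination c d * h d
    rw [this, e4, e3]; simp
  have := (Finset.sum_eq_zero_iff_of_nonneg (fun d _ => mul_self_nonneg (c d))).1 e5 d
    (Finset.mem_univ _)
  exact mul_self_eq_zero.1 this

/-! ### The first cohomology has dimension two. -/

section Decomposition

variable {μ η : D → ℚ}

/-- The dual coboundary in the decomposition of a cocycle is a difference of cocycles, so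
`IsCocycle.eq_zero_of_dual` kills it. -/
theorem decompose_closed (hμ : G.IsCocycle μ) (hη : G.IsCocycle η) {φ : D → ℚ}
    (hφ : G.IsCocycle φ) {x} (hx : G.decompose μ η x = φ) (d : D) :
    x.2.1 ⟦d⟧ = x.2.1 ⟦G.rev d⟧ := by
  have hc : G.IsCocycle (fun d => x.2.1 ⟦d⟧ - x.2.1 ⟦G.rev d⟧) := by
    have := (hφ.add ((isCocycle_coboundary (f := fun d => x.1 ⟦d⟧) (Vertices.rot _)).smul (-1))).add
      ((hμ.smul (- x.2.2.1)).add (hη.smul (- x.2.2.2)))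
    convert this using 2 with d
    rw [← hx]
    simp [decompose]
    ring
  have := hc.eq_zero_of_dual (g := fun d => x.2.1 ⟦d⟧) (Faces.face _) (fun _ => rfl) d
  exact sub_eq_zero.1 this

theorem decompose_coeff (hμ : G.IsCocycle μ) (hη : G.IsCocycle η) {φ : D → ℚ}
    (hφ : G.IsCocycle φ) {x} (hx : G.decompose μ η x = φ) :
    (∀ d, φ d = x.2.2.1 * μ d + x.2.2.2 * η d + (x.1 ⟦G.rev d⟧ - x.1 ⟦d⟧)) ∧
    G.form φ η = x.2.2.1 * G.form μ η ∧ G.form φ μ = - x.2.2.2 * G.form μ η := by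
  have h (d) : φ d = x.2.2.1 * μ d + x.2.2.2 * η d + (x.1 ⟦G.rev d⟧ - x.1 ⟦d⟧) := by
    have := decompose_closed hμ hη hφ hx d
    rw [← hx]
    simp [decompose]
    linear_combination this
  refine ⟨h, ?_, ?_⟩
  · rw [show φ = _ from funext h, form_add,
      form_coboundary (f := fun d => x.1 ⟦d⟧) (Vertices.rot _) hη,
      form_add, form_smul, form_smul, form_self]
    ring
  · rw [show φ = _ from funext h, form_add,
      form_coboundary (f := fun d => x.1 ⟦d⟧) (Vertices.rot _) hμ,
      form_add, form_smul, form_smul, form_self, form_swap η μ]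
    ring

/-- The source has dimension `|V| + |F| + 2`. By connectedness and `hκ`, only a constant on vertices
together with a constant on faces is mapped to zero, so the rank is at least `|V| + |F|`. This
equals `|E|`, the dimension of the space of antisymmetric functions. -/
theorem decompose_surjective (hμ : G.IsCocycle μ) (hη : G.IsCocycle η) (hκ : G.form μ η ≠ 0)
    {φ : D → ℚ} (hφ : ∀ d, φ (G.rev d) = - φ d) : ∃ x, G.decompose μ η x = φ := by
  classical
  have := Fintype.ofFinite G.Vertices
  have := Fintype.ofFinite G.Faces
  have := Fintype.ofFinite G.Edges
  -- An antisymmetric function is determined by its values on one chosen dart per edge.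
  let R : (D → ℚ) →ₗ[ℚ] (G.Edges → ℚ) := LinearMap.funLeft ℚ ℚ Quotient.out
  let T := R ∘ₗ G.decompose μ η
  let K : (ℚ × ℚ) →ₗ[ℚ] ((G.Vertices → ℚ) × (G.Faces → ℚ) × ℚ × ℚ) :=
    { toFun := fun c => (fun _ => c.1, fun _ => c.2, 0, 0)
      map_add' := fun a b => by ext <;> simp
      map_smul' := fun a b => by ext <;> simp }
  have hker : LinearMap.ker T ≤ LinearMap.range K := by
    intro x hx
    have hx0 : G.decompose μ η x = fun _ => 0 :=
      funext fun d => anti_eq_zero_of_edges (decompose_anti hμ hη x) (fun e => congr_fun hx e) d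
    have h0 : G.IsCocycle (fun _ => 0) := ⟨by simp, by simp⟩
    obtain ⟨h1, h2, h3⟩ := decompose_coeff hμ hη h0 hx0
    have h4 := decompose_closed hμ hη h0 hx0
    have hz (β) : G.form (fun _ => 0) β = 0 := by simp [form]
    rw [hz] at h2 h3
    have hu : x.2.2.1 = 0 := by
      rcases mul_eq_zero.1 h2.symm with h | h
      · exact h
      · exact absurd h hκ
    have hv : x.2.2.2 = 0 := by
      rcases mul_eq_zero.1 h3.symm with h | h
      · exact neg_eq_zero.1 h
      · exact absurd h hκ
    obtain ⟨d₀⟩ := G.nonempty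
    refine ⟨(x.1 ⟦d₀⟧, x.2.1 ⟦d₀⟧), ?_⟩
    refine Prod.ext (funext fun v => ?_) (Prod.ext (funext fun v => ?_)
      (Prod.ext hu.symm hv.symm))
    · induction v using Quotient.inductionOn with | _ d =>
      refine const_of_invariant (G := G) (f := fun d => x.1 ⟦d⟧) (Vertices.rot _) (fun d => ?_) d₀ d
      have := h1 d
      rw [hu, hv] at this
      linarith
    · induction v using Quotient.inductionOn with | _ d =>
      refine const_of_invariant (G := G) (f := fun d => x.2.1 ⟦d⟧) (fun d => ?_)
        (fun d => (h4 d).symm) d₀ d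
      have := Faces.face x.2.1 (G.rev d)
      rw [face_rev] at this
      exact this.trans (h4 d).symm
  have hk2 : Module.finrank ℚ (LinearMap.ker T) ≤ 2 := by
    refine (Submodule.finrank_mono hker).trans ((LinearMap.finrank_range_le K).trans ?_)
    simp
  have hrn := LinearMap.finrank_range_add_finrank_ker T
  have heu : Nat.card G.Vertices + Nat.card G.Faces = Nat.card G.Edges := G.euler
  have htop : LinearMap.range T = ⊤ := by
    apply Submodule.eq_top_of_finrank_eq
    apply le_antisymm (Submodule.finrank_le _)
    rw [Nat.card_eq_fintype_card, Nat.card_eq_fintype_card, Nat.card_eq_fintype_card] at heu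
    simp only [Module.finrank_prod, Module.finrank_fintype_fun_eq_card,
        Module.finrank_self] at hrn ⊢
    omega
  obtain ⟨x, hx⟩ : R φ ∈ LinearMap.range T := htop ▸ Submodule.mem_top
  refine ⟨x, funext fun d => sub_eq_zero.1 ?_⟩
  refine anti_eq_zero_of_edges (α := fun d => G.decompose μ η x d - φ d) (fun d => ?_)
    (fun e => sub_eq_zero.2 (congr_fun hx e)) d
  simp only [decompose_anti hμ hη, hφ]
  ring

/-- Two cocycles with non-zero intersection form span the first cohomology of the torus. -/
theorem IsCocycle.decomposition (hμ : G.IsCocycle μ) (hη : G.IsCocycle η) (hκ : G.form μ η ≠ 0)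
    {φ : D → ℚ} (hφ : G.IsCocycle φ) :
    ∃ f : D → ℚ, (∀ d, f (G.rot d) = f d) ∧ ∀ d, G.form μ η * φ d =
      G.form φ η * μ d - G.form φ μ * η d + (f (G.rev d) - f d) := by
  obtain ⟨x, hx⟩ := decompose_surjective hμ hη hκ hφ.anti
  obtain ⟨h1, h2, h3⟩ := decompose_coeff hμ hη hφ hx
  refine ⟨fun d => G.form μ η * x.1 ⟦d⟧, fun d => by simp only [Vertices.rot], fun d => ?_⟩
  rw [h1, h2, h3]
  ring

end Decomposition

end TorusTriangulation

/-! ### Cyclic order on the boundary of a face, and crossings of chords. -/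

/-- `a`, `b`, `c` are distinct and in cyclic order. -/
def Cyc {α : Type*} [LinearOrder α] (a b c : α) : Prop :=
  (a < b ∧ b < c) ∨ (b < c ∧ c < a) ∨ (c < a ∧ a < b)

theorem cyc_cross {α : Type*} [LinearOrder α] {a b c d : α} (h₁ : a ≠ c) (h₂ : b ≠ d) :
    (Cyc a c b ∧ ¬ Cyc a d b) ↔ (Cyc c b d ∧ ¬ Cyc c a d) := by
  unfold Cyc
  grind

namespace TorusTriangulation

variable {D : Type} (G : TorusTriangulation D)

theorem face_iterate_mod (k : ℕ) (x : D) : G.face^[k % 3] x = G.face^[k] x := by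
  have : Function.IsPeriodicPt G.face 3 x := G.face_face_face x
  exact this.iterate_mod_apply k

theorem face_face_ne (d : D) : G.face (G.face d) ≠ d := by
  intro h
  have := G.face_face_face d
  rw [h] at this
  exact G.face_ne d this

theorem face_iterate_inj {k l : ℕ} (x : D) :
    G.face^[k] x = G.face^[l] x ↔ k % 3 = l % 3 := by
  rw [← face_iterate_mod, ← G.face_iterate_mod l]
  have h1 : G.face x ≠ x := G.face_ne x
  have h2 := G.face_face_ne x
  have h3 : G.face (G.face x) ≠ G.face x := G.face_ne _
  have hk := Nat.mod_lt k (show 0 < 3 by norm_num)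
  have hl := Nat.mod_lt l (show 0 < 3 by norm_num)
  generalize k % 3 = k at *
  generalize l % 3 = l at *
  interval_cases k <;> interval_cases l <;> simp [h1, h2, h3, h1.symm, h2.symm, h3.symm]

theorem sameFace_iff {x y : D} : G.SameFace x y ↔ ∃ s < 3, G.face^[s] x = y := by
  constructor
  · rintro ⟨k, rfl⟩
    have h3 : G.face ^ (3 : ℤ) = 1 := by
      ext d; simp [zpow_ofNat, pow_succ, G.face_face_face]
    refine ⟨(k % 3).toNat, by omega, ?_⟩
    have hk : k = 3 * (k / 3) + ((k % 3).toNat : ℤ) := by omega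
    conv_rhs => rw [hk, zpow_add, zpow_mul, h3, one_zpow, one_mul, zpow_natCast]
    rw [Equiv.Perm.iterate_eq_pow]
  · rintro ⟨s, -, rfl⟩
    rw [Equiv.Perm.iterate_eq_pow]
    exact ⟨s, by simp⟩

theorem Between.sameFace {A B C : D × ℤ} {G : TorusTriangulation D} (h : G.Between A B C) :
    G.SameFace A.1 B.1 := by
  obtain ⟨p, q, -, -, h, -⟩ := h
  rw [← h, Equiv.Perm.iterate_eq_pow]
  exact ⟨p, by simp⟩

/-- Numbering the sides of the face from `x` cuts its boundary open: points become pairs in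
lexicographic order, and cyclic statements become linear arithmetic. -/
theorem between_iff (x : D) {a b c : ℕ} (ha : a < 3) (hb : b < 3) (hc : c < 3) (r s t : ℤ) :
    G.Between (G.face^[a] x, r) (G.face^[b] x, s) (G.face^[c] x, t) ↔
      Cyc (toLex (a, r)) (toLex (b, s)) (toLex (c, t)) := by
  simp only [Between, Cyc, Prod.Lex.toLex_lt_toLex, ← Function.iterate_add_apply, face_iterate_inj]
  constructor
  · rintro ⟨p, q, hp, hq, h⟩
    omega
  · intro h
    refine ⟨if a < b ∨ (a = b ∧ r < s) then b - a else b + 3 - a,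
      if a < c ∨ (a = c ∧ r < t) then c - a else c + 3 - a, ?_⟩
    split_ifs <;> omega

/-- Exchanging two chords reverses the sign of their crossing. This lets `no_cross_back` be used
with the chords of the meridian held fixed. -/
theorem chordCrosses_swap {x y : (D × ℤ) × (D × ℤ)} (hx : G.SameFace x.1.1 x.2.1)
    (hy : G.SameFace y.1.1 y.2.1) (h₁ : y.1 ≠ x.1) (h₂ : y.2 ≠ x.2) :
    (G.Between y.1 x.1 y.2 ∧ ¬ G.Between y.1 x.2 y.2) ↔ G.ChordCrosses y x := by
  obtain ⟨⟨a, s₁⟩, ⟨b, s₂⟩⟩ := x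
  obtain ⟨⟨c, t₁⟩, ⟨d, t₂⟩⟩ := y
  dsimp only at *
  by_cases h : G.SameFace c a
  · obtain ⟨k, hk, rfl⟩ := G.sameFace_iff.1 h
    obtain ⟨l, hl, rfl⟩ := G.sameFace_iff.1 hy
    obtain ⟨j, hj, rfl⟩ := G.sameFace_iff.1 (h.trans hx)
    have key (u v : ℕ) (p q : ℤ) (hh : (G.face^[u] c, p) ≠ (G.face^[v] c, q)) :
        toLex (u, p) ≠ toLex (v, q) := by
      intro h'
      simp only [EmbeddingLike.apply_eq_iff_eq, Prod.mk.injEq] at h'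
      exact hh (by rw [h'.1, h'.2])
    simp only [ChordCrosses]
    rw [show G.Between (c, t₁) = G.Between (G.face^[0] c, t₁) from rfl,
      show (c, t₁) = (G.face^[0] c, t₁) from rfl,
      G.between_iff c (by norm_num) hk hl, G.between_iff c (by norm_num) hj hl,
      G.between_iff c hk hl hj, G.between_iff c hk (by norm_num) hj]
    exact cyc_cross (key _ _ _ _ h₁) (key _ _ _ _ h₂)
  · constructor
    · exact fun h' => absurd h'.1.sameFace h
    · exact fun h' => absurd (hy.trans h'.1.sameFace.symm) h

open Classical in
theorem sum_face_eq [DecidableEq D] (a d : D) : ((if a = d then 1 else 0)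
    + (if a = G.face d then 1 else 0) + (if a = G.face (G.face d) then 1 else 0) : ℚ) =
      if G.SameFace d a then 1 else 0 := by
  by_cases hs : G.SameFace d a
  · obtain ⟨s, hs3, rfl⟩ := G.sameFace_iff.1 hs
    have h0 := G.face_iterate_inj (k := s) (l := 0) d
    have h1 := G.face_iterate_inj (k := s) (l := 1) d
    have h2 := G.face_iterate_inj (k := s) (l := 2) d
    simp only [Function.iterate_zero_apply, Function.iterate_succ_apply'] at h0 h1 h2
    simp only [h0, h1, h2, hs]
    interval_cases s <;> simp
  · have hn (s : ℕ) (h : a = G.face^[s] d) : False :=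
      hs (h ▸ ⟨s, by simp [Equiv.Perm.iterate_eq_pow]⟩)
    have h0 : a ≠ d := hn 0
    have h1 : a ≠ G.face d := hn 1
    have h2 : a ≠ G.face (G.face d) := hn 2
    simp [h0, h1, h2, hs]

open Classical in
/-- The boundary points `Y`, `Z` of a face split its boundary; a point `X` lies between them if it
follows `Y` on its side, precedes `Z` on its side, or lies on a side in between. -/
theorem between_eq_sum [DecidableEq D] {X Y Z : D × ℤ} (hYZ : G.SameFace Y.1 Z.1) (h₁ : X ≠ Y)
    (h₂ : X ≠ Z)
    (h₃ : Y ≠ Z) :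
    (if G.Between Y X Z then 1 else 0 : ℚ) =
      (if X.1 = Y.1 ∧ Y.2 < X.2 then 1 else 0) + (if X.1 = Z.1 ∧ X.2 < Z.2 then 1 else 0)
      + (if Z.1 = Y.1 then
            if Y.2 < Z.2 then - (if X.1 = Y.1 then 1 else 0)
            else (if X.1 = G.face Y.1 then 1 else 0) + (if X.1 = G.face (G.face Y.1) then 1 else 0)
          else if Z.1 = G.face Y.1 then 0 else (if X.1 = G.face Y.1 then 1 else 0)) := by
  obtain ⟨x, s⟩ := X
  obtain ⟨y, t⟩ := Y
  obtain ⟨z, u⟩ := Z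
  dsimp only at *
  obtain ⟨j, hj, rfl⟩ := G.sameFace_iff.1 hYZ
  by_cases h : G.SameFace y x
  · obtain ⟨k, hk, rfl⟩ := G.sameFace_iff.1 h
    have e0 (k) : G.face^[k] y = y ↔ k % 3 = 0 := G.face_iterate_inj (l := 0) y
    have e1 (k) : G.face^[k] y = G.face y ↔ k % 3 = 1 := G.face_iterate_inj (l := 1) y
    have e2 (k) : G.face^[k] y = G.face (G.face y) ↔ k % 3 = 2 := G.face_iterate_inj (l := 2) y
    simp only [ne_eq, Prod.mk.injEq, e2, e0, e1, face_iterate_inj, eq_comm (a := y)] at h₁ h₂ h₃ ⊢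
    rw [show (y, t) = (G.face^[0] y, t) from rfl, G.between_iff y (by norm_num) hk hj]
    simp only [Cyc, Prod.Lex.toLex_lt_toLex]
    interval_cases j <;> interval_cases k <;> simp at h₁ h₂ h₃ ⊢ <;> grind
  · have hx (k) : x ≠ G.face^[k] y := by
      rintro rfl
      exact h ⟨k, by simp [Equiv.Perm.iterate_eq_pow]⟩
    have h0 := hx 0
    have h1 := hx 1
    have h2 := hx 2
    have hn : ¬ G.Between (y, t) (x, s) (G.face^[j] y, u) := fun h' => h h'.sameFace
    simp only [Function.iterate_zero_apply, Function.iterate_succ_apply'] at h0 h1 h2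
    simp [hn, hx, h0, h1, h2]

end TorusTriangulation

theorem sum_range_shift {M : Type*} [AddCommGroup M] {n : ℕ} {F : ℕ → M} (h : F n = F 0) :
    ∑ k ∈ Finset.range n, F (k + 1) = ∑ k ∈ Finset.range n, F k := by
  have := (Finset.sum_range_succ' F n).symm.trans (Finset.sum_range_succ F n)
  rw [h] at this
  exact add_right_cancel this

/-! ### The orbits as cocycles, and their intersection number. -/

namespace Orbits

variable {D : Type} {G : TorusTriangulation D} (O : Orbits G)

/-- A crossing of a curve with an edge, as a point at which the curve leaves a face. -/
def exitPt (o : Fin 2) (k : ℕ) : D × ℤ := (O.dart o k, O.pos o k)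

/-- A crossing of a curve with an edge, as a point at which the curve enters a face. -/
def entryPt (o : Fin 2) (k : ℕ) : D × ℤ := (G.rev (O.dart o k), - O.pos o k)

theorem dart_mod (o : Fin 2) (k : ℕ) : O.dart o (k % O.len o) = O.dart o k :=
  Function.Periodic.map_mod_nat (O.dart_add o) k

theorem pos_mod (o : Fin 2) (k : ℕ) : O.pos o (k % O.len o) = O.pos o k :=
  Function.Periodic.map_mod_nat (O.pos_add o) k

theorem separate_mod {o o' : Fin 2} {k k' : ℕ}
    (h : O.exitPt o k = O.exitPt o' k' ∨ O.exitPt o k = O.entryPt o' k') :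
    o = o' ∧ k % O.len o = k' % O.len o' := by
  apply O.separate o _ o' _ (Nat.mod_lt _ (O.len_pos o)) (Nat.mod_lt _ (O.len_pos o'))
  simpa only [dart_mod, pos_mod, exitPt, entryPt, Prod.mk.injEq] using h

theorem exitPt_ne_entryPt (o o' : Fin 2) (k k' : ℕ) : O.exitPt o k ≠ O.entryPt o' k' := by
  intro h
  obtain ⟨rfl, h2⟩ := O.separate_mod (Or.inr h)
  have h3 := congr_arg Prod.fst h
  simp only [exitPt, entryPt] at h3
  rw [← O.dart_mod o k, h2, O.dart_mod] at h3
  exact G.rev_ne _ h3.symm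

theorem exitPt_ne_exitPt {o o' : Fin 2} (ho : o ≠ o') (k k' : ℕ) :
    O.exitPt o k ≠ O.exitPt o' k' := fun h => ho (O.separate_mod (Or.inl h)).1

theorem entryPt_ne_entryPt {o o' : Fin 2} (ho : o ≠ o') (k k' : ℕ) :
    O.entryPt o k ≠ O.entryPt o' k' := by
  intro h
  refine O.exitPt_ne_exitPt ho k k' ?_
  simpa only [entryPt, exitPt, Prod.mk.injEq, EmbeddingLike.apply_eq_iff_eq, neg_inj] using h

/-- The signed sum of `F` over the crossings of a curve with edges, seen from both sides. -/
def flux (o : Fin 2) (F : D × ℤ → ℚ) : ℚ :=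
  ∑ k ∈ Finset.range (O.len o), (F (O.exitPt o k) - F (O.entryPt o k))

theorem flux_add (o : Fin 2) (F F' : D × ℤ → ℚ) :
    O.flux o (fun X => F X + F' X) = O.flux o F + O.flux o F' := by
  simp only [flux, ← Finset.sum_add_distrib]
  exact Finset.sum_congr rfl fun d _ => by ring

theorem flux_neg (o : Fin 2) (F : D × ℤ → ℚ) : O.flux o (fun X => - F X) = - O.flux o F := by
  simp only [flux, ← Finset.sum_neg_distrib]
  exact Finset.sum_congr rfl fun d _ => by ring

theorem flux_congr (o : Fin 2) {F F' : D × ℤ → ℚ} (h₁ : ∀ k, F (O.exitPt o k) = F' (O.exitPt o k))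
    (h₂ : ∀ k, F (O.entryPt o k) = F' (O.entryPt o k)) : O.flux o F = O.flux o F' := by
  simp only [flux, h₁, h₂]

/-- Regrouping by chords instead of crossings: the points where a curve enters and next leaves a
face are compared. Hence a function that depends only on the face has no flux. -/
theorem flux_shift (o : Fin 2) (F : D × ℤ → ℚ) :
    O.flux o F = ∑ k ∈ Finset.range (O.len o), (F (O.exitPt o (k + 1)) - F (O.entryPt o k)) := by
  have : F (O.exitPt o (O.len o)) = F (O.exitPt o 0) := by
    have h1 := O.dart_add o 0
    have h2 := O.pos_add o 0
    simp only [zero_add] at h1 h2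
    simp only [exitPt, h1, h2]
  rw [Finset.sum_sub_distrib, sum_range_shift (F := fun k => F (O.exitPt o k)) this, flux,
    Finset.sum_sub_distrib]

theorem flux_sameFace (o : Fin 2) (c : D → ℚ) (hc : ∀ a b, G.SameFace a b → c a = c b) :
    O.flux o (fun X => c X.1) = 0 := by
  rw [flux_shift]
  exact Finset.sum_eq_zero fun k _ => sub_eq_zero.2 (hc _ _ (O.linked o k)).symm

-- For a chord of each orbit, the difference of the indicator at the two ends of the horizon chord
-- is their signed crossing number. The axioms of `Orbits` leave a single nonzero term, equal to 1.
open Classical in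
theorem sum_between_eq_one : ∑ k ∈ Finset.range (O.len 0), O.flux 1
    (fun X => if G.Between (O.entryPt 0 k) X (O.exitPt 0 (k + 1)) then 1 else 0) = 1 := by
  have h01 : (0 : Fin 2) ≠ 1 := by decide
  obtain ⟨⟨l₀, k₀⟩, ⟨hl₀, hk₀, hc₀⟩, huniq⟩ := O.cross_once
  have key (k l : ℕ) (hk : k < O.len 0) (hl : l < O.len 1) :
      ((if G.Between (O.entryPt 0 k) (O.exitPt 1 (l + 1)) (O.exitPt 0 (k + 1)) then 1 else 0)
        - (if G.Between (O.entryPt 0 k) (O.entryPt 1 l) (O.exitPt 0 (k + 1)) then 1 else 0) : ℚ)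
      = if k = k₀ ∧ l = l₀ then 1 else 0 := by
    have hback := O.no_cross_back k l hk hl
    have hsw := G.chordCrosses_swap (x := (O.entryPt 1 l, O.exitPt 1 (l + 1)))
      (y := (O.entryPt 0 k, O.exitPt 0 (k + 1))) (O.linked 1 l) (O.linked 0 k)
      (O.entryPt_ne_entryPt h01 _ _) (O.exitPt_ne_exitPt h01 _ _)
    have hcr : (G.Between (O.entryPt 0 k) (O.exitPt 1 (l + 1)) (O.exitPt 0 (k + 1)) ∧
        ¬ G.Between (O.entryPt 0 k) (O.entryPt 1 l) (O.exitPt 0 (k + 1))) ↔ k = k₀ ∧ l = l₀ := by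
      constructor
      · intro h
        have := huniq (l, k) ⟨hl, hk, h⟩
        simp only [Prod.mk.injEq] at this
        exact this.symm
      · rintro ⟨rfl, rfl⟩
        exact hc₀
    have hback' := mt hsw.1 hback
    dsimp only at hback'
    rw [if_congr hcr.symm rfl rfl]
    by_cases h1 : G.Between (O.entryPt 0 k) (O.exitPt 1 (l + 1)) (O.exitPt 0 (k + 1)) <;>
    by_cases h2 : G.Between (O.entryPt 0 k) (O.entryPt 1 l) (O.exitPt 0 (k + 1)) <;>
    simp [h1, h2] at hback' ⊢
  simp only [flux_shift]
  rw [Finset.sum_congr rfl fun k hk => Finset.sum_congr rfl fun l hl =>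
    key k l (Finset.mem_range.1 hk) (Finset.mem_range.1 hl)]
  rw [Finset.sum_eq_single k₀, Finset.sum_eq_single l₀]
  · simp
  · intro l _ hl; simp [hl]
  · intro h; exact absurd (Finset.mem_range.2 hl₀) h
  · intro k _ hk; simp [hk]
  · intro h; exact absurd (Finset.mem_range.2 hk₀) h

variable [DecidableEq D]

/-- How often curve `o` crosses the dart `d` from left to right, minus the number of crossings in
the other direction. -/
def crossing (o : Fin 2) (d : D) : ℚ := (O.count o d : ℚ) - O.count o (G.rev d)

theorem dartClass_fst (d : D) : ((O.dartClass d).1 : ℚ) = - O.crossing 0 d := by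
  simp [dartClass, crossing]

theorem dartClass_snd (d : D) : ((O.dartClass d).2 : ℚ) = O.crossing 1 d := by
  simp [dartClass, crossing]

theorem crossing_eq_flux (o : Fin 2) (d : D) :
    O.crossing o d = O.flux o (fun X => if X.1 = d then 1 else 0) := by
  have h (k) : G.rev (O.dart o k) = d ↔ O.dart o k = G.rev d := by
    constructor
    · rintro rfl; rw [G.rev_rev]
    · intro h; rw [h, G.rev_rev]
  change _ = ∑ k ∈ Finset.range (O.len o), ((if O.dart o k = d then 1 else 0)
    - (if G.rev (O.dart o k) = d then 1 else 0))
  simp only [crossing, count, Finset.sum_sub_distrib, Finset.sum_boole, h]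

/-- A closed curve enters and leaves each face equally often: this is the vanishing of the flux of
the indicator of the face. -/
theorem isCocycle_crossing (o : Fin 2) : G.IsCocycle (O.crossing o) where
  anti d := by simp only [crossing, G.rev_rev]; ring
  closed d := by
    classical
    have h := O.flux_sameFace o (fun a => if G.SameFace d a then 1 else 0) (fun a b h => by
      have : G.SameFace d a ↔ G.SameFace d b := ⟨fun h' => h'.trans h, fun h' => h'.trans h.symm⟩
      simp only [this])
    simp only [crossing_eq_flux, ← flux_add]
    refine Eq.trans ?_ h
    exact O.flux_congr o (fun k => G.sum_face_eq _ _)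
      (fun k => G.sum_face_eq _ _)

/-- The signed number of crossings of curve `o` with the part of a dart before a point. -/
def before (o : Fin 2) (Z : D × ℤ) : ℚ :=
  O.flux o (fun X => if X.1 = Z.1 ∧ X.2 < Z.2 then 1 else 0)

theorem flux_after (o : Fin 2) (d : D) (t : ℤ) :
    O.flux o (fun X => if X.1 = G.rev d ∧ - t < X.2 then 1 else 0) = - O.before o (d, t) := by
  simp only [before, flux, ← Finset.sum_neg_distrib]
  refine Finset.sum_congr rfl fun k _ => ?_
  have h (a) : G.rev a = d ↔ a = G.rev d := by
    constructor
    · rintro rfl; rw [G.rev_rev]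
    · rintro rfl; rw [G.rev_rev]
  change ((if O.dart o k = G.rev d ∧ - t < O.pos o k then 1 else 0)
    - (if G.rev (O.dart o k) = G.rev d ∧ - t < - O.pos o k then 1 else 0) : ℚ)
    = - ((if O.dart o k = d ∧ O.pos o k < t then 1 else 0)
    - (if G.rev (O.dart o k) = d ∧ - O.pos o k < t then 1 else 0))
  simp only [h, EmbeddingLike.apply_eq_iff_eq, neg_lt_neg_iff, neg_lt (b := t)]
  ring

/-- The contribution of one chord of the meridian to the intersection number, written so that the
terms with `before` and `crossing` telescope along the closed meridian, while the remaining ones add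
up to `form`. The factor 6 clears the denominators. -/
theorem flux_between (k : ℕ) :
    6 * O.flux 1 (fun X => open Classical in
      if G.Between (O.entryPt 0 k) X (O.exitPt 0 (k + 1)) then 1 else 0) =
    6 * (O.before 1 (O.exitPt 0 (k + 1)) - O.before 1 (O.exitPt 0 k))
    + 3 * (O.crossing 1 (O.dart 0 k) - O.crossing 1 (O.dart 0 (k + 1)))
    - ((O.crossing 1 (G.face (O.dart 0 (k + 1))) -
      O.crossing 1 (G.face (G.face (O.dart 0 (k + 1)))))
      - (O.crossing 1 (G.face (G.rev (O.dart 0 k)))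
        - O.crossing 1 (G.face (G.face (G.rev (O.dart 0 k)))))) := by
  classical
  have h01 : (0 : Fin 2) ≠ 1 := by decide
  have hl := O.linked 0 k
  have hβ := O.isCocycle_crossing 1
  rw [O.flux_congr 1 (F' := fun X =>
      (if X.1 = (O.entryPt 0 k).1 ∧ (O.entryPt 0 k).2 < X.2 then 1 else 0)
      + (if X.1 = (O.exitPt 0 (k + 1)).1 ∧ X.2 < (O.exitPt 0 (k + 1)).2 then 1 else 0)
      + (if (O.exitPt 0 (k + 1)).1 = (O.entryPt 0 k).1 then
          if (O.entryPt 0 k).2 < (O.exitPt 0 (k + 1)).2 then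
            - (if X.1 = (O.entryPt 0 k).1 then 1 else 0)
          else (if X.1 = G.face (O.entryPt 0 k).1 then 1 else 0)
            + (if X.1 = G.face (G.face (O.entryPt 0 k).1) then 1 else 0)
        else if (O.exitPt 0 (k + 1)).1 = G.face (O.entryPt 0 k).1 then 0
          else (if X.1 = G.face (O.entryPt 0 k).1 then 1 else 0)))
    (fun l => G.between_eq_sum (Y := O.entryPt 0 k) (Z := O.exitPt 0 (k + 1)) hl
      (O.exitPt_ne_entryPt 1 0 l k) (O.exitPt_ne_exitPt h01.symm l (k + 1))
      (O.exitPt_ne_entryPt 0 0 (k + 1) k).symm)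
    (fun l => G.between_eq_sum (Y := O.entryPt 0 k) (Z := O.exitPt 0 (k + 1)) hl
      (O.entryPt_ne_entryPt h01.symm l k) (O.exitPt_ne_entryPt 0 1 (k + 1) l).symm
      (O.exitPt_ne_entryPt 0 0 (k + 1) k).symm)]
  have e1 : O.flux 1 (fun X => if X.1 = (O.entryPt 0 k).1 ∧ (O.entryPt 0 k).2 < X.2 then 1 else 0)
      = - O.before 1 (O.exitPt 0 k) := O.flux_after 1 _ _
  rw [flux_add, flux_add, e1]
  change 6 * (_ + O.before 1 (O.exitPt 0 (k + 1)) + _) = _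
  have ha := hβ.anti (O.dart 0 k)
  have hc := hβ.closed (G.rev (O.dart 0 k))
  have h1 : G.face (G.rev (O.dart 0 k)) ≠ G.rev (O.dart 0 k) := G.face_ne _
  have h2 := G.face_face_ne (G.rev (O.dart 0 k))
  have h3 : G.face (G.face (G.rev (O.dart 0 k))) ≠ G.face (G.rev (O.dart 0 k)) := G.face_ne _
  obtain ⟨s, hs, hy⟩ := G.sameFace_iff.1 hl
  have hx : (O.entryPt 0 k).1 = G.rev (O.dart 0 k) := rfl
  have hz : (O.exitPt 0 (k + 1)).1 = O.dart 0 (k + 1) := rfl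
  simp only [hx, hz, ← hy]
  -- The three possible positions of the exit side relative to the entry side; for `s = 0` the chord
  -- returns to the side through which it entered.
  interval_cases s
  · simp only [Function.iterate_zero_apply, if_true]
    split_ifs
    · rw [flux_neg, ← crossing_eq_flux]
      linear_combination - 3 * ha
    · rw [flux_add, ← crossing_eq_flux, ← crossing_eq_flux]
      linear_combination 6 * hc - 3 * ha
  · simp only [Function.iterate_one, h1, if_true, if_false]
    have : O.flux 1 (fun _ => 0) = 0 := by simp [flux]
    rw [this, G.face_face_face]
    linear_combination 2 * hc - 3 * ha
  · simp only [Function.iterate_succ_apply', Function.iterate_zero_apply, h2, h3, if_false,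
      G.face_face_face]
    rw [← crossing_eq_flux]
    linear_combination 4 * hc - 3 * ha

variable [Fintype D]

theorem sum_crossing_mul (o : Fin 2) (g : D → ℚ) :
    ∑ d, O.crossing o d * g d = O.flux o (fun X => g X.1) := by
  simp only [crossing_eq_flux, flux, Finset.sum_mul]
  rw [Finset.sum_comm]
  refine Finset.sum_congr rfl fun k _ => ?_
  simp [sub_mul, Finset.sum_sub_distrib]

/-- The single crossing of the two orbits, summed over the chords of the meridian with all
telescoping terms removed. -/
theorem form_crossing : G.form (O.crossing 0) (O.crossing 1) = - 6 := by
  rw [TorusTriangulation.form_eq, sum_crossing_mul, flux_shift]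
  have h := O.sum_between_eq_one
  have per {F : D × ℤ → ℚ} : F (O.exitPt 0 (O.len 0)) = F (O.exitPt 0 0) := by
    have h1 := O.dart_add 0 0
    have h2 := O.pos_add 0 0
    simp only [zero_add] at h1 h2
    simp only [exitPt, h1, h2]
  have s1 := sum_range_shift (F := fun k => O.before 1 (O.exitPt 0 k)) per
  have s2 := sum_range_shift (F := fun k => O.crossing 1 (O.dart 0 k))
    (per (F := fun X => O.crossing 1 X.1))
  have h6 := congr_arg (fun z => 6 * z) h
  simp only [Finset.mul_sum] at h6
  simp only [flux_between, Finset.sum_sub_distrib, Finset.sum_add_distrib, ← Finset.mul_sum, s1,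
    s2] at h6
  simp only [exitPt, entryPt, Finset.sum_sub_distrib]
  linarith

end Orbits

/-! ### Cochains summed along closed walks. -/

namespace ClosedSeq

variable {D : Type} (w : ClosedSeq D)

/-- The sum of a cochain along a closed walk. -/
def sum (β : D → ℚ) : ℚ := ∑ k ∈ Finset.range w.len, β (w.dart k)

/-- Consecutive darts meet in a vertex. -/
def IsWalk (G : TorusTriangulation D) : Prop :=
  ∀ k, G.SameVertex (G.rev (w.dart k)) (w.dart (k + 1))

theorem dart_mod (k : ℕ) : w.dart (k % w.len) = w.dart k :=
  Function.Periodic.map_mod_nat w.dart_add k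

theorem sum_add (α β : D → ℚ) : w.sum (fun d => α d + β d) = w.sum α + w.sum β :=
  Finset.sum_add_distrib

theorem sum_sub (α β : D → ℚ) : w.sum (fun d => α d - β d) = w.sum α - w.sum β :=
  Finset.sum_sub_distrib ..

theorem sum_mul (u : ℚ) (α : D → ℚ) : w.sum (fun d => u * α d) = u * w.sum α :=
  (Finset.mul_sum ..).symm

theorem exists_lt (k : ℕ) : ∃ p < w.len, w.dart p = w.dart k :=
  ⟨k % w.len, Nat.mod_lt _ w.len_pos, w.dart_mod k⟩

theorem sum_pos {β : D → ℚ} (h : ∀ k, 0 ≤ β (w.dart k)) {k : ℕ} (hk : 0 < β (w.dart k)) :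
    0 < w.sum β := by
  obtain ⟨p, hp, e⟩ := w.exists_lt k
  exact Finset.sum_pos' (fun _ _ => h _) ⟨p, Finset.mem_range.2 hp, e ▸ hk⟩

theorem sum_nonneg {β : D → ℚ} (h : ∀ k, 0 ≤ β (w.dart k)) : 0 ≤ w.sum β :=
  Finset.sum_nonneg fun _ _ => h _

theorem sum_coboundary {G : TorusTriangulation D} (hw : w.IsWalk G) {f : D → ℚ}
    (hf : ∀ a b, G.SameVertex a b → f a = f b) : w.sum (fun d => f (G.rev d) - f d) = 0 := by
  have h0 : w.dart w.len = w.dart 0 := by simpa using w.dart_add 0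
  have h := sum_range_shift (n := w.len) (F := fun k => f (w.dart k)) (congr_arg f h0)
  simp only [sum, Finset.sum_sub_distrib, hf _ _ (hw _), h, sub_self]

variable {w} {G : TorusTriangulation D}

theorem IsSimple.mod_eq (h : w.IsSimple G) {p q : ℕ} (hpq : G.SameVertex (w.dart p) (w.dart q)) :
    p % w.len = q % w.len := by
  apply h _ _ (Nat.mod_lt _ w.len_pos) (Nat.mod_lt _ w.len_pos)
  rwa [dart_mod, dart_mod]

theorem dart_eq_of_mod {p q : ℕ} (h : p % w.len = q % w.len) : w.dart p = w.dart q := by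
  rw [← dart_mod, h, dart_mod]

theorem exists_pred (w : ClosedSeq D) (k : ℕ) : ∃ p, w.dart (p + 1) = w.dart k := by
  refine ⟨k + (w.len - 1), ?_⟩
  have := w.len_pos
  rw [show k + (w.len - 1) + 1 = k + w.len by omega, w.dart_add]

end ClosedSeq

theorem TorusTriangulation.sameVertex_iterate {D : Type} (G : TorusTriangulation D) (k : ℕ)
    (d : D) : G.SameVertex d (G.rot^[k] d) := ⟨k, by simp [Equiv.Perm.iterate_eq_pow]⟩

theorem TorusTriangulation.eq_of_sameVertex {D : Type} {G : TorusTriangulation D} {X : Type*}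
    [Finite D] {f : D → X} (hf : ∀ d, f (G.rot d) = f d) {a b : D} (h : G.SameVertex a b) :
    f a = f b := by
  obtain ⟨k, -, rfl⟩ := h.exists_pow_eq'
  induction k with
  | zero => rfl
  | succ k ih =>
    rw [pow_succ', Equiv.Perm.mul_apply, hf, ← ih ⟨k, by simp⟩]

/-! ### The four groups of edges at a vertex as intervals of a linear order. -/

namespace REL

variable {D : Type} {G : TorusTriangulation D} (L : REL G) (i : Fin 2)

/-- The four groups of edges at a vertex in clockwise order, starting with the incoming edges
of colour `i`. -/
def phase (d : D) : ℕ := (edgeKind (L.color d) (L.out d) - edgeKind i false).val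

theorem phase_lt (d : D) : L.phase i d < 4 := ZMod.val_lt _

theorem phase_eq_two {d : D} : L.phase i d = 2 ↔ L.IsArc i d := by
  unfold phase IsArc
  generalize L.color d = c
  generalize L.out d = b
  revert i c b; decide

theorem phase_eq_zero {d : D} : L.phase i d = 0 ↔ L.IsArc i (G.rev d) := by
  unfold phase IsArc
  rw [L.color_rev, L.out_rev]
  generalize L.color d = c
  generalize L.out d = b
  revert i c b; decide

theorem phase_rot (d : D) : L.phase i (G.rot d) = L.phase i d ∨
    L.phase i (G.rot d) = (L.phase i d + 1) % 4 := by
  have h := L.step d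
  unfold phase
  generalize edgeKind (L.color (G.rot d)) (L.out (G.rot d)) = k at *
  generalize edgeKind (L.color d) (L.out d) = l at *
  rcases h with rfl | rfl
  · left; rfl
  · right; revert i l; decide

/-- Every change of the group occurs exactly once at a vertex. -/
theorem exists_unique_turn (v : D) {p : ℕ} (hp : p < 4) : ∃! d, G.SameVertex v d ∧
    L.phase i d = p ∧ L.phase i (G.rot d) = (p + 1) % 4 := by
  have h := L.turn v ((p : ZMod 4) + edgeKind i false)
  refine (existsUnique_congr fun d => and_congr_right fun _ => ?_).1 h
  unfold phase
  generalize edgeKind (L.color (G.rot d)) (L.out (G.rot d)) = k at *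
  generalize edgeKind (L.color d) (L.out d) = l at *
  clear h
  interval_cases p <;> revert i k l <;> decide

/-- The first dart of the group of incoming edges of colour `i`. -/
noncomputable def first (d : D) : D :=
  G.rot (L.exists_unique_turn i d (show 3 < 4 by norm_num)).choose

theorem first_spec (d : D) : G.SameVertex d (L.first i d) ∧ L.phase i (L.first i d) = 0 ∧
    L.phase i (G.rot.symm (L.first i d)) = 3 := by
  obtain ⟨h1, h2, h3⟩ := (L.exists_unique_turn i d (show 3 < 4 by norm_num)).choose_spec.1
  refine ⟨Equiv.Perm.sameCycle_apply_right.2 h1, h3, ?_⟩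
  rw [first, Equiv.symm_apply_apply, h2]

theorem eq_first {d e : D} (h : G.SameVertex d e) (h3 : L.phase i e = 3)
    (h0 : L.phase i (G.rot e) = 0) : G.rot e = L.first i d := by
  have := (L.exists_unique_turn i d (show 3 < 4 by norm_num)).choose_spec.2 e ⟨h, h3, h0⟩
  rw [first, ← this]

theorem first_eq {a b : D} (h : G.SameVertex a b) : L.first i a = L.first i b := by
  obtain ⟨h1, h2, h3⟩ := L.first_spec i a
  have := L.eq_first i (d := b) (e := G.rot.symm (L.first i a))
    (h.symm.trans (Equiv.Perm.sameCycle_apply_right.1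
      (by rwa [Equiv.apply_symm_apply]))) h3 (by simpa using h2)
  simpa using this

variable [Finite D]

/-- The number of edges at the tail of a dart. -/
noncomputable def deg (d : D) : ℕ := Function.minimalPeriod G.rot (L.first i d)

omit [Finite D] in
theorem deg_eq {a b : D} (h : G.SameVertex a b) : L.deg i a = L.deg i b := by
  rw [deg, L.first_eq i h, deg]

theorem mem_periodicPts (d : D) : d ∈ Function.periodicPts G.rot :=
  Function.Injective.mem_periodicPts G.rot.injective d

theorem deg_pos (d : D) : 0 < L.deg i d :=
  Function.minimalPeriod_pos_of_mem_periodicPts (mem_periodicPts _)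

theorem exists_index (d : D) : ∃ k < L.deg i d, G.rot^[k] (L.first i d) = d := by
  obtain ⟨k, -, hk⟩ := (L.first_spec i d).1.symm.exists_pow_eq'
  refine ⟨k % L.deg i d, Nat.mod_lt _ (L.deg_pos i d), ?_⟩
  rw [deg, Function.iterate_mod_minimalPeriod_eq, Equiv.Perm.iterate_eq_pow, hk]

/-- The position of a dart in clockwise order around its tail, starting with the group of
incoming edges of colour `i`. -/
noncomputable def index (d : D) : ℕ := (L.exists_index i d).choose

theorem index_lt (d : D) : L.index i d < L.deg i d := (L.exists_index i d).choose_spec.1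

theorem rot_index (d : D) : G.rot^[L.index i d] (L.first i d) = d :=
  (L.exists_index i d).choose_spec.2

theorem index_eq {d : D} {k : ℕ} (h : G.rot^[k] (L.first i d) = d) :
    L.index i d = k % L.deg i d := by
  have h' := h.trans (L.rot_index i d).symm
  rw [← Function.iterate_mod_minimalPeriod_eq] at h'
  exact (Function.iterate_injOn_Iio_minimalPeriod (Nat.mod_lt _ (L.deg_pos i d))
    (L.index_lt i d) h').symm

theorem index_rot_iterate (k : ℕ) (d : D) :
    L.index i (G.rot^[k] d) = (L.index i d + k) % L.deg i d := by
  have hs : G.SameVertex d (G.rot^[k] d) :=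
      G.sameVertex_iterate k _
  rw [L.deg_eq i hs]
  apply index_eq
  rw [← L.first_eq i hs, add_comm, Function.iterate_add_apply, rot_index]

theorem index_inj {a b : D} (h : G.SameVertex a b) : L.index i a = L.index i b ↔ a = b := by
  constructor
  · intro h'
    rw [← L.rot_index i a, ← L.rot_index i b, h', L.first_eq i h]
  · rintro rfl; rfl

/-- The phase can only drop from 3 to 0, and by uniqueness of that turn it does so only on reaching
`first`, where the index restarts at 0. So incoming arcs of colour `i` have smaller indices than
outgoing ones. -/
theorem phase_mono {a b : D} (h : G.SameVertex a b) (hab : L.index i a ≤ L.index i b) :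
    L.phase i a ≤ L.phase i b := by
  have key (k : ℕ) : L.index i a + k < L.deg i a →
      L.phase i a ≤ L.phase i (G.rot^[k] a) := by
    induction k with
    | zero => intro _; simp
    | succ k ih =>
      intro hk
      refine (ih (by omega)).trans ?_
      rw [Function.iterate_succ_apply']
      have h4 := L.phase_lt i (G.rot^[k] a)
      rcases L.phase_rot i (G.rot^[k] a) with h1 | h1
      · exact h1.ge
      · by_cases h3 : L.phase i (G.rot^[k] a) = 3
        · rw [h3] at h1
          have hs : G.SameVertex a (G.rot^[k] a) :=
      G.sameVertex_iterate k _
          have h5 := L.eq_first i hs h3 h1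
          rw [← Function.iterate_succ_apply' (f := G.rot)] at h5
          have h6 := L.index_rot_iterate i (k + 1) a
          have h7 : L.index i (L.first i a) = 0 := by
            have := L.index_eq i (d := L.first i a) (k := 0)
              (L.first_eq i (L.first_spec i a).1).symm
            simpa using this
          rw [Nat.succ_eq_add_one] at h5
          rw [h5, h7, Nat.mod_eq_of_lt hk] at h6
          omega
        · rw [h1, Nat.mod_eq_of_lt (by omega)]; omega
  have hb := L.index_lt i b
  rw [← L.deg_eq i h] at hb
  have := key (L.index i b - L.index i a) (by omega)
  convert this
  rw [← L.index_inj i (h.symm.trans (G.sameVertex_iterate _ a)),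
    index_rot_iterate, Nat.mod_eq_of_lt (by omega)]
  omega

theorem index_lt_of_phase_lt {a b : D} (h : G.SameVertex a b)
    (hab : L.phase i a < L.phase i b) : L.index i a < L.index i b := by
  by_contra h'
  exact absurd (L.phase_mono i h.symm (not_lt.1 h')) (not_le.2 hab)

theorem clockwise_iff {a b c : D} (hb : G.SameVertex a b) (hc : G.SameVertex a c) :
    G.Clockwise a b c ↔ Cyc (L.index i a) (L.index i b) (L.index i c) := by
  have hla := L.index_lt i a
  have hlb := L.index_lt i b
  have hlc := L.index_lt i c
  rw [← L.deg_eq i hb] at hlb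
  rw [← L.deg_eq i hc] at hlc
  have key (k : ℕ) {x : D} (hx : G.SameVertex a x) :
      G.rot^[k] a = x ↔ (L.index i a + k) % L.deg i a = L.index i x := by
    have hs : G.SameVertex a (G.rot^[k] a) :=
      G.sameVertex_iterate k _
    rw [← index_rot_iterate, L.index_inj i (hs.symm.trans hx)]
  have ha : G.SameVertex a a := Equiv.Perm.SameCycle.refl _ _
  simp only [TorusTriangulation.Clockwise, key _ hb, key _ hc, ne_eq, key _ ha]
  generalize L.index i a = α at *
  generalize L.index i b = β at *
  generalize L.index i c = γ at *
  generalize L.deg i a = N at *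
  have hmod (k : ℕ) (hk : k < N) : (α + k) % N = if α + k < N then α + k else α + k - N := by
    split_ifs with h
    · exact Nat.mod_eq_of_lt h
    · rw [Nat.mod_eq_sub_mod (by omega), Nat.mod_eq_of_lt (by omega)]
  constructor
  · rintro ⟨p, q, h0, hpq, h1, h2, h3⟩
    have hq : q < N := by
      by_contra hq
      exact h3 N (by omega) (by omega) (by rw [Nat.add_mod_right, Nat.mod_eq_of_lt hla])
    rw [hmod _ (by omega)] at h1 h2
    unfold Cyc
    split_ifs at h1 h2 <;> omega
  · intro h
    unfold Cyc at h
    refine ⟨if α < β then β - α else β + N - α, if α < γ then γ - α else γ + N - α, ?_, ?_, ?_, ?_,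
      fun k hk hk' => ?_⟩
    · split_ifs <;> omega
    · split_ifs <;> omega
    · rw [hmod _ (by split_ifs <;> omega)]; split_ifs <;> omega
    · rw [hmod _ (by split_ifs <;> omega)]; split_ifs <;> omega
    · have : k < N := by split_ifs at hk' <;> omega
      rw [hmod _ this]
      split_ifs <;> omega

end REL

/-! ### Cycles of one colour pushed off to their left. -/

namespace REL

variable {D : Type} {G : TorusTriangulation D} (L : REL G) (i : Fin 2)

open Classical in
/-- The indicator function of the set of darts of a closed walk. -/
noncomputable def _root_.TorusREL.ClosedSeq.indicator (w : ClosedSeq D) (d : D) : ℚ :=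
  if ∃ k, w.dart k = d then 1 else 0

theorem _root_.TorusREL.ClosedSeq.sum_indicator [Fintype D] {w : ClosedSeq D} (hw : w.IsSimple G)
    (β : D → ℚ) : ∑ d, w.indicator d * β d = w.sum β := by
  classical
  simp only [ClosedSeq.indicator, ite_mul, one_mul, zero_mul, ← Finset.sum_filter, ClosedSeq.sum]
  refine (Finset.sum_bij (fun k _ => w.dart k) (fun k _ => ?_) (fun p hp q hq h => ?_)
    (fun d hd => ?_) (fun _ _ => rfl)).symm
  · simp
  · exact hw p q (Finset.mem_range.1 hp) (Finset.mem_range.1 hq)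
      (h ▸ Equiv.Perm.SameCycle.refl _ _)
  · obtain ⟨k, rfl⟩ := (Finset.mem_filter.1 hd).2
    obtain ⟨p, hp, e⟩ := w.exists_lt k
    exact ⟨p, Finset.mem_range.2 hp, e⟩

theorem IsClosedWalk.isWalk {L : REL G} {i : Fin 2} {w : ClosedSeq D} (h : L.IsClosedWalk i w) :
    w.IsWalk G := fun k => (h k).2

variable [Finite D]

open Classical in
/-- The indicator function of the darts that leave a closed walk to its left. -/
noncomputable def leftOf (w : ClosedSeq D) (d : D) : ℚ :=
  if ∃ k, G.SameVertex d (w.dart (k + 1)) ∧ L.index i (G.rev (w.dart k)) < L.index i d ∧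
    L.index i d < L.index i (w.dart (k + 1)) then 1 else 0

theorem leftOf_nonneg (w : ClosedSeq D) (d : D) : 0 ≤ L.leftOf i w d := by
  unfold leftOf; split_ifs <;> simp

variable {L i} {w : ClosedSeq D} (hw : L.IsCycle i w)

theorem leftOf_eq_zero {d : D} (h : ∀ k, ¬ G.SameVertex d (w.dart k)) : L.leftOf i w d = 0 :=
  if_neg fun ⟨_, hk, _⟩ => h _ hk

include hw

omit [Finite D] in
theorem IsCycle.isWalk : w.IsWalk G := hw.1.isWalk

omit [Finite D] in
theorem IsCycle.dart_eq_pred {k m : ℕ}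
    (h : G.SameVertex (w.dart (m + 1)) (w.dart (k + 1))) : w.dart m = w.dart k :=
  ClosedSeq.dart_eq_of_mod (Nat.ModEq.add_right_cancel' 1 (hw.2.mod_eq h))

theorem IsCycle.leftOf_eq {d : D} {k : ℕ} (h : G.SameVertex d (w.dart (k + 1))) :
    L.leftOf i w d = if L.index i (G.rev (w.dart k)) < L.index i d ∧
      L.index i d < L.index i (w.dart (k + 1)) then 1 else 0 := by
  unfold leftOf
  congr 1
  refine propext ⟨?_, fun h' => ⟨k, h, h'⟩⟩
  rintro ⟨m, hm, h'⟩
  have hs := hm.symm.trans h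
  rw [hw.dart_eq_pred hs, ClosedSeq.dart_eq_of_mod (hw.2.mod_eq hs)] at h'
  exact h'

omit [Finite D] in
theorem IsCycle.phase_out (k : ℕ) : L.phase i (w.dart k) = 2 :=
  (L.phase_eq_two i).2 (hw.1 k).1

omit [Finite D] in
theorem IsCycle.phase_in (k : ℕ) : L.phase i (G.rev (w.dart k)) = 0 :=
  (L.phase_eq_zero i).2 (by rw [G.rev_rev]; exact (hw.1 k).1)

theorem IsCycle.index_in_lt (k : ℕ) :
    L.index i (G.rev (w.dart k)) < L.index i (w.dart (k + 1)) := by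
  apply L.index_lt_of_phase_lt i (hw.1 k).2
  rw [hw.phase_in, hw.phase_out]
  norm_num

/-- Darts of the two groups of the other colour leave a cycle to the left or to the right. -/
theorem IsCycle.leftOf_eq_of_phase {d : D} (k : ℕ) (h : G.SameVertex d (w.dart k)) :
    (L.phase i d = 1 → L.leftOf i w d = 1) ∧ (L.phase i d = 3 → L.leftOf i w d = 0) := by
  obtain ⟨k, hk⟩ := w.exists_pred k
  rw [← hk] at h
  have h2 := hw.phase_out (k + 1)
  have h0 := hw.phase_in k
  rw [hw.leftOf_eq h]
  constructor
  · intro hd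
    exact if_pos ⟨L.index_lt_of_phase_lt i ((hw.1 k).2.trans h.symm) (by omega),
      L.index_lt_of_phase_lt i h (by omega)⟩
  · intro hd
    have := L.index_lt_of_phase_lt i h.symm (by omega)
    exact if_neg (by omega)

/-- Around a vertex, being to the left changes only at the two edges of the cycle itself. This is
the hypothesis of `isCocycle_push` and `form_push` for the indicator of the cycle. -/
theorem IsCycle.leftOf_rot (d : D) : L.leftOf i w d - L.leftOf i w (G.rot d) =
    w.indicator (G.rot d) - w.indicator (G.rev d) := by
  have hr : G.SameVertex d (G.rot d) := G.sameVertex_iterate 1 d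
  by_cases h : ∃ k, G.SameVertex d (w.dart k)
  · obtain ⟨k, hk⟩ := h
    obtain ⟨k, e⟩ := w.exists_pred k
    rw [← e] at hk
    have hj := hw.index_in_lt k
    have hi : G.SameVertex d (G.rev (w.dart k)) := hk.trans (hw.1 k).2.symm
    have e1 : w.indicator (G.rot d) =
        if L.index i (G.rot d) = L.index i (w.dart (k + 1)) then 1 else 0 := by
      unfold ClosedSeq.indicator
      congr 1
      rw [L.index_inj i (hr.symm.trans hk)]
      refine propext ⟨?_, fun h' => ⟨_, h'.symm⟩⟩
      rintro ⟨m, hm⟩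
      rw [← hm]
      exact ClosedSeq.dart_eq_of_mod (hw.2.mod_eq (hm ▸ hr.symm.trans hk))
    have e2 : w.indicator (G.rev d) =
        if L.index i d = L.index i (G.rev (w.dart k)) then 1 else 0 := by
      unfold ClosedSeq.indicator
      congr 1
      rw [L.index_inj i hi]
      refine propext ⟨?_, fun h' => ⟨k, by rw [h', G.rev_rev]⟩⟩
      rintro ⟨m, hm⟩
      have hd : d = G.rev (w.dart m) := by rw [hm, G.rev_rev]
      rw [hd, EmbeddingLike.apply_eq_iff_eq]
      exact hw.dart_eq_pred ((hw.1 m).2.symm.trans (hd ▸ hk))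
    rw [hw.leftOf_eq hk, hw.leftOf_eq (hr.symm.trans hk), e1, e2]
    have h1 := L.index_rot_iterate i 1 d
    have h2 := L.index_lt i d
    have h3 := L.index_lt i (w.dart (k + 1))
    rw [← L.deg_eq i hk] at h3
    rw [Function.iterate_one] at h1
    rcases Nat.lt_or_ge (L.index i d + 1) (L.deg i d) with h4 | h4
    · rw [Nat.mod_eq_of_lt h4] at h1
      rw [h1]
      split_ifs <;> first | omega | norm_num
    -- The index wraps around to 0. Neither dart is to the left there, because the incoming edge of
    -- the cycle precedes the outgoing one.
    · rw [show L.index i d + 1 = L.deg i d by omega, Nat.mod_self] at h1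
      rw [h1]
      split_ifs <;> first | omega | norm_num
  · have h : ∀ k, ¬ G.SameVertex d (w.dart k) := fun k hk => h ⟨k, hk⟩
    have e1 : w.indicator (G.rot d) = 0 := if_neg fun ⟨m, hm⟩ => h m (hm ▸ hr)
    have e2 : w.indicator (G.rev d) = 0 := if_neg fun ⟨m, hm⟩ => h (m + 1) (by
      have := (hw.1 m).2
      rwa [hm, G.rev_rev] at this)
    rw [leftOf_eq_zero h, leftOf_eq_zero fun k hk => h k (hr.trans hk), e1, e2]

omit hw

variable (L i) in
/-- The cocycle that counts crossings from left to right with a closed walk pushed off to its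
left. -/
noncomputable def push (w : ClosedSeq D) (d : D) : ℚ := L.leftOf i w (G.rev d) - L.leftOf i w d

end REL

namespace ClosedSeq

variable {D : Type} [DecidableEq D] {G : TorusTriangulation D} (O : Orbits G)

/-- The intersection number of two closed walks, computed from their homotopy classes. -/
def pair (w z : ClosedSeq D) : ℚ :=
  w.sum (O.crossing 0) * z.sum (O.crossing 1) - w.sum (O.crossing 1) * z.sum (O.crossing 0)

end ClosedSeq

namespace REL

variable {D : Type} [DecidableEq D] [Fintype D] {G : TorusTriangulation D} {L : REL G} {i : Fin 2}
  (O : Orbits G)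

-- The crossing cocycles of the orbits qualify as a basis because their intersection form is `-6`,
-- not zero.
include O in
theorem _root_.TorusREL.TorusTriangulation.IsCocycle.exists_eq {φ : D → ℚ} (hφ : G.IsCocycle φ) :
    ∃ f : D → ℚ, (∀ a b, G.SameVertex a b → f a = f b) ∧ ∀ d, φ d =
      G.form φ (O.crossing 0) / 6 * O.crossing 1 d - G.form φ (O.crossing 1) / 6 * O.crossing 0 d
        + (f (G.rev d) - f d) := by
  obtain ⟨f, hf, h⟩ := (O.isCocycle_crossing 0).decomposition (O.isCocycle_crossing 1)
    (by rw [O.form_crossing]; norm_num) hφ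
  refine ⟨fun d => - f d / 6, fun a b hab => by
    simp only [TorusTriangulation.eq_of_sameVertex hf hab], fun d => ?_⟩
  have := h d
  rw [O.form_crossing] at this
  linear_combination (-1 / 6) * this

/-- The coefficients are the pairings of the pushed-off cycle with the orbits, which `form_push`
evaluates as the crossing numbers of `w`. -/
theorem IsCycle.push_eq {w : ClosedSeq D} (hw : L.IsCycle i w) :
    ∃ f : D → ℚ, (∀ a b, G.SameVertex a b → f a = f b) ∧ ∀ d, L.push i w d =
      w.sum (O.crossing 0) * O.crossing 1 d - w.sum (O.crossing 1) * O.crossing 0 d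
        + (f (G.rev d) - f d) := by
  have hc := TorusTriangulation.isCocycle_push hw.leftOf_rot
  obtain ⟨f, hf, h⟩ := hc.exists_eq O
  refine ⟨f, hf, fun d => (h d).trans ?_⟩
  rw [TorusTriangulation.form_push (O.isCocycle_crossing 0) hw.leftOf_rot,
    TorusTriangulation.form_push (O.isCocycle_crossing 1) hw.leftOf_rot,
    ClosedSeq.sum_indicator hw.2, ClosedSeq.sum_indicator hw.2]
  ring

/-- The bridge between combinatorics and topology: crossings counted locally on one side, an
expression in the two classes on the other. -/
theorem IsCycle.sum_push {w z : ClosedSeq D} (hw : L.IsCycle i w) (hz : z.IsWalk G) :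
    z.sum (L.push i w) = w.pair O z := by
  obtain ⟨f, hf, h⟩ := hw.push_eq O
  rw [show L.push i w = _ from funext h, ClosedSeq.sum_add, z.sum_coboundary hz hf,
    ClosedSeq.sum_sub, ClosedSeq.sum_mul, ClosedSeq.sum_mul, ClosedSeq.pair]
  ring

end REL

theorem Orbits.crossing_int {D : Type} [DecidableEq D] {G : TorusTriangulation D} (O : Orbits G)
    (o : Fin 2) (d : D) : ∃ t : ℤ, O.crossing o d = t :=
  ⟨(O.count o d : ℤ) - O.count o (G.rev d), by simp [Orbits.crossing]⟩

theorem ClosedSeq.sum_int {D : Type} (w : ClosedSeq D) {β : D → ℚ} (h : ∀ d, ∃ t : ℤ, β d = t) :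
    ∃ t : ℤ, w.sum β = t := by
  choose b hb using h
  exact ⟨∑ k ∈ Finset.range w.len, b (w.dart k), by simp [ClosedSeq.sum, hb]⟩

/-! ### Interaction of the two colours: non-contractibility and primitivity. -/

namespace REL

/-- The sign with which arcs of the other colour cross the cycles of `L_i(G)`. -/
def sign (i : Fin 2) : ℚ := if i = 0 then 1 else -1

/-- The end of an arc of the other colour that lies to the left of a cycle of `L_i(G)`
when the arc meets the cycle in this end. -/
def leftEnd {D : Type} (G : TorusTriangulation D) (i : Fin 2) (d : D) : D :=
  if i = 0 then G.rev d else d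

section

variable {D : Type} {G : TorusTriangulation D} {L : REL G} {i j : Fin 2}

theorem phase_leftEnd (hij : j ≠ i) {d : D} (h : L.IsArc j d) :
    L.phase i (leftEnd G i d) = 1 ∧ L.phase i (G.rev (leftEnd G i d)) = 3 := by
  obtain ⟨h1, h2⟩ := h
  unfold leftEnd phase
  have hi : i = 0 ∧ j = 1 ∨ i = 1 ∧ j = 0 := by omega
  rcases hi with ⟨rfl, rfl⟩ | ⟨rfl, rfl⟩ <;>
    simp only [if_true, G.rev_rev, L.color_rev, L.out_rev, h1, h2, one_ne_zero, if_false] <;> decide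

theorem exists_arc_leftEnd (i : Fin 2) {e : D} (h : L.phase i e = 1) :
    ∃ d, leftEnd G i d = e ∧ ∀ j ≠ i, L.IsArc j d := by
  refine ⟨leftEnd G i e, ?_, fun j hij => ?_⟩
  · unfold leftEnd; split_ifs <;> simp [G.rev_rev]
  · unfold phase at h
    unfold leftEnd IsArc
    have hi : i = 0 ∧ j = 1 ∨ i = 1 ∧ j = 0 := by omega
    rcases hi with ⟨rfl, rfl⟩ | ⟨rfl, rfl⟩ <;>
    simp only [if_true, L.color_rev, L.out_rev, one_ne_zero, if_false] <;>
    revert h <;> generalize L.color e = c <;> generalize L.out e = b <;> revert c b <;> decide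

end

variable {D : Type} [DecidableEq D] [Fintype D] {G : TorusTriangulation D} {L : REL G}
  {i j : Fin 2} (O : Orbits G) {w z : ClosedSeq D}

-- The two groups of the other colour lie on opposite sides of the cycle, so all arcs of that colour
-- cross it in the same direction. A crossing is registered at the end of the arc that touches the
-- cycle from the left.
omit [DecidableEq D] in
open Classical in
theorem IsCycle.push_other (hw : L.IsCycle i w) (hij : j ≠ i) {d : D} (h : L.IsArc j d) :
    sign i * L.push i w d = if ∃ k, G.SameVertex (leftEnd G i d) (w.dart k) then 1 else 0 := by
  have e : sign i * L.push i w d =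
      L.leftOf i w (leftEnd G i d) - L.leftOf i w (G.rev (leftEnd G i d)) := by
    unfold sign push leftEnd
    split_ifs <;> simp [G.rev_rev]
  obtain ⟨h1, h3⟩ := phase_leftEnd hij h
  have hr : L.leftOf i w (G.rev (leftEnd G i d)) = 0 := by
    by_cases hv : ∃ k, G.SameVertex (G.rev (leftEnd G i d)) (w.dart k)
    · obtain ⟨k, hk⟩ := hv
      exact (hw.leftOf_eq_of_phase k hk).2 h3
    · exact leftOf_eq_zero fun k hk => hv ⟨k, hk⟩
  rw [e, hr, sub_zero]
  split_ifs with hv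
  · obtain ⟨k, hk⟩ := hv
    exact (hw.leftOf_eq_of_phase k hk).1 h1
  · exact leftOf_eq_zero fun k hk => hv ⟨k, hk⟩

theorem IsCycle.sign_pair (hw : L.IsCycle i w) (hz : z.IsWalk G) :
    sign i * w.pair O z = z.sum (fun d => sign i * L.push i w d) := by
  rw [ClosedSeq.sum_mul, hw.sum_push O hz]

theorem IsCycle.pair_other_nonneg (hw : L.IsCycle i w) (hij : j ≠ i) (hz : L.IsClosedWalk j z) :
    0 ≤ sign i * w.pair O z := by
  rw [hw.sign_pair O hz.isWalk]
  refine z.sum_nonneg fun k => ?_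
  rw [hw.push_other hij (hz k).1]
  split_ifs <;> simp

omit [DecidableEq D] [Fintype D] in
/-- An arc of the other colour that touches a closed walk from the left. -/
theorem exists_left_arc (w : ClosedSeq D) (i : Fin 2) :
    ∃ d, (∀ j ≠ i, L.IsArc j d) ∧ G.SameVertex (leftEnd G i d) (w.dart 0) := by
  obtain ⟨e, h1, h2, -⟩ := (L.exists_unique_turn i (w.dart 0) (show 1 < 4 by norm_num)).exists
  obtain ⟨d, rfl, hd⟩ := exists_arc_leftEnd i h2
  exact ⟨d, hd, h1.symm⟩

theorem IsCycle.pair_pos_of_mem (hw : L.IsCycle i w) (hij : j ≠ i) (hz : L.IsClosedWalk j z)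
    {k m : ℕ} (h : G.SameVertex (leftEnd G i (z.dart m)) (w.dart k)) :
    0 < sign i * w.pair O z := by
  rw [hw.sign_pair O hz.isWalk]
  refine z.sum_pos (fun k => ?_) (k := m) ?_
  · rw [hw.push_other hij (hz k).1]
    split_ifs <;> simp
  · rw [hw.push_other hij (hz m).1, if_pos ⟨k, h⟩]
    norm_num

/-- Realizability extends an arc of the other colour that touches `w` to a directed cycle. Its
crossings with `w` all have the same sign and cannot cancel. -/
theorem IsCycle.exists_transversal (hL : L.Realizable) (hw : L.IsCycle i w) (hij : j ≠ i) :
    ∃ z, L.IsCycle j z ∧ 0 < sign i * w.pair O z := by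
  obtain ⟨d, hd, hs⟩ := exists_left_arc (L := L) w i
  obtain ⟨z, hz, m, rfl⟩ := hL j d (hd j hij)
  exact ⟨z, hz, hw.pair_pos_of_mem O hij hz.1 hs⟩

theorem exists_ne (i : Fin 2) : ∃ j : Fin 2, j ≠ i := ⟨i + 1, by omega⟩

theorem IsCycle.sum_ne_zero (hL : L.Realizable) (hw : L.IsCycle i w) :
    ¬ (w.sum (O.crossing 0) = 0 ∧ w.sum (O.crossing 1) = 0) := by
  rintro ⟨h0, h1⟩
  obtain ⟨j, hij⟩ := exists_ne i
  obtain ⟨z, -, hz⟩ := hw.exists_transversal O hL hij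
  simp [ClosedSeq.pair, h0, h1] at hz

omit [DecidableEq D] in
theorem IsCycle.push_self (hw : L.IsCycle i w) (k : ℕ) : L.push i w (w.dart k) = 0 := by
  obtain ⟨p, hp⟩ := w.exists_pred k
  rw [push, hw.leftOf_eq (hw.1 k).2, ← hp, hw.leftOf_eq (Equiv.Perm.SameCycle.refl _ _)]
  simp

/-- The homotopy class of a cycle of `L_i(G)` is primitive. -/
theorem IsCycle.primitive (hL : L.Realizable) (hw : L.IsCycle i w) {k x y : ℤ}
    (hx : w.sum (O.crossing 0) = k * x) (hy : w.sum (O.crossing 1) = k * y) :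
    k = 1 ∨ k = -1 := by
  classical
  obtain ⟨f, hf, hpush⟩ := hw.push_eq O
  -- If the class is `k` times an integral one, the pushed-off cycle is the coboundary of `f` modulo
  -- `k`.
  have hstep (d : D) : ∃ t : ℤ, f (G.rev d) - f d = L.push i w d + k * t := by
    obtain ⟨a, ha⟩ := O.crossing_int 0 d
    obtain ⟨b, hb⟩ := O.crossing_int 1 d
    refine ⟨y * a - x * b, ?_⟩
    rw [hpush, hx, hy, ha, hb]
    push_cast
    ring
  -- Modulo `k`, the potential is constant along `w`, which does not cross its own push-off.
  have hon (p : ℕ) : ∃ t : ℤ, f (w.dart p) - f (w.dart 0) = k * t := by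
    induction p with
    | zero => exact ⟨0, by simp⟩
    | succ p ih =>
      obtain ⟨t, ht⟩ := ih
      obtain ⟨s, hs⟩ := hstep (w.dart p)
      rw [hf _ _ (hw.1 p).2, hw.push_self] at hs
      exact ⟨t + s, by push_cast; linear_combination ht + hs⟩
  obtain ⟨j, hij⟩ := exists_ne i
  obtain ⟨d, hd, hs⟩ := exists_left_arc (L := L) w i
  obtain ⟨z, hz, m, rfl⟩ := hL j d (hd j hij)
  let V (n : ℕ) : Prop := ∃ k, G.SameVertex (z.dart n) (w.dart k)
  have hVm : ∃ n, V n := by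
    unfold leftEnd at hs
    split_ifs at hs
    · exact ⟨m + 1, 0, (hz.1 m).2.symm.trans hs⟩
    · exact ⟨m, 0, hs⟩
  obtain ⟨n, hn⟩ := hVm
  have hex : ∃ t, 0 < t ∧ V (n + t) := ⟨z.len, z.len_pos, by
    obtain ⟨k, hk⟩ := hn
    exact ⟨k, by rwa [z.dart_add]⟩⟩
  -- The segment of the transversal `z` from a visit of `w` to the next one crosses the push-off
  -- exactly once. The potential changes by `1` or `-1` between two vertices of `w`, so `k` divides
  -- 1.
  obtain ⟨t, ⟨ht0, htV⟩, hmin⟩ : ∃ t, (0 < t ∧ V (n + t)) ∧ ∀ s, 0 < s → s < t → ¬ V (n + s) :=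
    ⟨Nat.find hex, Nat.find_spec hex, fun s h0 hst hV => Nat.find_min hex hst ⟨h0, hV⟩⟩
  have hp (s : ℕ) : sign i * L.push i w (z.dart (n + s)) =
      if V (n + s + if i = 0 then 1 else 0) then 1 else 0 := by
    rw [hw.push_other hij (hz.1 _).1]
    congr 1
    unfold leftEnd
    split_ifs
    · refine propext (exists_congr fun k => ?_)
      exact ⟨fun h => (hz.1 _).2.symm.trans h, fun h => (hz.1 _).2.trans h⟩
    · rfl
  -- For `i = 0` the crossing happens at the last arc of the segment, whose head is on `w`; for `i =
  -- 1` at the first one, whose tail is on `w`.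
  have hwalk (s : ℕ) (hst : s ≤ t) : ∃ a : ℤ, sign i * (f (z.dart (n + s)) - f (z.dart n)) =
      (if i = 0 then (if s = t then 1 else 0) else (if s = 0 then 0 else 1)) + k * a := by
    induction s with
    | zero => exact ⟨0, by simp [ht0.ne]⟩
    | succ s ih =>
      obtain ⟨a, ha⟩ := ih (by omega)
      obtain ⟨b, hb⟩ := hstep (z.dart (n + s))
      rw [hf _ _ (hz.1 _).2] at hb
      have hps := hp s
      have hsg : ∃ c : ℤ, sign i * b = c := by
        unfold sign; split_ifs
        · exact ⟨b, by simp⟩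
        · exact ⟨-b, by simp⟩
      obtain ⟨c, hc⟩ := hsg
      refine ⟨a + c, ?_⟩
      have e : sign i * (f (z.dart (n + (s + 1))) - f (z.dart n)) =
          sign i * (f (z.dart (n + s)) - f (z.dart n)) + sign i * L.push i w (z.dart (n + s))
            + k * c := by
        rw [← hc, ← add_assoc]
        linear_combination sign i * hb
      rw [e, ha, hps]
      push_cast
      have hne : s ≠ t := by omega
      by_cases hi : i = 0
      · simp only [hi, if_true, if_neg hne]
        by_cases h1 : s + 1 = t
        · have : V (n + s + 1) := by rw [add_assoc, h1]; exact htV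
          simp only [h1, this, if_true]; ring
        · have : ¬ V (n + s + 1) := by rw [add_assoc]; exact hmin _ (by omega) (by omega)
          simp only [h1, this, if_false]; ring
      · simp only [hi, if_false, add_zero]
        by_cases h1 : s = 0
        · subst h1
          have : V (n + 0) := hn
          simp only [this, if_true]; ring
        · have : ¬ V (n + s) := hmin _ (by omega) (by omega)
          simp only [h1, this, if_false]; ring
  obtain ⟨a, ha⟩ := hwalk t le_rfl
  have hone : (if i = 0 then (if t = t then 1 else 0) else (if t = 0 then 0 else 1) : ℚ) = 1 := by
    simp [ht0.ne']
  rw [hone] at ha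
  obtain ⟨p, hpv⟩ := hn
  obtain ⟨q, hq⟩ := htV
  obtain ⟨b, hb⟩ := hon p
  obtain ⟨c, hc⟩ := hon q
  rw [hf _ _ hpv, hf _ _ hq] at ha
  have hdvd : ∃ e : ℤ, k * e = 1 := by
    unfold sign at ha
    split_ifs at ha
    · refine ⟨c - b - a, ?_⟩
      have : (k : ℚ) * (c - b - a) = 1 := by linear_combination ha - hc + hb
      exact_mod_cast this
    · refine ⟨b - c - a, ?_⟩
      have : (k : ℚ) * (b - c - a) = 1 := by linear_combination ha + hc - hb
      exact_mod_cast this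
  obtain ⟨e, he⟩ := hdvd
  exact Int.eq_one_or_neg_one_of_mul_eq_one he

end REL

namespace Orbits

variable {D : Type} [DecidableEq D] {G : TorusTriangulation D} (O : Orbits G)

theorem homotopyClass_fst (w : ClosedSeq D) :
    ((O.homotopyClass w).1 : ℚ) = - w.sum (O.crossing 0) := by
  simp only [homotopyClass, Prod.fst_sum, Int.cast_sum, dartClass_fst, ClosedSeq.sum,
    Finset.sum_neg_distrib]

theorem homotopyClass_snd (w : ClosedSeq D) :
    ((O.homotopyClass w).2 : ℚ) = w.sum (O.crossing 1) := by
  simp only [homotopyClass, Prod.snd_sum, Int.cast_sum, dartClass_snd, ClosedSeq.sum]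

theorem homotopyClass_ne_zero {w : ClosedSeq D}
    (h : ¬ (w.sum (O.crossing 0) = 0 ∧ w.sum (O.crossing 1) = 0)) : O.homotopyClass w ≠ 0 := by
  intro h0
  apply h
  rw [← O.homotopyClass_snd, ← neg_eq_zero, ← O.homotopyClass_fst, h0]
  simp

theorem homotopyClass_eq_orbitClass (i : Fin 2) (w : ClosedSeq D) :
    O.homotopyClass w = orbitClass i ↔ w.sum (O.crossing 0) = (if i = 0 then 0 else -1) ∧
      w.sum (O.crossing 1) = if i = 0 then 1 else 0 := by
  rw [← O.homotopyClass_snd, ← neg_neg (w.sum (O.crossing 0)), ← O.homotopyClass_fst, Prod.ext_iff]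
  unfold orbitClass
  split_ifs <;> norm_num

/-- The intersection number of a closed walk with the `i`th orbit. -/
theorem pair_of_orbitClass {i : Fin 2} {z : ClosedSeq D} (hz : O.homotopyClass z = orbitClass i)
    (w : ClosedSeq D) : w.pair O z = w.sum (O.crossing i) := by
  obtain ⟨h0, h1⟩ := (O.homotopyClass_eq_orbitClass i z).1 hz
  rw [ClosedSeq.pair, h0, h1]
  have hi : i = 0 ∨ i = 1 := by omega
  rcases hi with rfl | rfl <;> simp

end Orbits

theorem ClosedSeq.pair_swap {D : Type} [DecidableEq D] {G : TorusTriangulation D} (O : Orbits G)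
    (w z : ClosedSeq D) : w.pair O z = - z.pair O w := by
  unfold ClosedSeq.pair; ring

/-! ### Dual cycles as cohomology classes, and the criterion for feedback. -/

namespace REL

section Dual

variable {D : Type} [DecidableEq D] {G : TorusTriangulation D} {L : REL G} {i : Fin 2}

/-- The cochain that counts how often a dart, or in the opposite direction its reverse, is `x`. -/
def point (G : TorusTriangulation D) (x d : D) : ℚ :=
  (if x = d then 1 else 0) - if x = G.rev d then 1 else 0

theorem point_rev (x d : D) : point G x (G.rev d) = - point G x d := by
  simp only [point, G.rev_rev]; ring

open Classical in
theorem point_face (x d : D) :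
    point G x d + point G x (G.face d) + point G x (G.face (G.face d)) =
      (if G.SameFace d x then 1 else 0) - if G.SameFace d (G.rev x) then 1 else 0 := by
  rw [← G.sum_face_eq, ← G.sum_face_eq]
  have h (a : D) : (x = G.rev a) ↔ G.rev x = a := by
    constructor
    · rintro rfl; rw [G.rev_rev]
    · rintro rfl; rw [G.rev_rev]
  simp only [point, h]
  ring

open Classical in
/-- A dual path that avoids the edges of colour `i`, as a cochain. -/
theorem SameFaceOf.exists_cochain {a b : D} (h : L.SameFaceOf i a b) : ∃ θ : D → ℚ,
    (∀ d, θ (G.rev d) = - θ d) ∧ (∀ d, L.color d = i → θ d = 0) ∧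
    ∀ d, θ d + θ (G.face d) + θ (G.face (G.face d)) =
      (if G.SameFace d a then 1 else 0) - if G.SameFace d b then 1 else 0 := by
  induction h with
  | rel x y h =>
    rcases h with rfl | ⟨hx, rfl⟩
    · refine ⟨fun _ => 0, by simp, by simp, fun d => ?_⟩
      have : G.SameFace d (G.face x) ↔ G.SameFace d x := Equiv.Perm.sameCycle_apply_right
      simp [this]
    · refine ⟨point G x, point_rev x, fun d hd => ?_, point_face x⟩
      have h1 : x ≠ d := fun h => hx (h ▸ hd)
      have h2 : x ≠ G.rev d := fun h => hx (by rw [h, L.color_rev, hd])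
      simp [point, h1, h2]
  | refl x => exact ⟨fun _ => 0, by simp, by simp, by simp⟩
  | symm x y _ ih =>
    obtain ⟨θ, h1, h2, h3⟩ := ih
    exact ⟨fun d => - θ d, fun d => by simp [h1], fun d hd => by simp [h2 d hd],
      fun d => by linear_combination - h3 d⟩
  | trans x y z _ _ ih ih' =>
    obtain ⟨θ, h1, h2, h3⟩ := ih
    obtain ⟨θ', h1', h2', h3'⟩ := ih'
    exact ⟨fun d => θ d + θ' d, fun d => by simp only [h1, h1']; ring, fun d hd => by
      simp only [h2 d hd, h2' d hd, add_zero], fun d => by linear_combination h3 d + h3' d⟩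

/-- A dual closed walk as a cocycle. -/
theorem IsDualCycle.exists_cocycle {c : ClosedSeq D} (hc : L.IsDualCycle i c) : ∃ φ : D → ℚ,
    G.IsCocycle φ ∧ ∀ d, L.IsArc i d → φ d = c.sum (fun e => if e = d then 1 else 0) := by
  classical
  choose θ h1 h2 h3 using fun k => (hc.1 k).2.exists_cochain
  refine ⟨fun d => ∑ k ∈ Finset.range c.len, (point G (c.dart k) d + θ k d), ⟨fun d => ?_,
    fun d => ?_⟩, fun d hd => Finset.sum_congr rfl fun k _ => ?_⟩
  · rw [← Finset.sum_neg_distrib]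
    exact Finset.sum_congr rfl fun k _ => by rw [point_rev, h1]; ring
  · rw [← Finset.sum_add_distrib, ← Finset.sum_add_distrib]
    have h0 : c.dart c.len = c.dart 0 := by simpa using c.dart_add 0
    have hs := sum_range_shift (n := c.len)
      (F := fun k => if G.SameFace d (c.dart k) then (1 : ℚ) else 0) (by simp only [h0])
    have : ∀ k ∈ Finset.range c.len, point G (c.dart k) d + θ k d
        + (point G (c.dart k) (G.face d) + θ k (G.face d))
        + (point G (c.dart k) (G.face (G.face d)) + θ k (G.face (G.face d))) =
        (if G.SameFace d (c.dart k) then 1 else 0)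
        - if G.SameFace d (c.dart (k + 1)) then 1 else 0 := fun k _ => by
      linear_combination h3 k d + point_face (G := G) (c.dart k) d
    rw [Finset.sum_congr rfl this, Finset.sum_sub_distrib, hs, sub_self]
  · have hr : c.dart k ≠ G.rev d := by
      intro h
      have h4 := (hc.1 k).1.2
      rw [h, L.out_rev, hd.2] at h4
      exact absurd h4 (by decide)
    rw [h2 k d hd.1, point, if_neg hr]
    ring

end Dual

variable {D : Type} [DecidableEq D] [Fintype D] {G : TorusTriangulation D} {L : REL G}
  {i : Fin 2} (O : Orbits G) {w : ClosedSeq D}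

include O in
/-- A closed walk of `L_i(G)` crosses all dual cycles if its homotopy class lies in the relative
interior of the cone spanned by the homotopy classes of the closed walks of `L_i(G)`. -/
theorem exists_common_arc (hL : L.Realizable) (hw : L.IsClosedWalk i w)
    (h0 : ¬ (w.sum (O.crossing 0) = 0 ∧ w.sum (O.crossing 1) = 0))
    (h : (∀ z, L.IsCycle i z → w.pair O z = 0) ∨ ∃ z z', L.IsClosedWalk i z ∧
      L.IsClosedWalk i z' ∧ w.pair O z < 0 ∧ 0 < w.pair O z')
    {c : ClosedSeq D} (hc : L.IsDualCycle i c) : ∃ p q, w.dart p = c.dart q := by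
  by_contra! hne
  obtain ⟨φ, hφ, harc⟩ := hc.exists_cocycle
  obtain ⟨f, hf, hdec⟩ := hφ.exists_eq O
  set u := G.form φ (O.crossing 0) / 6
  set v := G.form φ (O.crossing 1) / 6
  have hsum {z : ClosedSeq D} (hz : z.IsWalk G) :
      z.sum φ = u * z.sum (O.crossing 1) - v * z.sum (O.crossing 0) := by
    rw [show φ = _ from funext hdec, ClosedSeq.sum_add, z.sum_coboundary hz hf,
      ClosedSeq.sum_sub, ClosedSeq.sum_mul, ClosedSeq.sum_mul, add_zero]
  have hpos {d : D} (hd : L.IsArc i d) : 0 ≤ φ d := by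
    rw [harc d hd]
    exact c.sum_nonneg fun k => by split_ifs <;> simp
  have hnn {z : ClosedSeq D} (hz : L.IsClosedWalk i z) : 0 ≤ z.sum φ :=
    z.sum_nonneg fun k => hpos (hz k).1
  -- On arcs, `φ` counts visits of the dual cycle, so a walk without a common arc integrates it to
  -- zero.
  have hw0 : w.sum φ = 0 := by
    refine Finset.sum_eq_zero fun k _ => ?_
    rw [harc _ (hw k).1]
    exact Finset.sum_eq_zero fun q _ => if_neg (hne k q).symm
  rw [hsum hw.isWalk] at hw0
  -- In the plane, a functional that vanishes on the nonzero class of `w` is a multiple of the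
  -- pairing with `w`.
  obtain ⟨s, hs⟩ : ∃ s : ℚ, ∀ z : ClosedSeq D, z.IsWalk G → z.sum φ = s * w.pair O z := by
    by_cases hx : w.sum (O.crossing 0) = 0
    · have hy : w.sum (O.crossing 1) ≠ 0 := fun hy => h0 ⟨hx, hy⟩
      have hu : u = 0 := by
        rw [hx, mul_zero, sub_zero] at hw0
        exact (mul_eq_zero.1 hw0).resolve_right hy
      refine ⟨v / w.sum (O.crossing 1), fun z hz => ?_⟩
      rw [hsum hz, hu, ClosedSeq.pair, hx]
      field_simp
      ring
    · refine ⟨u / w.sum (O.crossing 0), fun z hz => ?_⟩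
      rw [hsum hz, ClosedSeq.pair]
      field_simp
      linear_combination z.sum (O.crossing 0) * hw0
  -- Realizability supplies a cycle on which `φ` is positive. This excludes both `s = 0` and a
  -- pairing that vanishes on all cycles; with pairings of both signs, any other `s` would make `φ`
  -- negative on some closed walk.
  obtain ⟨z, hz, k, hk⟩ := hL i (c.dart 0) (hc.1 0).1
  have hzpos : 0 < z.sum φ := by
    refine z.sum_pos (fun k => hpos (hz.1 k).1) (k := k) ?_
    rw [hk, harc _ (hc.1 0).1]
    exact c.sum_pos (fun q => by split_ifs <;> simp) (k := 0) (by simp)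
  rw [hs z hz.isWalk] at hzpos
  rcases h with h | ⟨z₁, z₂, hz₁, hz₂, h1, h2⟩
  · rw [h z hz, mul_zero] at hzpos
    exact lt_irrefl _ hzpos
  · have e1 := hnn hz₁
    have e2 := hnn hz₂
    rw [hs _ hz₁.isWalk] at e1
    rw [hs _ hz₂.isWalk] at e2
    rcases lt_trichotomy s 0 with hs0 | hs0 | hs0
    · nlinarith
    · rw [hs0, zero_mul] at hzpos; exact lt_irrefl _ hzpos
    · nlinarith

/-- Two cycles of `L_i(G)` with parallel homotopy classes have the same direction. -/
theorem IsCycle.not_opposite (hL : L.Realizable) (hw : L.IsCycle i w) {z : ClosedSeq D}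
    (hz : L.IsCycle i z) {s : ℚ} (h0 : z.sum (O.crossing 0) = s * w.sum (O.crossing 0))
    (h1 : z.sum (O.crossing 1) = s * w.sum (O.crossing 1)) : 0 < s := by
  obtain ⟨j, hij⟩ := exists_ne i
  -- A transversal of `w` cannot cross `z` with the opposite sign.
  obtain ⟨r, hr, hpos⟩ := hw.exists_transversal O hL hij
  have h2 := hz.pair_other_nonneg O hij hr.1
  have e : z.pair O r = s * w.pair O r := by
    simp only [ClosedSeq.pair, h0, h1]; ring
  have hs : s ≠ 0 := by
    rintro rfl
    exact hz.sum_ne_zero O hL ⟨by simp [h0], by simp [h1]⟩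
  rw [e] at h2
  by_contra hneg
  have : s < 0 := lt_of_le_of_ne (not_lt.1 hneg) hs
  nlinarith

omit [Fintype D] in
theorem Orbital.realizable {O : Orbits G} (hO : L.Orbital O) : L.Realizable := fun i d hd =>
  let ⟨w, hw, _, hk⟩ := hO i d hd
  ⟨w, hw, hk⟩

/-- A cycle that does not intersect the `i`th orbit algebraically is `i`-orbital. -/
theorem IsCycle.class_eq_of_orbital {O : Orbits G} (hO : L.Orbital O) (hw : L.IsCycle i w)
    (h : w.sum (O.crossing i) = 0) : O.homotopyClass w = Orbits.orbitClass i := by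
  have hL := hO.realizable
  obtain ⟨z, hz, hclass, -⟩ := hO i _ (hw.1 0).1
  obtain ⟨z0, z1⟩ := (O.homotopyClass_eq_orbitClass i z).1 hclass
  rw [O.homotopyClass_eq_orbitClass]
  have hi : i = 0 ∨ i = 1 := by omega
  rcases hi with rfl | rfl
  · simp only [if_true] at z0 z1 ⊢
    refine ⟨h, ?_⟩
    -- The class is `t` times that of the orbit. Primitivity leaves `t = 1` or `t = -1`, and
    -- comparison with an orbital cycle excludes the latter.
    obtain ⟨t, ht⟩ := w.sum_int (O.crossing_int 1)
    have hp := hz.not_opposite O hL hw (s := t) (by rw [h, z0, mul_zero]) (by rw [ht, z1, mul_one])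
    rcases hw.primitive O hL (k := t) (x := 0) (y := 1) (by simpa using h) (by simpa using ht)
      with rfl | rfl
    · simpa using ht
    · norm_num at hp
  · simp only [one_ne_zero, if_false] at z0 z1 ⊢
    refine ⟨?_, h⟩
    obtain ⟨t, ht⟩ := w.sum_int (O.crossing_int 0)
    have hp := hz.not_opposite O hL hw (s := -t) (by rw [ht, z0]; ring) (by rw [h, z1, mul_zero])
    rcases hw.primitive O hL (k := t) (x := 1) (y := 0) (by simpa using ht) (by simpa using h)
      with rfl | rfl
    · norm_num at hp
    · simpa using ht

end REL

/-! ### Leftmost arcs and the two extreme cycles. -/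

namespace REL

variable {D : Type} {G : TorusTriangulation D} (L : REL G) (i : Fin 2)

/-- The leftmost outgoing edge of colour `i` at the tail of a dart. -/
noncomputable def lo (d : D) : D :=
  G.rot (L.exists_unique_turn i d (show 1 < 4 by norm_num)).choose

/-- The leftmost incoming edge of colour `i` at the tail of a dart. -/
noncomputable def li (d : D) : D :=
  G.rev (L.exists_unique_turn i d (show 0 < 4 by norm_num)).choose

theorem sameVertex_lo (d : D) : G.SameVertex d (L.lo i d) :=
  Equiv.Perm.sameCycle_apply_right.2
    (L.exists_unique_turn i d (show 1 < 4 by norm_num)).choose_spec.1.1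

theorem isArc_lo (d : D) : L.IsArc i (L.lo i d) :=
  (L.phase_eq_two i).1 (L.exists_unique_turn i d (show 1 < 4 by norm_num)).choose_spec.1.2.2

theorem eq_lo {d e : D} (h : G.SameVertex d e) (h1 : L.phase i e = 1)
    (h2 : L.phase i (G.rot e) = 2) : G.rot e = L.lo i d := by
  have := (L.exists_unique_turn i d (show 1 < 4 by norm_num)).choose_spec.2 e ⟨h, h1, h2⟩
  rw [lo, ← this]

theorem lo_eq {a b : D} (h : G.SameVertex a b) : L.lo i a = L.lo i b :=
  let hs := (L.exists_unique_turn i a (show 1 < 4 by norm_num)).choose_spec.1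
  L.eq_lo i (h.symm.trans hs.1) hs.2.1 hs.2.2

theorem lo_eq_iff {a b : D} : L.lo i a = L.lo i b ↔ G.SameVertex a b :=
  ⟨fun h => (L.sameVertex_lo i a).trans (h ▸ (L.sameVertex_lo i b).symm), L.lo_eq i⟩

@[simp] theorem lo_lo (d : D) : L.lo i (L.lo i d) = L.lo i d :=
  (L.lo_eq i (L.sameVertex_lo i d)).symm

theorem isArc_li (d : D) : L.IsArc i (L.li i d) :=
  (L.phase_eq_zero i).1 (L.exists_unique_turn i d (show 0 < 4 by norm_num)).choose_spec.1.2.1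

theorem sameVertex_li (d : D) : G.SameVertex (G.rev (L.li i d)) d := by
  rw [li, G.rev_rev]
  exact (L.exists_unique_turn i d (show 0 < 4 by norm_num)).choose_spec.1.1.symm

theorem eq_li {d e : D} (h : G.SameVertex d e) (h1 : L.phase i e = 0)
    (h2 : L.phase i (G.rot e) = 1) : G.rev e = L.li i d := by
  have := (L.exists_unique_turn i d (show 0 < 4 by norm_num)).choose_spec.2 e ⟨h, h1, h2⟩
  rw [li, ← this]

theorem li_eq {a b : D} (h : G.SameVertex a b) : L.li i a = L.li i b :=
  let hs := (L.exists_unique_turn i a (show 0 < 4 by norm_num)).choose_spec.1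
  L.eq_li i (h.symm.trans hs.1) hs.2.1 hs.2.2

/-- The next dart on the walk that always leaves through the leftmost edge. -/
noncomputable def succ (d : D) : D := L.lo i (G.rev d)

/-- The previous vertex (given by its leftmost outgoing edge) on the walk that always
enters through the leftmost edge. -/
noncomputable def pred (d : D) : D := L.lo i (L.li i d)

/-- A cycle that always leaves a vertex through the leftmost edge. -/
noncomputable def leftOut (v : D) (h : v ∈ Function.periodicPts (L.succ i)) : ClosedSeq D where
  len := Function.minimalPeriod (L.succ i) v
  dart k := (L.succ i)^[k] v
  len_pos := Function.minimalPeriod_pos_of_mem_periodicPts h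
  dart_add k := by rw [Function.iterate_add_minimalPeriod_eq]

theorem lo_leftOut {v : D} (h : v ∈ Function.periodicPts (L.succ i)) (k : ℕ) :
    L.lo i ((L.leftOut i v h).dart k) = (L.leftOut i v h).dart k := by
  rw [← ClosedSeq.dart_add, show k + (L.leftOut i v h).len = k + ((L.leftOut i v h).len - 1) + 1 by
    have := (L.leftOut i v h).len_pos; omega]
  change L.lo i ((L.succ i)^[_ + 1] v) = (L.succ i)^[_ + 1] v
  rw [Function.iterate_succ_apply', succ, lo_lo]

theorem isCycle_leftOut {v : D} (h : v ∈ Function.periodicPts (L.succ i)) :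
    L.IsCycle i (L.leftOut i v h) := by
  refine ⟨fun k => ⟨?_, ?_⟩, fun p q hp hq hpq => ?_⟩
  · rw [← lo_leftOut]; exact L.isArc_lo i _
  · change G.SameVertex _ ((L.succ i)^[k + 1] v)
    rw [Function.iterate_succ_apply']
    exact L.sameVertex_lo i _
  · rw [← L.lo_eq_iff i, lo_leftOut, lo_leftOut] at hpq
    exact Function.iterate_injOn_Iio_minimalPeriod hp hq hpq

/-- A cycle that always enters a vertex through the leftmost edge. -/
noncomputable def leftIn (u : D) (h : u ∈ Function.periodicPts (L.pred i)) : ClosedSeq D where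
  len := Function.minimalPeriod (L.pred i) u
  -- Iterating `pred` one time less than its period inverts it, so the sequence runs forward; its
  -- `k`th arc enters the vertex number `k + 1`.
  dart k := L.li i ((L.pred i)^[(Function.minimalPeriod (L.pred i) u - 1) * (k + 1)] u)
  len_pos := Function.minimalPeriod_pos_of_mem_periodicPts h
  dart_add k := by
    congr 1
    rw [← Function.iterate_mod_minimalPeriod_eq, add_right_comm, mul_add,
        Nat.add_mul_mod_self_right,
      Function.iterate_mod_minimalPeriod_eq]

variable {L i} in
theorem lo_leftIn {u : D} (h : u ∈ Function.periodicPts (L.pred i)) (k : ℕ) :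
    L.lo i ((L.leftIn i u h).dart k) =
      (L.pred i)^[(Function.minimalPeriod (L.pred i) u - 1) * k] u := by
  change L.pred i ((L.pred i)^[_] u) = _
  have := Function.minimalPeriod_pos_of_mem_periodicPts h
  rw [← Function.iterate_succ_apply' (f := L.pred i), ← Function.iterate_mod_minimalPeriod_eq,
      mul_add,
    mul_one, Nat.succ_eq_add_one, add_assoc, Nat.sub_add_cancel this, Nat.add_mod_right,
    Function.iterate_mod_minimalPeriod_eq]

variable {L i} in
theorem pred_mod {u : D} (h : u ∈ Function.periodicPts (L.pred i)) (k : ℕ) :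
    (L.pred i)^[k] ((L.pred i)^[(Function.minimalPeriod (L.pred i) u - 1) * k] u) = u := by
  have h1 := Function.minimalPeriod_pos_of_mem_periodicPts h
  rw [← Function.iterate_add_apply, ← Function.iterate_mod_minimalPeriod_eq]
  obtain ⟨m, hm⟩ := Nat.exists_eq_add_of_lt h1
  rw [hm]
  have : k + (0 + m + 1 - 1) * k = k * (0 + m + 1) := by
    rw [show 0 + m + 1 - 1 = m by omega]; ring
  rw [this, Nat.mul_mod_left, Function.iterate_zero_apply]

theorem li_leftIn {u : D} (h : u ∈ Function.periodicPts (L.pred i)) (k : ℕ) :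
    L.li i ((L.leftIn i u h).dart (k + 1)) = (L.leftIn i u h).dart k := by
  rw [L.li_eq i (L.sameVertex_lo i _), lo_leftIn]
  rfl

theorem isCycle_leftIn {u : D} (h : u ∈ Function.periodicPts (L.pred i)) :
    L.IsCycle i (L.leftIn i u h) := by
  refine ⟨fun k => ⟨L.isArc_li i _, ?_⟩, fun p q hp hq hpq => ?_⟩
  · rw [← li_leftIn]; exact L.sameVertex_li i _
  · rw [← L.lo_eq_iff i, lo_leftIn, lo_leftIn] at hpq
    have h1 := congr_arg (L.pred i)^[p + q] hpq
    rw [add_comm p q, Function.iterate_add_apply, pred_mod h, add_comm q p,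
      Function.iterate_add_apply, pred_mod h] at h1
    exact (Function.iterate_injOn_Iio_minimalPeriod hq hp h1).symm

variable [Finite D]

theorem index_lo_le {d x : D} (h : G.SameVertex d x) (hx : L.phase i x = 2) :
    L.index i (L.lo i d) ≤ L.index i x := by
  obtain ⟨h1, h2, -⟩ := (L.exists_unique_turn i d (show 1 < 4 by norm_num)).choose_spec.1
  have h3 := L.index_lt_of_phase_lt i (h1.symm.trans h) (by omega)
  have h4 := L.index_rot_iterate i 1 (L.exists_unique_turn i d (show 1 < 4 by norm_num)).choose
  rw [Function.iterate_one] at h4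
  rw [lo, h4]
  exact (Nat.mod_le _ _).trans h3

theorem index_le_li {d x : D} (h : G.SameVertex d x) (hx : L.phase i x = 0) :
    L.index i x ≤ L.index i (G.rev (L.li i d)) := by
  obtain ⟨h1, -, h2⟩ := (L.exists_unique_turn i d (show 0 < 4 by norm_num)).choose_spec.1
  have h3 := L.index_lt_of_phase_lt i (h.symm.trans (Equiv.Perm.sameCycle_apply_right.2 h1))
    (by omega)
  have h4 := L.index_rot_iterate i 1 (L.exists_unique_turn i d (show 0 < 4 by norm_num)).choose
  rw [Function.iterate_one] at h4
  rw [h4] at h3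
  rw [li, G.rev_rev]
  exact Nat.le_of_lt_succ (h3.trans_le (Nat.mod_le _ _))

end REL

/-! ### Strands: parallel copies of the two cycles, uncrossed. -/

/-- A cycle `a` that always leaves through the leftmost edge and a cycle `b` that always enters
through the leftmost edge. We follow one of `p` parallel copies of `a` and `q` parallel copies of
`b`, which switch between `a` and `b` so that they do not cross. -/
structure Strands {D : Type} {G : TorusTriangulation D} (L : REL G) (i : Fin 2) where
  a : ClosedSeq D
  b : ClosedSeq D
  ha : L.IsCycle i a
  hb : L.IsCycle i b
  lo_a : ∀ k, L.lo i (a.dart k) = a.dart k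
  li_b : ∀ k, L.li i (b.dart (k + 1)) = b.dart k

namespace Strands

open Classical

variable {D : Type} {G : TorusTriangulation D} {L : REL G} {i : Fin 2} (S : Strands L i)

/-- `d` is an arc of `a`. -/
def InA (d : D) : Prop := ∃ k, S.a.dart k = d

/-- `d` is an arc of `b`. -/
def InB (d : D) : Prop := ∃ k, S.b.dart k = d

/-- `v` is (the leftmost outgoing edge of) a vertex of `b`. -/
def OnB (v : D) : Prop := ∃ k, L.lo i (S.b.dart k) = v

/-- The arc of `b` that leaves `v`. -/
noncomputable def bOut (v : D) : D := if h : S.OnB v then S.b.dart h.choose else v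

variable {S}

theorem InA.lo {d : D} (h : S.InA d) : L.lo i d = d := by
  obtain ⟨k, rfl⟩ := h; exact S.lo_a k

theorem InA.isArc {d : D} (h : S.InA d) : L.IsArc i d := by
  obtain ⟨k, rfl⟩ := h; exact (S.ha.1 k).1

theorem InB.isArc {d : D} (h : S.InB d) : L.IsArc i d := by
  obtain ⟨k, rfl⟩ := h; exact (S.hb.1 k).1

theorem InB.onB {d : D} (h : S.InB d) : S.OnB (L.lo i d) := by
  obtain ⟨k, rfl⟩ := h; exact ⟨k, rfl⟩

theorem InA.succ {d : D} (h : S.InA d) : S.InA (L.lo i (G.rev d)) := by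
  obtain ⟨k, rfl⟩ := h
  exact ⟨k + 1, by rw [L.lo_eq i (S.ha.1 k).2, S.lo_a]⟩

theorem InB.succ {d : D} (h : S.InB d) : S.OnB (L.lo i (G.rev d)) := by
  obtain ⟨k, rfl⟩ := h
  exact ⟨k + 1, by rw [L.lo_eq i (S.hb.1 k).2]⟩

theorem OnB.spec {v : D} (h : S.OnB v) : S.InB (S.bOut v) ∧ L.lo i (S.bOut v) = v := by
  rw [bOut, dif_pos h]
  exact ⟨⟨_, rfl⟩, h.choose_spec⟩

theorem InB.bOut_eq {d : D} (h : S.InB d) : S.bOut (L.lo i d) = d := by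
  obtain ⟨⟨m, hm⟩, h2⟩ := h.onB.spec
  obtain ⟨k, rfl⟩ := h
  rw [← hm] at h2 ⊢
  exact ClosedSeq.dart_eq_of_mod (S.hb.2.mod_eq ((L.lo_eq_iff i).1 h2))

theorem InA.eq_of_head {d e : D} (hd : S.InA d) (he : S.InA e)
    (h : L.lo i (G.rev d) = L.lo i (G.rev e)) : d = e := by
  obtain ⟨k, rfl⟩ := hd
  obtain ⟨m, rfl⟩ := he
  rw [L.lo_eq_iff] at h
  exact S.ha.dart_eq_pred ((S.ha.1 k).2.symm.trans (h.trans (S.ha.1 m).2))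

theorem InB.eq_of_head {d e : D} (hd : S.InB d) (he : S.InB e)
    (h : L.lo i (G.rev d) = L.lo i (G.rev e)) : d = e := by
  obtain ⟨k, rfl⟩ := hd
  obtain ⟨m, rfl⟩ := he
  rw [L.lo_eq_iff] at h
  exact S.hb.dart_eq_pred ((S.hb.1 k).2.symm.trans (h.trans (S.hb.1 m).2))

variable (S) (p q : ℕ)

/-- The vertex `v`, given by its leftmost outgoing edge, and the number of strands to the right. -/
def Valid (s : D × ℕ) : Prop :=
  L.lo i s.1 = s.1 ∧ s.2 < (if S.InA s.1 then p else 0) + (if S.OnB s.1 then q else 0)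

/-- The arc on which a strand leaves a vertex. -/
noncomputable def out (s : D × ℕ) : D := if S.OnB s.1 ∧ s.2 < q then S.bOut s.1 else s.1

/-- The number of strands on the right that leave the vertex `v` through another arc than `d`. -/
noncomputable def loss (v d : D) : ℕ := if S.OnB v ∧ d ≠ S.bOut v then q else 0

/-- The number of strands on the right that reach the head of `d` through another arc. -/
noncomputable def gain (d : D) : ℕ := if S.InA (L.lo i (G.rev d)) ∧ ¬ S.InA d then p else 0

/-- The next vertex on a strand. -/
noncomputable def step (s : D × ℕ) : D × ℕ :=
  (L.lo i (G.rev (S.out q s)), s.2 - S.loss q s.1 (S.out q s) + S.gain p (S.out q s))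

variable {S p q}

theorem Valid.lo_out {s : D × ℕ} (hs : S.Valid p q s) : L.lo i (S.out q s) = s.1 := by
  unfold out
  split_ifs with h
  · exact h.1.spec.2
  · exact hs.1

/-- Since `a` leaves through the leftmost arc, the `q` rightmost strands continue on `b` and the
others on `a`. The three cases are a common arc, an arc of `a` alone and an arc of `b` alone; `loss`
subtracts the strands that part to the right. -/
theorem Valid.cases {s : D × ℕ} (hs : S.Valid p q s) :
    (S.InA (S.out q s) ∧ S.InB (S.out q s) ∧ S.loss q s.1 (S.out q s) = 0) ∨
    (S.InA (S.out q s) ∧ ¬ S.InB (S.out q s) ∧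
      (if S.OnB s.1 then q else 0) = S.loss q s.1 (S.out q s) ∧ S.loss q s.1 (S.out q s) ≤ s.2 ∧
      s.2 < S.loss q s.1 (S.out q s) + p) ∨
    (¬ S.InA (S.out q s) ∧ S.InB (S.out q s) ∧ S.loss q s.1 (S.out q s) = 0 ∧ s.2 < q) := by
  have hlo := hs.lo_out
  by_cases hB : S.InB (S.out q s)
  · have h0 : S.loss q s.1 (S.out q s) = 0 := if_neg fun h => h.2 (by rw [← hlo, hB.bOut_eq])
    by_cases hA : S.InA (S.out q s)
    · exact Or.inl ⟨hA, hB, h0⟩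
    · refine Or.inr (Or.inr ⟨hA, hB, h0, ?_⟩)
      have hon := hB.onB
      rw [hlo] at hon
      by_contra hq
      have he : S.out q s = s.1 := if_neg fun h => hq h.2
      have h2 := hs.2
      rw [he] at hA
      rw [if_neg hA, if_pos hon] at h2
      omega
  · have hq : ¬ (S.OnB s.1 ∧ s.2 < q) := fun h => hB (by rw [out, if_pos h]; exact h.1.spec.1)
    have he : S.out q s = s.1 := if_neg hq
    have hl : (if S.OnB s.1 then q else 0) = S.loss q s.1 (S.out q s) := by
      unfold loss
      congr 1
      exact propext ⟨fun h => ⟨h, fun h' => hB (h' ▸ h.spec.1)⟩, fun h => h.1⟩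
    have h2 := hs.2
    rw [hl] at h2
    have hle : S.loss q s.1 (S.out q s) ≤ s.2 := by
      rw [← hl]
      split_ifs with h
      · exact not_lt.1 fun h' => hq ⟨h, h'⟩
      · exact Nat.zero_le _
    have hA : S.InA s.1 := by
      by_contra hA
      rw [if_neg hA] at h2
      omega
    rw [if_pos hA] at h2
    exact Or.inr (Or.inl ⟨he ▸ hA, hB, hl, hle, by omega⟩)

theorem Valid.isArc_out {s : D × ℕ} (hs : S.Valid p q s) : L.IsArc i (S.out q s) := by
  rcases hs.cases with h | h | h
  · exact h.1.isArc
  · exact h.1.isArc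
  · exact h.2.1.isArc

theorem Valid.loss_le {s : D × ℕ} (hs : S.Valid p q s) : S.loss q s.1 (S.out q s) ≤ s.2 := by
  rcases hs.cases with h | h | h
  · rw [h.2.2]; exact Nat.zero_le _
  · exact h.2.2.2.1
  · rw [h.2.2.1]; exact Nat.zero_le _

theorem Valid.lt {s : D × ℕ} (hs : S.Valid p q s) : s.2 < p + q := by
  have := hs.2
  split_ifs at this <;> omega

theorem Valid.step {s : D × ℕ} (hs : S.Valid p q s) : S.Valid p q (S.step p q s) := by
  refine ⟨L.lo_lo i _, ?_⟩
  change s.2 - S.loss q s.1 (S.out q s) + S.gain p (S.out q s) <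
    @ite ℕ (S.InA (L.lo i (G.rev (S.out q s)))) (propDecidable _) p 0 +
      @ite ℕ (S.OnB (L.lo i (G.rev (S.out q s)))) (propDecidable _) q 0
  have hlt := hs.lt
  rcases hs.cases with ⟨hA, hB, h0⟩ | ⟨hA, hB, -, h1, h2⟩ | ⟨hA, hB, h0, h1⟩
  · rw [if_pos hA.succ, if_pos hB.succ, h0, gain, if_neg fun h => h.2 hA]
    omega
  · rw [if_pos hA.succ, gain, if_neg fun h => h.2 hA]
    omega
  · rw [if_pos hB.succ, h0, gain]
    by_cases h : S.InA (L.lo i (G.rev (S.out q s)))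
    · rw [if_pos ⟨h, hA⟩, if_pos h]; omega
    · rw [if_neg fun h' => h h'.1, if_neg h]; omega

/-- Strands do not merge. If they reach a vertex through different arcs, one arc belongs to `a`
alone and the other to `b` alone. The arc of `b` enters further left, so its strands have at least
`p` strands on their right and those of `a` fewer than `p`. -/
theorem step_injOn : Set.InjOn (S.step p q) {s | S.Valid p q s} := by
  intro s hs t ht hst
  obtain ⟨h1, h2⟩ := Prod.ext_iff.1 hst
  dsimp only [Strands.step] at h1 h2
  have ls := hs.loss_le
  have lt := ht.loss_le
  have main : S.out q s = S.out q t := by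
    by_contra hne
    have notA (h : S.InA (S.out q s)) (h' : S.InA (S.out q t)) : False := hne (h.eq_of_head h' h1)
    have notB (h : S.InB (S.out q s)) (h' : S.InB (S.out q t)) : False := hne (h.eq_of_head h' h1)
    rcases hs.cases with ⟨hA, hB, -⟩ | ⟨hA, hB, -, -, h3⟩ | ⟨hA, hB, h0, h3⟩ <;>
    rcases ht.cases with ⟨hA', hB', -⟩ | ⟨hA', hB', -, -, h3'⟩ | ⟨hA', hB', h0', h3'⟩
    · exact notA hA hA'
    · exact notA hA hA'
    · exact notB hB hB'
    · exact notA hA hA'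
    · exact notA hA hA'
    · have g1 : S.gain p (S.out q s) = 0 := if_neg fun h => h.2 hA
      have g2 : S.gain p (S.out q t) = p := if_pos ⟨h1 ▸ hA.succ, hA'⟩
      omega
    · exact notB hB hB'
    · have g1 : S.gain p (S.out q t) = 0 := if_neg fun h => h.2 hA'
      have g2 : S.gain p (S.out q s) = p := if_pos ⟨h1 ▸ hA'.succ, hA⟩
      omega
    · exact notB hB hB'
  have hv : s.1 = t.1 := by rw [← hs.lo_out, main, ht.lo_out]
  refine Prod.ext hv ?_
  rw [main, hv] at h2 ls
  omega

theorem valid_iterate {s : D × ℕ} (hs : S.Valid p q s) (k : ℕ) :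
    S.Valid p q ((S.step p q)^[k] s) := by
  induction k with
  | zero => exact hs
  | succ k ih => rw [Function.iterate_succ_apply']; exact ih.step

theorem Valid.mem {s : D × ℕ} (hs : S.Valid p q s) : S.InA (S.out q s) ∨ S.InB (S.out q s) := by
  rcases hs.cases with h | h | h
  · exact Or.inl h.1
  · exact Or.inl h.1
  · exact Or.inr h.2.1

variable [Fintype D]

theorem Valid.mem_periodicPts {s : D × ℕ} (hs : S.Valid p q s) :
    s ∈ Function.periodicPts (S.step p q) := by
  let V : Set (D × ℕ) := {s | S.Valid p q s}
  have hfin : V.Finite := by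
    refine ((Set.finite_univ (α := D)).prod (Set.finite_Iio (p + q))).subset fun s hs => ?_
    exact ⟨Set.mem_univ _, Valid.lt hs⟩
  have : Finite V := hfin
  have hm : Set.MapsTo (S.step p q) V V := fun s hs => Valid.step hs
  have hinj : Function.Injective (hm.restrict _ _ _) := hm.restrict_inj.2 step_injOn
  obtain ⟨n, hn, h⟩ := hinj.mem_periodicPts ⟨s, hs⟩
  refine ⟨n, hn, ?_⟩
  have := congr_arg Subtype.val h
  rwa [Set.MapsTo.iterate_restrict, Set.MapsTo.val_restrict_apply] at this

/-- The closed walk that follows a strand. -/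
noncomputable def walk {s : D × ℕ} (hs : S.Valid p q s) : ClosedSeq D where
  len := Function.minimalPeriod (S.step p q) s
  dart k := S.out q ((S.step p q)^[k] s)
  len_pos := Function.minimalPeriod_pos_of_mem_periodicPts hs.mem_periodicPts
  dart_add k := by rw [Function.iterate_add_minimalPeriod_eq]

variable {s : D × ℕ} (hs : S.Valid p q s)

theorem lo_walk (k : ℕ) : L.lo i ((walk hs).dart k) = ((S.step p q)^[k] s).1 :=
  (valid_iterate hs k).lo_out

theorem isClosedWalk_walk : L.IsClosedWalk i (walk hs) := by
  refine fun k => ⟨(valid_iterate hs k).isArc_out, ?_⟩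
  rw [← L.lo_eq_iff i, lo_walk, Function.iterate_succ_apply']
  rfl

theorem walk_state_inj {k l : ℕ} (hk : k < (walk hs).len) (hl : l < (walk hs).len)
    (h : (S.step p q)^[k] s = (S.step p q)^[l] s) : k = l :=
  Function.iterate_injOn_Iio_minimalPeriod hk hl h

-- Leaving through the leftmost outgoing arc means that no arc of colour `i` starts to the left of
-- `a`.
variable (S) in
theorem leftOf_a_of_isArc {d : D} (hd : L.IsArc i d) : L.leftOf i S.a d = 0 := by
  refine if_neg ?_
  rintro ⟨k, h1, -, h2⟩
  have := L.index_lo_le i h1.symm ((L.phase_eq_two i).2 hd)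
  rw [S.lo_a] at this
  omega

-- Dually, no arc of colour `i` ends to the left of `b`, which enters through leftmost arcs.
variable (S) in
theorem leftOf_b_of_isArc {d : D} (hd : L.IsArc i d) : L.leftOf i S.b (G.rev d) = 0 := by
  refine if_neg ?_
  rintro ⟨k, h1, h2, -⟩
  have := L.index_le_li i h1.symm ((L.phase_eq_zero i).2 (by rwa [G.rev_rev]))
  rw [S.li_b] at this
  omega

/-- An arc of `b` that joins `a` does so from the left, since it is the leftmost incoming arc; it
never leaves `a` to the left. -/
theorem push_a {d : D} (hd : S.InA d ∨ S.InB d) :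
    L.push i S.a d = if S.InA (L.lo i (G.rev d)) ∧ ¬ S.InA d then 1 else 0 := by
  by_cases hA : S.InA d
  · rw [if_neg fun h => h.2 hA]
    obtain ⟨k, rfl⟩ := hA
    exact S.ha.push_self k
  · have hB := hd.resolve_left hA
    rw [REL.push, S.leftOf_a_of_isArc hB.isArc, sub_zero]
    by_cases h : S.InA (L.lo i (G.rev d))
    · rw [if_pos ⟨h, hA⟩]
      obtain ⟨k, hk⟩ := h
      obtain ⟨k, e⟩ := S.a.exists_pred k
      have hv : G.SameVertex (G.rev d) (S.a.dart (k + 1)) := by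
        rw [e, hk]; exact L.sameVertex_lo i _
      rw [S.ha.leftOf_eq hv, if_pos]
      have hin : L.phase i (G.rev d) = 0 :=
        (L.phase_eq_zero i).2 (by rw [G.rev_rev]; exact hB.isArc)
      refine ⟨?_, L.index_lt_of_phase_lt i hv (by rw [hin, S.ha.phase_out]; norm_num)⟩
      obtain ⟨m, rfl⟩ := hB
      have hv' := (S.ha.1 k).2.trans hv.symm
      have h1 := L.index_le_li i (d := S.b.dart (m + 1))
        ((S.hb.1 m).2.symm.trans hv'.symm) (S.ha.phase_in k)
      rw [S.li_b] at h1
      refine lt_of_le_of_ne h1 fun h2 => hA ⟨k, ?_⟩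
      rw [L.index_inj i hv'] at h2
      exact G.rev.injective h2
    · rw [if_neg fun h' => h h'.1]
      refine REL.leftOf_eq_zero fun k hk => h ⟨k, ?_⟩
      rw [L.lo_eq i hk, S.lo_a]

/-- The mirror case: an arc of `a` that parts from `b` is the leftmost outgoing arc, so it parts to
the left and counts negatively. -/
theorem push_b {d : D} (hd : S.InA d ∨ S.InB d) :
    L.push i S.b d = - if S.OnB (L.lo i d) ∧ ¬ S.InB d then 1 else 0 := by
  by_cases hB : S.InB d
  · rw [if_neg fun h => h.2 hB, neg_zero]
    obtain ⟨k, rfl⟩ := hB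
    exact S.hb.push_self k
  · have hA := hd.resolve_right hB
    rw [REL.push, S.leftOf_b_of_isArc hA.isArc, zero_sub, neg_inj]
    by_cases h : S.OnB (L.lo i d)
    · rw [if_pos ⟨h, hB⟩]
      obtain ⟨k, hk⟩ := h
      obtain ⟨k, e⟩ := S.b.exists_pred k
      have hv : G.SameVertex d (S.b.dart (k + 1)) := by
        rw [e]; exact (L.lo_eq_iff i).1 hk.symm
      rw [S.hb.leftOf_eq hv, if_pos]
      have hout : L.phase i d = 2 := (L.phase_eq_two i).2 hA.isArc
      refine ⟨L.index_lt_of_phase_lt i ((S.hb.1 k).2.trans hv.symm)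
        (by rw [hout, S.hb.phase_in]; norm_num), ?_⟩
      have h1 := L.index_lo_le i hv (S.hb.phase_out (k + 1))
      rw [hA.lo] at h1
      refine lt_of_le_of_ne h1 fun h2 => hB ⟨k + 1, ?_⟩
      exact ((L.index_inj i hv).1 h2).symm
    · rw [if_neg fun h' => h h'.1]
      refine REL.leftOf_eq_zero fun k hk => h ⟨k, ?_⟩
      rw [L.lo_eq i hk]

/-- Following a strand, the number of strands on the right changes according to the crossings
with the cycles, pushed off to their left. -/
theorem Valid.step_snd {s : D × ℕ} (hs : S.Valid p q s) : ((S.step p q s).2 : ℚ) =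
    s.2 + (p * L.push i S.a (S.out q s) + q * L.push i S.b (S.out q s)) := by
  have e1 : (S.loss q s.1 (S.out q s) : ℚ) =
      q * if S.OnB (L.lo i (S.out q s)) ∧ ¬ S.InB (S.out q s) then 1 else 0 := by
    rw [hs.lo_out, loss]
    have : (S.OnB s.1 ∧ S.out q s ≠ S.bOut s.1) ↔ (S.OnB s.1 ∧ ¬ S.InB (S.out q s)) := by
      refine and_congr_right fun h => not_congr ⟨fun h' => h' ▸ h.spec.1, fun h' => ?_⟩
      have := h'.bOut_eq
      rw [hs.lo_out] at this
      exact this.symm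
    simp only [this]
    split_ifs <;> simp
  have e2 : (S.gain p (S.out q s) : ℚ) =
      p * if S.InA (L.lo i (G.rev (S.out q s))) ∧ ¬ S.InA (S.out q s) then 1 else 0 := by
    rw [gain]; split_ifs <;> simp
  dsimp only [Strands.step]
  rw [push_a hs.mem, push_b hs.mem]
  push_cast [Nat.cast_sub hs.loss_le]
  rw [e1, e2]
  ring

end Strands

theorem ClosedSeq.IsSimple.isWeaklySimple {D : Type} {G : TorusTriangulation D} {w : ClosedSeq D}
    (h : w.IsSimple G) : w.IsWeaklySimple G := by
  refine ⟨fun v => ?_, ?_, ?_⟩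
  · refine le_trans ?_ one_le_two
    refine (Set.ncard_le_one ((Set.finite_Iio w.len).subset fun p hp => hp.1)).2 ?_
    exact fun p hp q hq => h p q hp.1 hq.1 (hp.2.symm.trans hq.2)
  · rintro ⟨p, q, l, h1, h2, -⟩
    exact h1 (dart_eq_of_mod (Nat.ModEq.add_right_cancel' 1 (h.mod_eq h2)))
  · rintro ⟨r, h0, hr, h1⟩
    have := h r 0 hr w.len_pos (by rw [← h1 0, zero_add]; exact Equiv.Perm.SameCycle.refl _ _)
    omega

namespace REL

variable {D : Type} [DecidableEq D] [Fintype D] {G : TorusTriangulation D} {L : REL G} {i : Fin 2}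
  (O : Orbits G)

/-- The roles of the colours are exchanged: a simple cycle of the other colour through an end of the
first arc is pushed off, and `w`, which may revisit vertices, crosses it in one direction only. -/
theorem IsClosedWalk.sum_ne_zero (hL : L.Realizable) {w : ClosedSeq D} (hw : L.IsClosedWalk i w) :
    ¬ (w.sum (O.crossing 0) = 0 ∧ w.sum (O.crossing 1) = 0) := by
  rintro ⟨h0, h1⟩
  obtain ⟨j, hij⟩ := exists_ne i
  obtain ⟨z, hz, k, hk⟩ := hL j _ (L.isArc_lo j (leftEnd G j (w.dart 0)))
  have := hz.pair_pos_of_mem O hij.symm hw (k := k) (m := 0) (by rw [hk]; exact L.sameVertex_lo j _)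
  simp [ClosedSeq.pair, h0, h1] at this

end REL

/-! ### The class of a strand, simplicity, and feedback. -/

namespace Strands

variable {D : Type} [DecidableEq D] [Fintype D] {G : TorusTriangulation D} {L : REL G} {i : Fin 2}
  {S : Strands L i} {p q : ℕ} {s : D × ℕ} (hs : S.Valid p q s) (O : Orbits G)

/-- The number of strands on the right returns to its initial value after a full turn, and
`Valid.step_snd` expresses its change by crossings. So the class of the strand is parallel to `p[a]
+ q[b]`. -/
theorem sum_weighted : p * S.a.pair O (walk hs) + q * S.b.pair O (walk hs) = 0 := by
  have hw := (isClosedWalk_walk hs).isWalk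
  rw [← S.ha.sum_push O hw, ← S.hb.sum_push O hw, ← ClosedSeq.sum_mul, ← ClosedSeq.sum_mul,
    ← ClosedSeq.sum_add]
  have h (k : ℕ) : (p * L.push i S.a ((walk hs).dart k) + q * L.push i S.b ((walk hs).dart k)) =
      (((S.step p q)^[k + 1] s).2 : ℚ) - ((S.step p q)^[k] s).2 := by
    rw [Function.iterate_succ_apply', (valid_iterate hs k).step_snd]
    simp [walk]
  simp only [ClosedSeq.sum, h]
  rw [Finset.sum_range_sub (fun k => (((S.step p q)^[k] s).2 : ℚ))]
  change (((S.step p q)^[Function.minimalPeriod (S.step p q) s] s).2 : ℚ) - _ = 0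
  rw [Function.iterate_minimalPeriod, Function.iterate_zero_apply, sub_self]

/-- Closed walks may join `a` from the left but never leave it to the left, so the class of `a` is
on the boundary of the cone. The same holds for `b` on the other side. -/
theorem pair_a_nonneg (S : Strands L i) {z : ClosedSeq D} (hz : L.IsClosedWalk i z) :
    0 ≤ S.a.pair O z := by
  rw [← S.ha.sum_push O hz.isWalk]
  refine z.sum_nonneg fun k => ?_
  rw [REL.push, S.leftOf_a_of_isArc (hz k).1, sub_zero]
  exact REL.leftOf_nonneg _ _ _ _

theorem pair_b_nonpos (S : Strands L i) {z : ClosedSeq D} (hz : L.IsClosedWalk i z) :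
    0 ≤ - S.b.pair O z := by
  rw [← S.hb.sum_push O hz.isWalk, neg_eq_neg_one_mul, ← ClosedSeq.sum_mul]
  refine z.sum_nonneg fun k => ?_
  rw [REL.push, S.leftOf_b_of_isArc (hz k).1, zero_sub, neg_mul_neg, one_mul]
  exact REL.leftOf_nonneg _ _ _ _

/-- If `p[a] + q[b]` is divisible by `m`, the combined push-off of the copies is a coboundary modulo
`m`. Hence the vertex determines the number of strands on the right modulo `m`; as this number is
less than `p + q ≤ m`, the vertex determines the state. -/
theorem isSimple_walk {m x y : ℤ} (hm : (p + q : ℕ) ≤ m)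
    (hx : p * S.a.sum (O.crossing 0) + q * S.b.sum (O.crossing 0) = m * x)
    (hy : p * S.a.sum (O.crossing 1) + q * S.b.sum (O.crossing 1) = m * y) :
    (walk hs).IsSimple G := by
  obtain ⟨f, hf, ha⟩ := S.ha.push_eq O
  obtain ⟨g, hg, hb⟩ := S.hb.push_eq O
  have key (k : ℕ) : ∃ t : ℤ, (((S.step p q)^[k] s).2 : ℚ) - s.2 = p * (f ((walk hs).dart k) -
      f ((walk hs).dart 0)) + q * (g ((walk hs).dart k) - g ((walk hs).dart 0)) + m * t := by
    induction k with
    | zero => exact ⟨0, by simp⟩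
    | succ k ih =>
      obtain ⟨t, ht⟩ := ih
      obtain ⟨c, hc⟩ := O.crossing_int 0 ((walk hs).dart k)
      obtain ⟨d, hd⟩ := O.crossing_int 1 ((walk hs).dart k)
      have h1 := (valid_iterate hs k).step_snd
      rw [← Function.iterate_succ_apply' (f := S.step p q)] at h1
      change _ = _ + (p * L.push i S.a ((walk hs).dart k) +
        q * L.push i S.b ((walk hs).dart k)) at h1
      rw [ha, hb, hf _ _ ((isClosedWalk_walk hs) k).2, hg _ _ ((isClosedWalk_walk hs) k).2,
        hc, hd] at h1
      refine ⟨t + (x * d - y * c), ?_⟩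
      push_cast
      linear_combination h1 + ht + d * hx - c * hy
  intro k l hk hl h
  refine walk_state_inj hs hk hl (Prod.ext ?_ ?_)
  · rw [← lo_walk hs, ← lo_walk hs, L.lo_eq i h]
  · obtain ⟨t, ht⟩ := key k
    obtain ⟨u, hu⟩ := key l
    rw [hf _ _ h, hg _ _ h] at ht
    have h1 : ((((S.step p q)^[k] s).2 : ℤ) - ((S.step p q)^[l] s).2) = m * (t - u) := by
      have : ((((S.step p q)^[k] s).2 : ℚ) - ((S.step p q)^[l] s).2) = m * (t - u) := by
        linear_combination ht - hu
      exact_mod_cast this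
    have hk' := (valid_iterate hs k).lt
    have hl' := (valid_iterate hs l).lt
    have h2 := Int.eq_zero_of_abs_lt_dvd ⟨_, h1⟩ (by rw [abs_lt]; omega)
    omega

omit [DecidableEq D] in
theorem len_le_of_isSimple {w : ClosedSeq D} (h : w.IsSimple G) : w.len ≤ Fintype.card D := by
  rw [← Fintype.card_fin w.len]
  refine Fintype.card_le_of_injective (fun k : Fin w.len => w.dart k) fun k l hkl => ?_
  refine Fin.ext (h k l k.2 l.2 ?_)
  change w.dart k = w.dart l at hkl
  rw [hkl]
  exact Equiv.Perm.SameCycle.refl _ _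

omit [DecidableEq D] in
theorem walk_len_le : (walk hs).len ≤ (p + q) * Fintype.card D := by
  rw [← Fintype.card_fin (walk hs).len, ← Fintype.card_fin (p + q), ← Fintype.card_prod]
  refine Fintype.card_le_of_injective (fun k : Fin (walk hs).len =>
    ((⟨((S.step p q)^[k] s).2, (valid_iterate hs k).lt⟩ : Fin (p + q)), ((S.step p q)^[k] s).1))
    fun k l hkl => Fin.ext (walk_state_inj hs k.2 l.2 ?_)
  simp only [Prod.mk.injEq, Fin.mk.injEq] at hkl
  exact Prod.ext hkl.2 hkl.1

section

variable (hL : L.Realizable) (h0 : S.a.pair O S.b ≠ 0) (hp : 0 < p) (hq : 0 < q)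
include hL h0 hp hq

/-- If one pairing vanished, so would the other by `sum_weighted`. As `[a]` and `[b]` are
independent, Cramer's rule would make the class of the strand zero. -/
theorem pair_walk_pos : 0 < S.a.pair O (walk hs) ∧ 0 < - S.b.pair O (walk hs) := by
  have hC := isClosedWalk_walk hs
  have h1 := S.pair_a_nonneg O hC
  have h2 := S.pair_b_nonpos O hC
  have h3 := sum_weighted hs O
  have hp' : (0 : ℚ) < p := by exact_mod_cast hp
  have hq' : (0 : ℚ) < q := by exact_mod_cast hq
  have hne : S.a.pair O (walk hs) ≠ 0 := by
    intro ha
    have hb : S.b.pair O (walk hs) = 0 := by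
      rw [ha, mul_zero, zero_add] at h3
      exact (mul_eq_zero.1 h3).resolve_left hq'.ne'
    refine hC.sum_ne_zero O hL ?_
    unfold ClosedSeq.pair at ha hb h0
    constructor
    · refine (mul_eq_zero.1 (?_ : (S.a.sum (O.crossing 0) * S.b.sum (O.crossing 1) -
        S.a.sum (O.crossing 1) * S.b.sum (O.crossing 0)) * _ = 0)).resolve_left h0
      linear_combination S.b.sum (O.crossing 0) * ha - S.a.sum (O.crossing 0) * hb
    · refine (mul_eq_zero.1 (?_ : (S.a.sum (O.crossing 0) * S.b.sum (O.crossing 1) -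
        S.a.sum (O.crossing 1) * S.b.sum (O.crossing 0)) * _ = 0)).resolve_left h0
      linear_combination S.b.sum (O.crossing 1) * ha - S.a.sum (O.crossing 1) * hb
  have h4 := lt_of_le_of_ne h1 hne.symm
  exact ⟨h4, by nlinarith⟩

theorem isFeedback_walk (hweak : (walk hs).IsWeaklySimple G) : L.IsFeedback O i (walk hs) := by
  have hC := isClosedWalk_walk hs
  have h1 := pair_walk_pos hs O hL h0 hp hq
  refine ⟨hC, hweak, O.homotopyClass_ne_zero (hC.sum_ne_zero O hL), fun c hc => ?_⟩
  refine REL.exists_common_arc O hL hC (hC.sum_ne_zero O hL)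
    (Or.inr ⟨S.a, S.b, S.ha.1, S.hb.1, ?_, ?_⟩) hc
  · rw [ClosedSeq.pair_swap]; linarith
  · rw [ClosedSeq.pair_swap]; linarith

end

end Strands

/-! ### One copy of each cycle: weakly simple walks. -/

namespace Strands

variable {D : Type} [Fintype D] {G : TorusTriangulation D} {L : REL G} {i : Fin 2}
  {S : Strands L i} {s : D × ℕ} (hs : S.Valid 1 1 s)

theorem walk_mod_eq {p q : ℕ} {s : D × ℕ} (hs : S.Valid p q s) {k l : ℕ}
    (h : (S.step p q)^[k] s = (S.step p q)^[l] s) : k % (walk hs).len = l % (walk hs).len := by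
  refine walk_state_inj hs (Nat.mod_lt _ (walk hs).len_pos) (Nat.mod_lt _ (walk hs).len_pos) ?_
  change (S.step p q)^[k % Function.minimalPeriod _ _] s =
    (S.step p q)^[l % Function.minimalPeriod _ _] s
  rw [Function.iterate_mod_minimalPeriod_eq, Function.iterate_mod_minimalPeriod_eq, h]

theorem atMostTwice_walk : (walk hs).AtMostTwice G := by
  intro v
  have h2 : (Set.Iio 2 : Set ℕ).ncard = 2 := by simp [Set.ncard_eq_toFinset_card']
  rw [← h2]
  refine Set.ncard_le_ncard_of_injOn (fun k => ((S.step 1 1)^[k] s).2)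
    (fun k _ => (valid_iterate hs k).lt) (fun k hk l hl h => ?_) (Set.finite_Iio 2)
  refine walk_state_inj hs hk.1 hl.1 (Prod.ext ?_ h)
  rw [← lo_walk hs, ← lo_walk hs, L.lo_eq i (hk.2.symm.trans hl.2)]

omit [Fintype D] in
theorem step_snd_of_not_inA {s : D × ℕ} (hs : S.Valid 1 1 s) (hA : ¬ S.InA (S.out 1 s))
    (hA' : S.InA (L.lo i (G.rev (S.out 1 s)))) : S.InB (S.out 1 s) ∧ (S.step 1 1 s).2 = 1 := by
  rcases hs.cases with h | h | ⟨-, hB, h0, h1⟩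
  · exact absurd h.1 hA
  · exact absurd h.1 hA
  · refine ⟨hB, ?_⟩
    change s.2 - S.loss 1 s.1 (S.out 1 s) + S.gain 1 (S.out 1 s) = 1
    rw [h0, gain, if_pos ⟨hA', hA⟩]
    omega

omit [Fintype D] in
theorem step_snd_of_not_inB {s : D × ℕ} (hs : S.Valid 1 1 s) (hB : ¬ S.InB (S.out 1 s)) :
    S.InA (S.out 1 s) ∧ (S.step 1 1 s).2 = 0 := by
  rcases hs.cases with h | ⟨hA, -, -, h0, h1⟩ | h
  · exact absurd h.2.1 hB
  · refine ⟨hA, ?_⟩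
    change s.2 - S.loss 1 s.1 (S.out 1 s) + S.gain 1 (S.out 1 s) = 0
    rw [gain, if_neg fun h => h.2 hA]
    omega
  · exact absurd h.2.1 hB

/-- After an arc of `b` that joins `a` there is exactly one strand on the right. The arc thus
determines the state, and a repetition would return to this state before the minimal period. -/
theorem not_isRepetition_walk {k : ℕ} (hA : ¬ S.InA ((walk hs).dart k))
    (hA' : S.InA (L.lo i (G.rev ((walk hs).dart k)))) : ¬ (walk hs).IsRepetition := by
  rintro ⟨r, h0, hr, h⟩
  have key (m : ℕ) (hm : (walk hs).dart m = (walk hs).dart k) :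
      (S.step 1 1)^[m + 1] s = (L.lo i (G.rev ((walk hs).dart k)), 1) := by
    rw [← hm] at hA hA'
    have h1 := (step_snd_of_not_inA (valid_iterate hs m) hA hA').2
    rw [← Function.iterate_succ_apply' (f := S.step 1 1)] at h1
    refine Prod.ext ?_ h1
    rw [← lo_walk hs, ← L.lo_eq i (isClosedWalk_walk hs m).2, hm]
  have h1 := walk_mod_eq hs ((key _ (h k)).trans (key _ rfl).symm)
  have h2 : (k + 1 + r) ≡ k + 1 + 0 [MOD (walk hs).len] := by rwa [add_right_comm]
  have h3 := Nat.ModEq.add_left_cancel' _ h2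
  rw [Nat.ModEq, Nat.zero_mod, Nat.mod_eq_of_lt hr] at h3
  omega

/-- The change of the number of strands on the right depends only on the arc, so two passes keep
their relative position on common arcs. -/
theorem snd_sub_snd {p q : ℕ} (l : ℕ)
    (h : ∀ j < l, (walk hs).dart (p + j) = (walk hs).dart (q + j)) :
    (((S.step 1 1)^[p + l] s).2 : ℚ) - ((S.step 1 1)^[q + l] s).2 =
      ((S.step 1 1)^[p] s).2 - ((S.step 1 1)^[q] s).2 := by
  induction l with
  | zero => rfl
  | succ l ih =>
    rw [← ih fun j hj => h j (by omega), ← add_assoc, ← add_assoc, Function.iterate_succ_apply',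
      Function.iterate_succ_apply', (valid_iterate hs _).step_snd, (valid_iterate hs _).step_snd]
    have := h l (by omega)
    change S.out 1 ((S.step 1 1)^[p + l] s) = S.out 1 ((S.step 1 1)^[q + l] s) at this
    rw [this]
    ring

/-- The pass with a strand on its right came in on `b`, through the leftmost incoming arc, and
finally leaves through the leftmost outgoing arc. It is on the left of the other pass at both ends.
-/
theorem crosses_aux {p q l : ℕ} (hp : ((S.step 1 1)^[p + 1] s).2 = 0)
    (hq : ((S.step 1 1)^[q + 1] s).2 = 1)
    (h1 : (walk hs).dart p ≠ (walk hs).dart q)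
    (h2 : G.SameVertex ((walk hs).dart (p + 1)) ((walk hs).dart (q + 1)))
    (h3 : ∀ j < l, (walk hs).dart (p + 1 + j) = (walk hs).dart (q + 1 + j))
    (h4 : (walk hs).dart (p + 1 + l) ≠ (walk hs).dart (q + 1 + l)) :
    L.index i (G.rev ((walk hs).dart p)) < L.index i (G.rev ((walk hs).dart q)) ∧
      G.SameVertex ((walk hs).dart (p + 1 + l)) ((walk hs).dart (q + 1 + l)) ∧
      L.index i ((walk hs).dart (q + 1 + l)) < L.index i ((walk hs).dart (p + 1 + l)) := by
  have hw := isClosedWalk_walk hs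
  refine ⟨?_, ?_⟩
  · have hhead : L.lo i (G.rev ((walk hs).dart p)) = L.lo i (G.rev ((walk hs).dart q)) := by
      rw [L.lo_eq i (hw p).2, L.lo_eq i h2, L.lo_eq i (hw q).2]
    have hB : S.InB ((walk hs).dart q) := by
      by_contra hB
      have := (step_snd_of_not_inB (valid_iterate hs q) hB).2
      rw [← Function.iterate_succ_apply' (f := S.step 1 1), hq] at this
      exact one_ne_zero this
    obtain ⟨m, hm⟩ := hB
    have hvert : G.SameVertex (S.b.dart (m + 1)) (G.rev ((walk hs).dart p)) := by
      refine (S.hb.1 m).2.symm.trans ?_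
      rw [hm]
      exact (L.lo_eq_iff i).1 hhead.symm
    have hle := L.index_le_li i hvert ((L.phase_eq_zero i).2 (by rw [G.rev_rev]; exact (hw p).1))
    rw [S.li_b, hm] at hle
    refine lt_of_le_of_ne hle fun h => h1 (G.rev.injective ?_)
    exact (L.index_inj i ((L.lo_eq_iff i).1 hhead)).1 h
  · have hsame : G.SameVertex ((walk hs).dart (p + 1 + l)) ((walk hs).dart (q + 1 + l)) := by
      rcases l with _ | l
      · exact h2
      · have h5 := h3 l (by omega)
        have h6 := (hw (p + 1 + l)).2
        rw [h5] at h6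
        exact h6.symm.trans (hw (q + 1 + l)).2
    refine ⟨hsame, ?_⟩
    have h5 := snd_sub_snd hs l h3
    rw [hp, hq] at h5
    have hq2 := (valid_iterate hs (q + 1 + l)).lt
    have hp2 : ((S.step 1 1)^[p + 1 + l] s).2 = 0 ∧ ((S.step 1 1)^[q + 1 + l] s).2 = 1 := by
      have : (((S.step 1 1)^[p + 1 + l] s).2 : ℤ) - ((S.step 1 1)^[q + 1 + l] s).2 = -1 := by
        have : (((S.step 1 1)^[p + 1 + l] s).2 : ℚ) - ((S.step 1 1)^[q + 1 + l] s).2 = -1 := by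
          rw [h5]; norm_num
        exact_mod_cast this
      omega
    have e : (walk hs).dart (q + 1 + l) = L.lo i ((walk hs).dart (q + 1 + l)) := by
      rw [lo_walk]
      exact if_neg fun h => by omega
    have hle := L.index_lo_le i hsame.symm ((L.phase_eq_two i).2 (hw (p + 1 + l)).1)
    rw [← e] at hle
    refine lt_of_le_of_ne hle fun h => h4 ?_
    exact ((L.index_inj i hsame.symm).1 h).symm

theorem not_crossesItself_walk : ¬ (walk hs).CrossesItself G := by
  rintro ⟨p, q, l, h1, h2, h3, h4, h5⟩
  apply h5
  have hw := isClosedWalk_walk hs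
  have hin (k : ℕ) : L.phase i (G.rev ((walk hs).dart k)) = 0 :=
    (L.phase_eq_zero i).2 (by rw [G.rev_rev]; exact (hw k).1)
  have hout (k : ℕ) : L.phase i ((walk hs).dart k) = 2 := (L.phase_eq_two i).2 (hw k).1
  have hv1 : G.SameVertex (G.rev ((walk hs).dart p)) ((walk hs).dart (p + 1)) := (hw p).2
  have hv2 : G.SameVertex (G.rev ((walk hs).dart p)) (G.rev ((walk hs).dart q)) :=
    (hv1.trans h2).trans (hw q).2.symm
  have hv3 : G.SameVertex (G.rev ((walk hs).dart (p + l))) ((walk hs).dart (p + 1 + l)) := by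
    rw [add_right_comm]; exact (hw (p + l)).2
  have i1 := L.index_lt_of_phase_lt i hv1 (by rw [hin, hout]; norm_num)
  have i2 := L.index_lt_of_phase_lt i (hv2.symm.trans hv1) (by rw [hin, hout]; norm_num)
  have i3 := L.index_lt_of_phase_lt i hv3 (by rw [hin, hout]; norm_num)
  have hne : (S.step 1 1)^[p + 1] s ≠ (S.step 1 1)^[q + 1] s := by
    intro h
    rw [Function.iterate_succ_apply', Function.iterate_succ_apply'] at h
    exact h1 (congr_arg (S.out 1) (step_injOn (valid_iterate hs p) (valid_iterate hs q) h))
  have hp := (valid_iterate hs (p + 1)).lt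
  have hq := (valid_iterate hs (q + 1)).lt
  have hr : ((S.step 1 1)^[p + 1] s).2 ≠ ((S.step 1 1)^[q + 1] s).2 := by
    refine fun h => hne (Prod.ext ?_ h)
    rw [← lo_walk hs, ← lo_walk hs, L.lo_eq i h2]
  have hcase : (((S.step 1 1)^[p + 1] s).2 = 0 ∧ ((S.step 1 1)^[q + 1] s).2 = 1) ∨
      (((S.step 1 1)^[q + 1] s).2 = 0 ∧ ((S.step 1 1)^[p + 1] s).2 = 1) := by omega
  rw [L.clockwise_iff i hv2 hv1]
  rcases hcase with ⟨c1, c2⟩ | ⟨c1, c2⟩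
  · obtain ⟨k1, k2, k3⟩ := crosses_aux hs c1 c2 h1 h2 h3 h4
    have i4 := L.index_lt_of_phase_lt i (hv3.trans k2) (by rw [hin, hout]; norm_num)
    rw [L.clockwise_iff i (hv3.trans k2) hv3]
    unfold Cyc
    omega
  · obtain ⟨k1, k2, k3⟩ := crosses_aux hs c1 c2 h1.symm h2.symm (fun j hj => (h3 j hj).symm) h4.symm
    have i4 := L.index_lt_of_phase_lt i (hv3.trans k2.symm) (by rw [hin, hout]; norm_num)
    rw [L.clockwise_iff i (hv3.trans k2.symm) hv3]
    unfold Cyc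
    omega

theorem isWeaklySimple_walk [DecidableEq D] (O : Orbits G) (hL : L.Realizable)
    (h0 : S.a.pair O S.b ≠ 0) : (walk hs).IsWeaklySimple G := by
  have h1 := (pair_walk_pos hs O hL h0 one_pos one_pos).1
  rw [← S.ha.sum_push O (isClosedWalk_walk hs).isWalk] at h1
  -- Since the strand has nonzero intersection number with `a`, some arc of it joins `a`; this arc
  -- excludes a repetition.
  obtain ⟨k, -, hk⟩ := Finset.exists_ne_zero_of_sum_ne_zero h1.ne'
  rw [push_a (d := (walk hs).dart k) (valid_iterate hs k).mem] at hk
  have h2 : S.InA (L.lo i (G.rev ((walk hs).dart k))) ∧ ¬ S.InA ((walk hs).dart k) := by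
    by_contra h
    exact hk (if_neg h)
  exact ⟨atMostTwice_walk hs, not_crossesItself_walk hs, not_isRepetition_walk hs h2.2 h2.1⟩

/-! ### The choice of weights and the orbital case. -/

section

variable [DecidableEq D] (O : Orbits G) (S)

/-- The numbers of copies of the two cycles for which a strand is a feedback closed walk. -/
def Weights (p q : ℕ) : Prop :=
  (S.a.pair O S.b = 0 ∧ p = 1 ∧ q = 0) ∨
  (S.a.pair O S.b ≠ 0 ∧ p = 1 ∧ q = 1 ∧ ¬ (0 < S.a.sum (O.crossing i) ∧
    0 < - S.b.sum (O.crossing i) ∧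
    S.a.sum (O.crossing i) + - S.b.sum (O.crossing i) ≤ S.a.pair O S.b)) ∨
  (S.a.pair O S.b ≠ 0 ∧ 0 < p ∧ 0 < q ∧ S.a.sum (O.crossing i) = q ∧
    - S.b.sum (O.crossing i) = p ∧ (p + q : ℚ) ≤ S.a.pair O S.b)

variable {O S}

/-- If `a` had intersection number zero with the `i`th orbit, no orbital cycle could cross it, since
crossings do not cancel. Orbital cycles cover all arcs of `b`, so `a` and `b` would have pairing
zero; likewise with `a` and `b` exchanged. The last bound expands the determinant of the two
classes. -/
theorem orbital_bounds (hO : L.Orbital O) (h0 : S.a.pair O S.b ≠ 0) :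
    0 < S.a.sum (O.crossing i) ∧ 0 < - S.b.sum (O.crossing i) ∧
      S.a.sum (O.crossing i) + - S.b.sum (O.crossing i) ≤ S.a.pair O S.b := by
  have hL := hO.realizable
  obtain ⟨o, ho, hco, -⟩ := hO i _ (S.ha.1 0).1
  have ha0 := S.pair_a_nonneg O ho.1
  have hb0 := S.pair_b_nonpos O ho.1
  rw [O.pair_of_orbitClass hco] at ha0 hb0
  refine ⟨lt_of_le_of_ne ha0 fun h => h0 ?_, lt_of_le_of_ne hb0 fun h => h0 ?_, ?_⟩
  · rw [← S.ha.sum_push O S.hb.isWalk]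
    refine Finset.sum_eq_zero fun k _ => ?_
    obtain ⟨z, hz, hcz, m, hm⟩ := hO i _ (S.hb.1 k).1
    have h1 := O.pair_of_orbitClass hcz S.a
    rw [← h, ← S.ha.sum_push O hz.isWalk] at h1
    rw [← hm]
    by_contra hne
    have hnn (k : ℕ) : 0 ≤ L.push i S.a (z.dart k) := by
      rw [REL.push, S.leftOf_a_of_isArc (hz.1 k).1, sub_zero]
      exact REL.leftOf_nonneg _ _ _ _
    exact (z.sum_pos hnn (lt_of_le_of_ne (hnn m) (Ne.symm hne))).ne' h1
  · rw [ClosedSeq.pair_swap, neg_eq_zero, ← S.hb.sum_push O S.ha.isWalk]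
    refine Finset.sum_eq_zero fun k _ => ?_
    obtain ⟨z, hz, hcz, m, hm⟩ := hO i _ (S.ha.1 k).1
    have h1 := O.pair_of_orbitClass hcz S.b
    rw [neg_eq_zero.1 h.symm, ← S.hb.sum_push O hz.isWalk] at h1
    rw [← hm]
    by_contra hne
    have hnn (k : ℕ) : 0 ≤ -1 * L.push i S.b (z.dart k) := by
      rw [REL.push, S.leftOf_b_of_isArc (hz.1 k).1, zero_sub, neg_mul_neg, one_mul]
      exact REL.leftOf_nonneg _ _ _ _
    refine (z.sum_pos (β := fun d => -1 * L.push i S.b d) hnn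
      (lt_of_le_of_ne (hnn m) (Ne.symm ?_))).ne' ?_
    · simpa using hne
    · rw [ClosedSeq.sum_mul, h1, mul_zero]
  · obtain ⟨j, hij⟩ := REL.exists_ne i
    -- Up to sign, each cycle of colour `i` meets the other orbit at least once, because an orbital
    -- cycle of the other colour touches it. These integers multiply the two positive summands of
    -- the determinant.
    have key {w : ClosedSeq D} (hw : L.IsCycle i w) :
        1 ≤ REL.sign i * w.sum (O.crossing j) := by
      obtain ⟨d, hd, hsd⟩ := REL.exists_left_arc (L := L) w i
      obtain ⟨z, hz, hcz, m, rfl⟩ := hO j d (hd j hij)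
      have h1 := hw.pair_pos_of_mem O hij hz.1 hsd
      rw [O.pair_of_orbitClass hcz] at h1
      obtain ⟨t, ht⟩ := w.sum_int (O.crossing_int j)
      rw [ht] at h1 ⊢
      unfold REL.sign at h1 ⊢
      split_ifs at h1 ⊢
      · rw [one_mul] at h1 ⊢; exact_mod_cast h1
      · have : 0 < -t := by
          have : (0 : ℚ) < ((-t : ℤ) : ℚ) := by push_cast; linarith
          exact_mod_cast this
        have : (1 : ℚ) ≤ ((-t : ℤ) : ℚ) := by exact_mod_cast this
        push_cast at this; linarith
    have h1 := key S.ha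
    have h2 := key S.hb
    have hi : (i = 0 ∧ j = 1) ∨ (i = 1 ∧ j = 0) := by omega
    rcases hi with ⟨rfl, rfl⟩ | ⟨rfl, rfl⟩
    · simp only [REL.sign, if_true, one_mul] at h1 h2
      unfold ClosedSeq.pair
      nlinarith
    · simp only [REL.sign, one_ne_zero, if_false] at h1 h2
      unfold ClosedSeq.pair
      nlinarith

/-- With zero pairing, all classes are parallel and one copy of `a` suffices. With the weights given
by crossings with the orbit, `p[a] + q[b]` is `S.a.pair O S.b` times the orbit class, so a large
enough pairing makes the strand simple. The case `p = q = 1` is left for labelings that violate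
`orbital_bounds`. -/
theorem feedback_of_weights {p q : ℕ} (h : S.Weights O p q) {s : D × ℕ}
    (hs : S.Valid p q s) (hL : L.Realizable) :
    L.IsFeedback O i (walk hs) ∧ (walk hs).len ≤ 2 * Fintype.card D ∧
      (L.Orbital O → (walk hs).IsSimple G ∧ O.homotopyClass (walk hs) = Orbits.orbitClass i) := by
  have hw := isClosedWalk_walk hs
  rcases h with ⟨h0, rfl, rfl⟩ | ⟨h0, rfl, rfl, hno⟩ | ⟨h0, hp, hq, hx, hy, hle⟩
  · obtain ⟨x, hx⟩ := S.a.sum_int (O.crossing_int 0)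
    obtain ⟨y, hy⟩ := S.a.sum_int (O.crossing_int 1)
    have hsimple : (walk hs).IsSimple G :=
      isSimple_walk hs O (m := 1) (x := x) (y := y) (by norm_num) (by simp [hx]) (by simp [hy])
    have hC : L.IsCycle i (walk hs) := ⟨hw, hsimple⟩
    have ha := S.ha.sum_ne_zero O hL
    have hpar {z : ClosedSeq D} (hz : S.a.pair O z = 0) : ∃ r : ℚ,
        z.sum (O.crossing 0) = r * S.a.sum (O.crossing 0) ∧
        z.sum (O.crossing 1) = r * S.a.sum (O.crossing 1) := by
      unfold ClosedSeq.pair at hz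
      by_cases hx0 : S.a.sum (O.crossing 0) = 0
      · have hy0 : S.a.sum (O.crossing 1) ≠ 0 := fun h => ha ⟨hx0, h⟩
        rw [hx0, zero_mul, zero_sub, neg_eq_zero] at hz
        have := (mul_eq_zero.1 hz).resolve_left hy0
        exact ⟨z.sum (O.crossing 1) / S.a.sum (O.crossing 1), by rw [this, hx0, mul_zero],
          by field_simp⟩
      · refine ⟨z.sum (O.crossing 0) / S.a.sum (O.crossing 0), by field_simp, ?_⟩
        field_simp
        linear_combination hz
    obtain ⟨r, hr0, hr1⟩ := hpar h0
    have hr := S.ha.not_opposite O hL S.hb hr0 hr1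
    -- The cone lies weakly on one side of `a` and on the other side of `b`; if these are parallel
    -- and of the same direction, it is a single ray.
    have haz {z : ClosedSeq D} (hz : L.IsClosedWalk i z) : S.a.pair O z = 0 := by
      have h1 := S.pair_a_nonneg O hz
      have h2 := S.pair_b_nonpos O hz
      have h3 : S.b.pair O z = r * S.a.pair O z := by
        simp only [ClosedSeq.pair, hr0, hr1]; ring
      rw [h3] at h2
      nlinarith
    obtain ⟨u, hu0, hu1⟩ := hpar (haz hw)
    have hcz {z : ClosedSeq D} (hz : L.IsClosedWalk i z) : (walk hs).pair O z = 0 := by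
      have : (walk hs).pair O z = u * S.a.pair O z := by
        simp only [ClosedSeq.pair, hu0, hu1]; ring
      rw [this, haz hz, mul_zero]
    refine ⟨⟨hw, hsimple.isWeaklySimple, O.homotopyClass_ne_zero (hC.sum_ne_zero O hL),
      fun c hc => REL.exists_common_arc O hL hw (hC.sum_ne_zero O hL)
        (Or.inl fun z hz => hcz hz.1) hc⟩, ?_, fun hO => ⟨hsimple, ?_⟩⟩
    · have := len_le_of_isSimple hsimple; omega
    · obtain ⟨o, ho, hco, -⟩ := hO i _ (S.ha.1 0).1
      refine hC.class_eq_of_orbital hO ?_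
      rw [← O.pair_of_orbitClass hco]
      exact hcz ho.1
  · exact ⟨isFeedback_walk hs O hL h0 one_pos one_pos (isWeaklySimple_walk hs O hL h0),
      walk_len_le hs, fun hO => absurd (orbital_bounds hO h0) hno⟩
  · have hsimple : (walk hs).IsSimple G := by
      -- Here `m` is the determinant of `[a]` and `[b]`, and `(x, y)` are the crossing numbers of
      -- the orbit class: `(0, 1)` for the meridian, `(-1, 0)` for the horizon.
      have hsum : ∃ m x y : ℤ, (S.a.pair O S.b = m) ∧
          p * S.a.sum (O.crossing 0) + q * S.b.sum (O.crossing 0) = m * x ∧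
          p * S.a.sum (O.crossing 1) + q * S.b.sum (O.crossing 1) = m * y := by
        obtain ⟨a0, ha0⟩ := S.a.sum_int (O.crossing_int 0)
        obtain ⟨a1, ha1⟩ := S.a.sum_int (O.crossing_int 1)
        obtain ⟨b0, hb0⟩ := S.b.sum_int (O.crossing_int 0)
        obtain ⟨b1, hb1⟩ := S.b.sum_int (O.crossing_int 1)
        have hi : i = 0 ∨ i = 1 := by omega
        rcases hi with rfl | rfl
        · refine ⟨a0 * b1 - a1 * b0, 0, 1, ?_, ?_, ?_⟩
          · simp [ClosedSeq.pair, ha0, ha1, hb0, hb1]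
          · rw [← hx, ← hy]; push_cast; ring
          · rw [← hx, ← hy, ha0, ha1, hb0, hb1]; push_cast; ring
        · refine ⟨a0 * b1 - a1 * b0, -1, 0, ?_, ?_, ?_⟩
          · simp [ClosedSeq.pair, ha0, ha1, hb0, hb1]
          · rw [← hx, ← hy, ha0, ha1, hb0, hb1]; push_cast; ring
          · rw [← hx, ← hy]; push_cast; ring
      obtain ⟨m, x, y, hm, h1, h2⟩ := hsum
      refine isSimple_walk hs O (m := m) ?_ h1 h2
      rw [hm] at hle
      exact_mod_cast hle
    have hC : L.IsCycle i (walk hs) := ⟨hw, hsimple⟩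
    refine ⟨isFeedback_walk hs O hL h0 hp hq hsimple.isWeaklySimple, ?_, fun hO => ⟨hsimple, ?_⟩⟩
    · have := len_le_of_isSimple hsimple; omega
    · refine hC.class_eq_of_orbital hO ?_
      have h3 := sum_weighted hs O
      refine (mul_eq_zero.1 (?_ : S.a.pair O S.b * _ = 0)).resolve_left h0
      rw [← hx, ← hy] at h3
      unfold ClosedSeq.pair at h3 ⊢
      have hi : i = 0 ∨ i = 1 := by omega
      rcases hi with rfl | rfl
      · linear_combination -h3
      · linear_combination -h3

end

end Strands

/-! ### Program logic for the random access machine, with running times. -/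

/-- The program halts in a state and after a number of steps with the given property. -/
def wp (W : ℕ) (P : Program) (Q : State → ℕ → Prop) (s : State) : Prop :=
  ∃ s' t, Exec W P s s' t ∧ Q s' t

section

variable {W : ℕ} {Q : State → ℕ → Prop} {s : State}

theorem wp_mono {P : Program} {Q' : State → ℕ → Prop} (h : wp W P Q s)
    (hQ : ∀ s' t, Q s' t → Q' s' t) : wp W P Q' s :=
  let ⟨s', t, h1, h2⟩ := h
  ⟨s', t, h1, hQ _ _ h2⟩

@[simp] theorem wp_skip : wp W .skip Q s ↔ Q s 1 :=
  ⟨fun ⟨_, _, h, hQ⟩ => by cases h; exact hQ, fun h => ⟨_, _, .skip s, h⟩⟩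

@[simp] theorem wp_const {x n : ℕ} : wp W (.const x n) Q s ↔ n ≤ W ∧ Q (s.setReg x n) 1 :=
  ⟨fun ⟨_, _, h, hQ⟩ => by cases h with | const _ _ _ hn => exact ⟨hn, hQ⟩,
    fun h => ⟨_, _, .const s x n h.1, h.2⟩⟩

@[simp] theorem wp_move {x y : ℕ} : wp W (.move x y) Q s ↔ Q (s.setReg x (s.reg y)) 1 :=
  ⟨fun ⟨_, _, h, hQ⟩ => by cases h; exact hQ, fun h => ⟨_, _, .move s x y, h⟩⟩

@[simp] theorem wp_add {x y z : ℕ} : wp W (.add x y z) Q s ↔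
    s.reg y + s.reg z ≤ W ∧ Q (s.setReg x (s.reg y + s.reg z)) 1 :=
  ⟨fun ⟨_, _, h, hQ⟩ => by cases h with | add _ _ _ _ hn => exact ⟨hn, hQ⟩,
    fun h => ⟨_, _, .add s x y z h.1, h.2⟩⟩

@[simp] theorem wp_sub {x y z : ℕ} : wp W (.sub x y z) Q s ↔ Q (s.setReg x (s.reg y - s.reg z)) 1 :=
  ⟨fun ⟨_, _, h, hQ⟩ => by cases h; exact hQ, fun h => ⟨_, _, .sub s x y z, h⟩⟩

@[simp] theorem wp_load {x a y : ℕ} : wp W (.load x a y) Q s ↔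
    Q (s.setReg x (s.mem a (s.reg y))) 1 :=
  ⟨fun ⟨_, _, h, hQ⟩ => by cases h; exact hQ, fun h => ⟨_, _, .load s x a y, h⟩⟩

@[simp] theorem wp_store {x a y : ℕ} : wp W (.store a x y) Q s ↔
    Q (s.setMem a (s.reg x) (s.reg y)) 1 :=
  ⟨fun ⟨_, _, h, hQ⟩ => by cases h; exact hQ, fun h => ⟨_, _, .store s a x y, h⟩⟩

@[simp] theorem wp_seq {P P' : Program} : wp W (.seq P P') Q s ↔
    wp W P (fun s' t => wp W P' (fun s'' t' => Q s'' (t + t')) s') s :=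
  ⟨fun ⟨_, _, h, hQ⟩ => by cases h with | seq h1 h2 => exact ⟨_, _, h1, _, _, h2, hQ⟩,
    fun ⟨_, _, h1, _, _, h2, hQ⟩ => ⟨_, _, .seq h1 h2, hQ⟩⟩

@[simp] theorem wp_ite {b : Test} {P P' : Program} : wp W (.ite b P P') Q s ↔
    (b.Holds s → wp W P (fun s' t => Q s' (t + 1)) s) ∧
      (¬ b.Holds s → wp W P' (fun s' t => Q s' (t + 1)) s) := by
  constructor
  · rintro ⟨_, _, h, hQ⟩
    cases h with
    | ite_true hb h => exact ⟨fun _ => ⟨_, _, h, hQ⟩, fun hb' => absurd hb hb'⟩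
    | ite_false hb h => exact ⟨fun hb' => absurd hb' hb, fun _ => ⟨_, _, h, hQ⟩⟩
  · rintro ⟨h1, h2⟩
    by_cases hb : b.Holds s
    · obtain ⟨_, _, h, hQ⟩ := h1 hb
      exact ⟨_, _, .ite_true hb h, hQ⟩
    · obtain ⟨_, _, h, hQ⟩ := h2 hb
      exact ⟨_, _, .ite_false hb h, hQ⟩

/-- A loop that is run `T` times. -/
theorem wp_loop {b : Test} {P : Program} (Inv : ℕ → State → Prop) (c : ℕ → ℕ) (T : ℕ)
    (hb : ∀ j s, Inv j s → (b.Holds s ↔ j < T))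
    (hP : ∀ j < T, ∀ s, Inv j s → wp W P (fun s' t => t ≤ c j ∧ Inv (j + 1) s') s)
    (h0 : Inv 0 s) :
    wp W (.while b P) (fun s' t => t ≤ ∑ j ∈ Finset.range T, (c j + 1) + 1 ∧ Inv T s') s := by
  suffices ∀ m j s, j + m = T → Inv j s → wp W (.while b P)
      (fun s' t => t ≤ ∑ k ∈ Finset.range m, (c (j + k) + 1) + 1 ∧ Inv T s') s by
    simpa using this T 0 s (by omega) h0
  intro m
  induction m with
  | zero =>
    intro j s hj hInv
    refine ⟨s, 1, .while_false fun h => ?_, by simp, by rwa [← hj]⟩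
    have := (hb j s hInv).1 h
    omega
  | succ m ih =>
    intro j s hj hInv
    obtain ⟨s', t, h1, h2, h3⟩ := hP j (by omega) s hInv
    obtain ⟨s'', t', h4, h5, h6⟩ := ih (j + 1) s' (by omega) h3
    refine ⟨s'', _, .while_true ((hb j s hInv).2 (by omega)) h1 h4, ?_, h6⟩
    rw [Finset.sum_range_succ']
    simp only [add_assoc, add_comm 1, add_zero] at h5 ⊢
    omega

/-- A loop that is run `T` times, in steps of bounded cost. -/
theorem wp_loop_const {b : Test} {P : Program} (Inv : ℕ → State → Prop) (c T : ℕ)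
    (hb : ∀ j s, Inv j s → (b.Holds s ↔ j < T))
    (hP : ∀ j < T, ∀ s, Inv j s → wp W P (fun s' t => t ≤ c ∧ Inv (j + 1) s') s)
    (h0 : Inv 0 s) :
    wp W (.while b P) (fun s' t => t ≤ (c + 1) * T + 1 ∧ Inv T s') s :=
  wp_mono (wp_loop Inv (fun _ => c) T hb hP h0) fun s' t h => by
    rwa [Finset.sum_const, Finset.card_range, smul_eq_mul, mul_comm] at h

theorem wp_seq_le {P P' : Program} {A B : ℕ} {R K : State → Prop}
    (h1 : wp W P (fun s' t => t ≤ A ∧ R s') s)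
    (h2 : ∀ s', R s' → wp W P' (fun s'' t => t ≤ B ∧ K s'') s') :
    wp W (.seq P P') (fun s' t => t ≤ A + B ∧ K s') s :=
  wp_seq.2 (wp_mono h1 fun s' _ h => wp_mono (h2 s' h.2) fun _ _ h' =>
    ⟨add_le_add h.1 h'.1, h'.2⟩)

/-- Programs that are run one after the other. -/
def Program.block : List Program → Program
  | [] => .skip
  | P :: l => .seq P (block l)

@[simp] theorem wp_block_nil : wp W (.block []) Q s ↔ Q s 1 := wp_skip

@[simp] theorem wp_block_cons {P : Program} {l : List Program} : wp W (.block (P :: l)) Q s ↔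
    wp W P (fun s' t => wp W (.block l) (fun s'' t' => Q s'' (t + t')) s') s := wp_seq

attribute [simp] Test.Holds

namespace State

@[simp] theorem setReg_reg (s : State) (x n y : ℕ) :
    (s.setReg x n).reg y = if y = x then n else s.reg y := Function.update_apply ..

@[simp] theorem setReg_mem (s : State) (x n : ℕ) : (s.setReg x n).mem = s.mem := rfl

@[simp] theorem setMem_reg (s : State) (a k n : ℕ) : (s.setMem a k n).reg = s.reg := rfl

@[simp] theorem setMem_mem (s : State) (a k n b : ℕ) :
    (s.setMem a k n).mem b = if b = a then Function.update (s.mem a) k n else s.mem b :=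
  Function.update_apply ..

end State

end

/-! ### Programs for crossing counts and leftmost arcs. -/

section

variable {n : ℕ} {G : TorusTriangulation (Fin n)}

/-- The rotation system and the labeling are stored as in the input. -/
structure Ready (L : REL G) (i : Fin 2) (s : State) : Prop where
  size : s.reg 0 = n
  one : s.reg 3 = 1
  zero : s.reg 4 = 0
  color : s.reg 5 = (i : ℕ)
  mem_rot : ∀ d : Fin n, s.mem 0 d = G.rot d
  mem_rev : ∀ d : Fin n, s.mem 1 d = G.rev d
  mem_color : ∀ d : Fin n, s.mem 2 d = L.color d
  mem_out : ∀ d : Fin n, s.mem 3 d = if L.out d then 1 else 0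

theorem Ready.congr {L : REL G} {i : Fin 2} {s s' : State} (h : Ready L i s)
    (hr : ∀ x < 6, s'.reg x = s.reg x) (hm : ∀ a < 6, s'.mem a = s.mem a) : Ready L i s' where
  size := (hr 0 (by norm_num)).trans h.size
  one := (hr 3 (by norm_num)).trans h.one
  zero := (hr 4 (by norm_num)).trans h.zero
  color := (hr 5 (by norm_num)).trans h.color
  mem_rot := by rw [hm 0 (by norm_num)]; exact h.mem_rot
  mem_rev := by rw [hm 1 (by norm_num)]; exact h.mem_rev
  mem_color := by rw [hm 2 (by norm_num)]; exact h.mem_color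
  mem_out := by rw [hm 3 (by norm_num)]; exact h.mem_out

@[simp] theorem ready_setReg {L : REL G} {i : Fin 2} {s : State} {x v : ℕ} (hx : 6 ≤ x) :
    Ready L i (s.setReg x v) ↔ Ready L i s := by
  have hr (y : ℕ) (hy : y < 6) : (s.setReg x v).reg y = s.reg y := by
    rw [State.setReg_reg, if_neg (by omega)]
  exact ⟨fun h => h.congr (fun y hy => (hr y hy).symm) fun _ _ => rfl,
    fun h => h.congr hr fun _ _ => rfl⟩

@[simp] theorem ready_setMem {L : REL G} {i : Fin 2} {s : State} {a k v : ℕ} (ha : 6 ≤ a) :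
    Ready L i (s.setMem a k v) ↔ Ready L i s := by
  have hm (b : ℕ) (hb : b < 6) : (s.setMem a k v).mem b = s.mem b := by
    rw [State.setMem_mem, if_neg (by omega)]
  exact ⟨fun h => h.congr (fun _ _ => rfl) fun b hb => (hm b hb).symm,
    fun h => h.congr (fun _ _ => rfl) hm⟩

theorem arrayOf_apply (f : Fin n → ℕ) (d : Fin n) : arrayOf f d = f d := dif_pos d.2

theorem mem_update {m : ℕ → ℕ} (x : Fin n) (v : ℕ) (d : Fin n) :
    Function.update m x v d = if d = x then v else m d := by
  simp only [Function.update_apply, Fin.ext_iff]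

theorem le_inputSize (O : Orbits G) (i : Fin 2) : n + O.len i ≤ inputSize O := by
  unfold inputSize
  have hi : i = 0 ∨ i = 1 := by omega
  rcases hi with rfl | rfl <;> omega

/-- Counts how often the `i`th orbit crosses each dart. -/
def countProgram (i : Fin 2) : Program :=
  -- Register `3` keeps the constant 1; register `4` is never written and keeps 0. Register `1 + i`
  -- and array `4 + i` hold the length and the crossed darts of the `i`th orbit.
  .block [.const 3 1, .const 5 i, .while (.lt 6 (1 + i))
    (.block [.load 7 (4 + i) 6, .load 8 11 7, .add 8 8 3, .store 11 7 8, .add 6 6 3])]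

theorem countProgram_spec {W : ℕ} (O : Orbits G) (L : REL G) (i : Fin 2) (hW : inputSize O ≤ W) :
    wp W (countProgram i) (fun s t => t ≤ 10 * inputSize O + 10 ∧ Ready L i s ∧
      (∀ a ≠ 11, 6 ≤ a → ∀ k, s.mem a k = 0) ∧ ∀ d : Fin n, s.mem 11 d = O.count i d)
      (inputState O L) := by
  have hn := le_inputSize O i
  have hlen := O.len_pos i
  have hi : (i : ℕ) ≤ 1 := by omega
  have h4 (a : ℕ) (ha : 6 ≤ a) : a ≠ 4 + (i : ℕ) := by omega
  let Inv (k : ℕ) (s : State) : Prop := Ready L i s ∧ s.reg 6 = k ∧ s.reg (1 + i) = O.len i ∧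
    (∀ k < O.len i, s.mem (4 + i) k = O.dart i k) ∧
    (∀ a ≠ 11, 6 ≤ a → ∀ k, s.mem a k = 0) ∧
    ∀ d : Fin n, s.mem 11 d = ((Finset.range k).filter (fun m => O.dart i m = d)).card
  have hcard (k : ℕ) (d : Fin n) :
      ((Finset.range k).filter (fun m => O.dart i m = d)).card ≤ k :=
    (Finset.card_filter_le _ _).trans (Finset.card_range k).le
  have hloop := fun s (h0 : Inv 0 s) => wp_loop_const (W := W) (b := .lt 6 (1 + i))
    (P := .block [.load 7 (4 + i) 6, .load 8 11 7, .add 8 8 3, .store 11 7 8, .add 6 6 3])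
    Inv 6 (O.len i) (s := s) ?_ ?_ h0
  · unfold countProgram
    simp only [wp_block_cons, wp_block_nil, wp_const]
    refine ⟨by omega, by omega, wp_mono (hloop _ ?_) ?_⟩
    · refine ⟨?_, ?_, ?_, ?_, ?_, ?_⟩
      · constructor <;> simp [inputState, arrayOf_apply]
      · simp [inputState]
      · have hi : i = 0 ∨ i = 1 := by omega
        rcases hi with rfl | rfl <;> simp [inputState]
      · intro k hk
        have hi : i = 0 ∨ i = 1 := by omega
        rcases hi with rfl | rfl
        · exact dif_pos hk
        · exact dif_pos hk
      · intro a _ ha k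
        obtain ⟨a, rfl⟩ := Nat.exists_eq_add_of_le' ha
        rfl
      · intro d
        simp [inputState]
    · rintro s' t ⟨ht, h1, -, -, -, h5, h6⟩
      exact ⟨by omega, h1, h5, h6⟩
  · rintro j s ⟨-, h2, h3, -⟩
    simp [h2, h3]
  · rintro j hj s ⟨h1, h2, h3, h4', h5, h6⟩
    have e1 : s.mem (4 + i) j = O.dart i j := h4' j hj
    have hc := hcard j (O.dart i j)
    simp [h2, e1, h6, h1.one]
    refine ⟨by omega, by omega, by simp [h1], by simp, ?_, fun k hk => ?_, fun a ha ha' k => ?_,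
      fun d => ?_⟩
    · simp [show 1 + (i : ℕ) ≠ 6 by omega, show 1 + (i : ℕ) ≠ 7 by omega,
        show 1 + (i : ℕ) ≠ 8 by omega, h3]
    · simp [(h4 11 (by norm_num)).symm, h4' k hk]
    · simp [ha, h5 a ha ha' k]
    · simp only [State.setReg_mem, State.setMem_mem, if_true]
      rw [mem_update, Finset.range_add_one, Finset.filter_insert]
      split_ifs with hd hd' hd'
      · rw [Finset.card_insert_of_notMem (by simp), hd]
      · exact absurd hd.symm hd'
      · exact absurd hd'.symm hd
      · exact h6 d

end

/-- Writes the number in register `16` to the entries of array `a` for all darts with the same tail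
as the dart in register `6`. -/
def scanProgram (a : ℕ) : Program :=
  .block [.move 17 6, .const 18 1, .while (.eq 18 3)
    (.block [.store a 17 16, .load 17 0 17, .ite (.eq 17 6) (.const 18 0) .skip])]

/-- Fills array `a` with data of the vertices. The subprogram decides whether the current dart
determines these data for its tail, and computes them. -/
def tableProgram (a : ℕ) (P : Program) : Program :=
  .block [.const 6 0, .while (.lt 6 0)
    (.block [P, .ite (.lt 12 13) (scanProgram a) .skip, .add 6 6 3])]

/-- The stopping test of the loops that follow a cycle until it closes. -/
theorem iterate_succ_eq_self_iff {X : Type*} {f : X → X} {x : X} {j : ℕ}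
    (hj : j < Function.minimalPeriod f x) :
    f^[j + 1] x = x ↔ ¬ j + 1 < Function.minimalPeriod f x := by
  constructor
  · intro h h'
    exact absurd (Function.IsPeriodicPt.minimalPeriod_dvd h)
      fun h => absurd (Nat.le_of_dvd (by omega) h) (by omega)
  · intro h
    rw [show j + 1 = Function.minimalPeriod f x by omega, Function.iterate_minimalPeriod]

section

variable {n W : ℕ} {G : TorusTriangulation (Fin n)} {L : REL G} {i : Fin 2}

theorem scanProgram_spec (hW : 1 ≤ W) {a : ℕ} (ha : 6 ≤ a) {e v : Fin n} {s : State}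
    (hs : Ready L i s) (h6 : s.reg 6 = e) (h16 : s.reg 16 = v) :
    wp W (scanProgram a) (fun s' t => t ≤ 8 * Function.minimalPeriod G.rot e + 5 ∧ Ready L i s' ∧
      s'.reg 6 = e ∧ (∀ b ≠ a, s'.mem b = s.mem b) ∧ ∀ d : Fin n, s'.mem a d =
        if ∃ m < Function.minimalPeriod G.rot e, G.rot^[m] e = d then (v : ℕ)
        else s.mem a d) s := by
  classical
  set T := Function.minimalPeriod G.rot e
  have hT : 0 < T := Function.minimalPeriod_pos_of_mem_periodicPts (REL.mem_periodicPts (G := G) e)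
  let Inv (j : ℕ) (s' : State) : Prop := Ready L i s' ∧ s'.reg 6 = e ∧ s'.reg 16 = v ∧
    s'.reg 17 = (G.rot^[j] e : Fin n) ∧ s'.reg 18 = (if j < T then 1 else 0) ∧
    (∀ b ≠ a, s'.mem b = s.mem b) ∧ ∀ d : Fin n, s'.mem a d =
        if ∃ m < j, G.rot^[m] e = d then (v : ℕ) else s.mem a d
  have hloop := fun s (h0 : Inv 0 s) => wp_loop_const (W := W) (b := .eq 18 3)
    (P := .block [.store a 17 16, .load 17 0 17, .ite (.eq 17 6) (.const 18 0) .skip])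
    Inv 7 T (s := s) ?_ ?_ h0
  · simp only [scanProgram, wp_block_cons, wp_block_nil, wp_const, wp_move]
    refine ⟨hW, wp_mono (hloop _ ?_) ?_⟩
    · simp [Inv, hs, h6, h16, hT]
    · rintro s' t ⟨ht, h1, h2, -, -, -, h3, h4⟩
      exact ⟨by omega, h1, h2, h3, h4⟩
  · rintro j s ⟨h1, -, -, -, h2, -⟩
    simp only [Test.Holds, h1.one, h2]
    split_ifs with h <;> simp [h]
  · rintro j hj s' ⟨h1, h2, h3, h4, h5, h7, h8⟩
    rw [if_pos hj] at h5
    have h0 : (s'.setMem a (G.rot^[j] e : Fin n) v).mem 0 (G.rot^[j] e : Fin n) =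
        (G.rot^[j + 1] e : Fin n) := by
      rw [Function.iterate_succ_apply', ← h1.mem_rot, State.setMem_mem, if_neg (by omega)]
    have key (s'' : State) (hr : Ready L i s'') (hm : s''.mem =
        (s'.setMem a (G.rot^[j] e : Fin n) v).mem) (k2 : s''.reg 6 = e) (k3 : s''.reg 16 = v)
        (k4 : s''.reg 17 = (G.rot^[j + 1] e : Fin n))
        (k5 : s''.reg 18 = if j + 1 < T then 1 else 0) : Inv (j + 1) s'' := by
      refine ⟨hr, k2, k3, k4, k5, fun b hb => ?_, fun d => ?_⟩
      · rw [hm, State.setMem_mem, if_neg hb, h7 b hb]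
      · rw [hm, State.setMem_mem, if_pos rfl, mem_update, h8]
        simp only [Nat.lt_succ_iff_lt_or_eq, or_and_right, exists_or, exists_eq_left]
        by_cases hd : G.rot^[j] e = d
        · rw [if_pos hd.symm, if_pos (Or.inr hd)]
        · rw [if_neg (Ne.symm hd)]
          simp only [hd, or_false]
    have hend : G.rot^[j + 1] e = e ↔ ¬ j + 1 < T := iterate_succ_eq_self_iff hj
    simp only [wp_block_cons, wp_block_nil, wp_store, wp_load, wp_ite, wp_const, wp_skip, h4, h3,
      State.setMem_reg, h0]
    refine ⟨fun hb => ⟨by omega, by norm_num, ?_⟩, fun hb => ⟨by norm_num, ?_⟩⟩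
    · simp only [Test.Holds, State.setReg_reg, State.setMem_reg, Nat.reduceEqDiff, if_true,
        if_false,
        h2, Fin.val_inj, hend] at hb
      refine key _ ?_ ?_ ?_ ?_ ?_ ?_ <;> simp [ha, h1, h2, h3, hb]
    · simp only [Test.Holds, State.setReg_reg, State.setMem_reg, Nat.reduceEqDiff, if_true,
        if_false,
        h2, Fin.val_inj, hend, not_not] at hb
      refine key _ ?_ ?_ ?_ ?_ ?_ ?_ <;> simp [ha, h1, h2, h3, hb, h5]

/-- Here `τ` maps each dart to the only dart at its tail that triggers a scan. Thus each vertex is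
scanned once, and the nested loops have total cost linear in the sum of the degrees, which is `n`.
-/
theorem tableProgram_spec {a : ℕ} (ha : 6 ≤ a) {P : Program} {trig : Fin n → Prop}
    {val F τ : Fin n → Fin n} (hW : n + 1 ≤ W)
    (hP : ∀ s (e : Fin n), Ready L i s → s.reg 6 = e → wp W P (fun s' t => t ≤ 20 ∧ Ready L i s' ∧
      s'.reg 6 = e ∧ s'.mem = s.mem ∧ (s'.reg 12 < s'.reg 13 ↔ trig e) ∧
      s'.reg 16 = val e) s)
    (h1 : ∀ e, trig e → ∀ m, τ (G.rot^[m] e) = e ∧ F (G.rot^[m] e) = val e)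
    (h2 : ∀ d, trig (τ d) ∧ G.SameVertex (τ d) d) {s : State} (hs : Ready L i s) :
    wp W (tableProgram a P) (fun s' t => t ≤ 40 * n + 10 ∧ Ready L i s' ∧
      (∀ b ≠ a, s'.mem b = s.mem b) ∧ ∀ d : Fin n, s'.mem a d = F d) s := by
  classical
  let Inv (k : ℕ) (s' : State) : Prop := Ready L i s' ∧ s'.reg 6 = k ∧
    (∀ b ≠ a, s'.mem b = s.mem b) ∧ ∀ d : Fin n, (τ d : ℕ) < k → s'.mem a d = F d
  let cost (k : ℕ) : ℕ := 30 + 8 * if h : k < n then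
    (if trig ⟨k, h⟩ then Function.minimalPeriod G.rot ⟨k, h⟩ else 0) else 0
  have hcost : ∑ k ∈ Finset.range n, (cost k + 1) + 1 ≤ 40 * n + 1 := by
    have e1 : ∑ k ∈ Finset.range n, (cost k + 1) = 31 * n +
        8 * ∑ e : Fin n, if trig e then Function.minimalPeriod G.rot e else 0 := by
      rw [← Fin.sum_univ_eq_sum_range (fun k => cost k + 1), Finset.mul_sum, mul_comm,
        show n * 31 = ∑ _e : Fin n, 31 by simp, ← Finset.sum_add_distrib]
      refine Finset.sum_congr rfl fun e _ => ?_
      simp only [cost, e.2, dif_pos, Fin.eta]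
      omega
    -- The rotation orbits of triggering darts inject into disjoint fibres of `τ`.
    have e2 : ∑ e : Fin n, (if trig e then Function.minimalPeriod G.rot e else 0) ≤ n := by
      conv_rhs => rw [← Fintype.card_fin n, ← Finset.card_univ,
        Finset.card_eq_sum_card_fiberwise (f := τ) (t := Finset.univ)
          (fun _ _ => Finset.mem_univ _)]
      refine Finset.sum_le_sum fun e _ => ?_
      split_ifs with h
      · rw [← Finset.card_range (Function.minimalPeriod G.rot e)]
        refine Finset.card_le_card_of_injOn (fun m => G.rot^[m] e) (fun m _ => ?_) ?_
        · simp [(h1 e h m).1]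
        · intro k hk l hl h
          simp only [Finset.coe_range, Set.mem_Iio] at hk hl
          exact Function.iterate_injOn_Iio_minimalPeriod hk hl h
      · exact Nat.zero_le _
    omega
  have hloop := fun s (h0 : Inv 0 s) => wp_loop (W := W) (b := .lt 6 0)
    (P := .block [P, .ite (.lt 12 13) (scanProgram a) .skip, .add 6 6 3])
    Inv cost n (s := s) ?_ ?_ h0
  · simp only [tableProgram, wp_block_cons, wp_block_nil, wp_const]
    refine ⟨Nat.zero_le _, wp_mono (hloop _ ?_) ?_⟩
    · simp [Inv, hs]
    · rintro s' t ⟨ht, k1, -, k2, k3⟩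
      exact ⟨by omega, k1, k2, fun d => k3 d (τ d).2⟩
  · rintro j s ⟨k1, k2, -⟩
    simp [k1.size, k2]
  · rintro k hk s' ⟨k1, k2, k3, k4⟩
    simp only [wp_block_cons, wp_block_nil, wp_ite, wp_add, wp_skip]
    refine wp_mono (hP s' ⟨k, hk⟩ k1 k2) ?_
    rintro s₁ t ⟨ht, l1, l2, l3, l4, l5⟩
    refine ⟨fun hb => ?_, fun hb => ?_⟩
    · have htr := l4.1 hb
      refine wp_mono (scanProgram_spec (by omega) ha l1 l2 l5) ?_
      rintro s₂ t₂ ⟨ht₂, m1, m2, m3, m4⟩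
      rw [m2, m1.one]
      refine ⟨by simp only; omega, ?_, by simp [m1], by simp, fun b hb => ?_, fun d hd => ?_⟩
      · simp only [cost, hk, dif_pos, if_pos htr]; omega
      · rw [State.setReg_mem, m3 b hb, l3, k3 b hb]
      · rw [State.setReg_mem, m4]
        split_ifs with hm
        · obtain ⟨m, -, rfl⟩ := hm
          rw [(h1 _ htr m).2]
        · rw [l3]
          refine k4 d (lt_of_le_of_ne (by omega) fun hd' => hm ?_)
          have hv := (h2 d).2
          rw [show τ d = ⟨k, hk⟩ from Fin.ext hd'] at hv
          obtain ⟨m, -, hm⟩ := hv.exists_pow_eq'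
          refine ⟨m % Function.minimalPeriod G.rot ⟨k, hk⟩, Nat.mod_lt _
            (Function.minimalPeriod_pos_of_mem_periodicPts (REL.mem_periodicPts (G := G) _)), ?_⟩
          rw [Function.iterate_mod_minimalPeriod_eq, ← Equiv.Perm.coe_pow]
          exact hm
    · rw [l2, l1.one]
      refine ⟨by simp only; omega, ?_, by simp [l1], by simp, fun b hb => ?_, fun d hd => ?_⟩
      · simp only [cost]; omega
      · rw [State.setReg_mem, l3, k3 b hb]
      · rw [State.setReg_mem, l3]
        refine k4 d (lt_of_le_of_ne (by omega) fun hd' => hb (l4.2 ?_))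
        have := (h2 d).1
        rwa [show τ d = ⟨k, hk⟩ from Fin.ext hd'] at this

end

/-- Decides whether the next dart in clockwise order is the leftmost outgoing edge of its tail. -/
def loTest : Program :=
  .block [.load 7 0 6, .load 8 2 6, .load 9 3 6, .load 10 2 7, .load 11 3 7,
    .ite (.eq 8 5) (.move 12 9) (.const 12 0), .ite (.eq 10 5) (.move 13 11) (.const 13 0),
    .move 16 7]

/-- Decides whether the reversed dart is the leftmost incoming edge of its head. -/
def liTest : Program :=
  .block [.load 7 0 6, .load 8 2 6, .load 9 3 6, .load 10 2 7, .load 11 3 7,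
    .ite (.eq 8 5) (.sub 13 3 9) (.const 13 0), .ite (.eq 10 5) (.sub 12 3 11) (.const 12 0),
    .load 16 1 6]

section

variable {n W : ℕ} {G : TorusTriangulation (Fin n)} {L : REL G} {i : Fin 2}

theorem loTest_spec {s : State} {e : Fin n} (hs : Ready L i s) (h6 : s.reg 6 = e) :
    wp W loTest (fun s' t => t ≤ 20 ∧ Ready L i s' ∧ s'.reg 6 = e ∧ s'.mem = s.mem ∧
      (s'.reg 12 < s'.reg 13 ↔ ¬ L.IsArc i e ∧ L.IsArc i (G.rot e)) ∧ s'.reg 16 = G.rot e) s := by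
  simp [loTest, h6, hs, hs.mem_rot, hs.mem_color, hs.mem_out, hs.color, Fin.val_inj,
    REL.IsArc]
  by_cases h1 : L.color e = i <;> by_cases h2 : L.color (G.rot e) = i <;>
  cases h3 : L.out e <;> cases h4 : L.out (G.rot e) <;> simp [h1, h2]

theorem liTest_spec {s : State} {e : Fin n} (hs : Ready L i s) (h6 : s.reg 6 = e) :
    wp W liTest (fun s' t => t ≤ 20 ∧ Ready L i s' ∧ s'.reg 6 = e ∧ s'.mem = s.mem ∧
      (s'.reg 12 < s'.reg 13 ↔ ¬ L.IsArc i (G.rev (G.rot e)) ∧ L.IsArc i (G.rev e)) ∧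
      s'.reg 16 = G.rev e) s := by
  simp [liTest, h6, hs, hs.mem_rot, hs.mem_rev, hs.mem_color, hs.mem_out, hs.color, hs.one,
    Fin.val_inj, REL.IsArc, L.color_rev, L.out_rev]
  by_cases h1 : L.color e = i <;> by_cases h2 : L.color (G.rot e) = i <;>
  cases h3 : L.out e <;> cases h4 : L.out (G.rot e) <;> simp [h1, h2]

theorem loTable_spec (hW : n + 1 ≤ W) {s : State} (hs : Ready L i s) :
    wp W (tableProgram 7 loTest) (fun s' t => t ≤ 40 * n + 10 ∧ Ready L i s' ∧
      (∀ b ≠ 7, s'.mem b = s.mem b) ∧ ∀ d : Fin n, s'.mem 7 d = L.lo i d) s := by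
  refine tableProgram_spec (by norm_num) (trig := fun e => ¬ L.IsArc i e ∧ L.IsArc i (G.rot e))
    (val := G.rot) (τ := fun d => G.rot.symm (L.lo i d)) hW (fun s e hs h6 => loTest_spec hs h6)
    ?_ ?_
    hs
  · rintro e ⟨h1, h2⟩ m
    rw [← L.phase_eq_two] at h1 h2
    -- The phase advances by at most one, so an outgoing arc that follows a dart of another kind is
    -- the first of its group. Hence the trigger fires once per vertex.
    have h3 : L.phase i e = 1 := by
      have := L.phase_rot i e
      have := L.phase_lt i e
      omega
    have h4 := L.eq_lo i (G.sameVertex_iterate m e).symm h3 h2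
    rw [← h4]
    exact ⟨G.rot.symm_apply_apply e, rfl⟩
  · intro d
    obtain ⟨e, h1, h2, h3⟩ := (L.exists_unique_turn i d (show 1 < 4 by norm_num)).exists
    rw [← L.eq_lo i h1 h2 h3, Equiv.symm_apply_apply, ← L.phase_eq_two, ← L.phase_eq_two]
    exact ⟨⟨by omega, h3⟩, h1.symm⟩

theorem liTable_spec (hW : n + 1 ≤ W) {s : State} (hs : Ready L i s) :
    wp W (tableProgram 8 liTest) (fun s' t => t ≤ 40 * n + 10 ∧ Ready L i s' ∧
      (∀ b ≠ 8, s'.mem b = s.mem b) ∧ ∀ d : Fin n, s'.mem 8 d = L.li i d) s := by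
  refine tableProgram_spec (by norm_num)
    (trig := fun e => ¬ L.IsArc i (G.rev (G.rot e)) ∧ L.IsArc i (G.rev e))
    (val := G.rev) (τ := fun d => G.rev (L.li i d)) hW (fun s e hs h6 => liTest_spec hs h6) ?_ ?_ hs
  · rintro e ⟨h1, h2⟩ m
    rw [← L.phase_eq_zero] at h1 h2
    have h3 : L.phase i (G.rot e) = 1 := by
      have := L.phase_rot i e
      omega
    have h4 := L.eq_li i (G.sameVertex_iterate m e).symm h2 h3
    rw [← h4]
    exact ⟨G.rev_rev e, rfl⟩
  · intro d
    obtain ⟨e, h1, h2, h3⟩ := (L.exists_unique_turn i d (show 0 < 4 by norm_num)).exists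
    rw [← L.eq_li i h1 h2 h3, G.rev_rev, ← L.phase_eq_zero, ← L.phase_eq_zero]
    exact ⟨⟨by omega, h2⟩, h1.symm⟩

/-- The first part of the data that the program computes. -/
structure Tables (O : Orbits G) (L : REL G) (i : Fin 2) (s : State) : Prop where
  ready : Ready L i s
  mem_lo : ∀ d : Fin n, s.mem 7 d = L.lo i d
  mem_li : ∀ d : Fin n, s.mem 8 d = L.li i d
  mem_count : ∀ d : Fin n, s.mem 11 d = O.count i d

@[simp] theorem tables_setReg {O : Orbits G} {s : State} {x v : ℕ} (hx : 6 ≤ x) :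
    Tables O L i (s.setReg x v) ↔ Tables O L i s :=
  ⟨fun h => ⟨(ready_setReg hx).1 h.ready, h.mem_lo, h.mem_li, h.mem_count⟩,
    fun h => ⟨(ready_setReg hx).2 h.ready, h.mem_lo, h.mem_li, h.mem_count⟩⟩

@[simp] theorem tables_setMem {O : Orbits G} {s : State} {a k v : ℕ} (ha : 6 ≤ a) (h7 : a ≠ 7)
    (h8 : a ≠ 8) (h11 : a ≠ 11) : Tables O L i (s.setMem a k v) ↔ Tables O L i s := by
  have key (b : ℕ) (hb : a ≠ b) : (s.setMem a k v).mem b = s.mem b := by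
    rw [State.setMem_mem, if_neg hb.symm]
  constructor <;> rintro ⟨h, h1, h2, h3⟩ <;> refine ⟨?_, ?_, ?_, ?_⟩
  · exact (ready_setMem ha).1 h
  · simpa only [key 7 h7] using h1
  · simpa only [key 8 h8] using h2
  · simpa only [key 11 h11] using h3
  · exact (ready_setMem ha).2 h
  · simpa only [key 7 h7] using h1
  · simpa only [key 8 h8] using h2
  · simpa only [key 11 h11] using h3

/-- Counts crossings with an orbit, and finds the leftmost edges at all vertices. -/
def tablesProgram (i : Fin 2) : Program :=
  .seq (countProgram i) (.seq (tableProgram 7 loTest) (tableProgram 8 liTest))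

theorem tablesProgram_spec (O : Orbits G) (hW : inputSize O ≤ W) :
    wp W (tablesProgram i) (fun s t => t ≤ 120 * inputSize O ∧ Tables O L i s ∧
      ∀ a ≠ 11, 9 ≤ a → ∀ k, s.mem a k = 0) (inputState O L) := by
  have h1 := le_inputSize O i
  have h2 := O.len_pos i
  have hn : 0 < n := Fin.pos_iff_nonempty.2 G.nonempty
  refine wp_mono (wp_seq_le (countProgram_spec O L i hW) fun s hs =>
    wp_seq_le (wp_mono (loTable_spec (W := W) (by omega) hs.1) fun s' t h =>
      ⟨h.1, (⟨h.2.1, h.2.2.2, fun d => ?_, fun a h11 ha k => ?_⟩ : Ready L i s' ∧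
        (∀ d : Fin n, s'.mem 7 d = L.lo i d) ∧ (∀ d : Fin n, s'.mem 11 d = O.count i d) ∧
        ∀ a ≠ 11, 9 ≤ a → ∀ k, s'.mem a k = 0)⟩) fun s' hs' =>
      wp_mono (liTable_spec (W := W) (by omega) hs'.1) fun s'' t h =>
        ⟨h.1, (⟨⟨h.2.1, fun d => ?_, h.2.2.2, fun d => ?_⟩, fun a h11 ha k => ?_⟩ :
          Tables O L i s'' ∧ ∀ a ≠ 11, 9 ≤ a → ∀ k, s''.mem a k = 0)⟩) fun s t h => ⟨?_, h.2⟩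
  · rw [h.2.2.1 11 (by norm_num), hs.2.2]
  · rw [h.2.2.1 a (by omega), hs.2.1 a h11 (by omega)]
  · rw [h.2.2.1 7 (by norm_num), hs'.2.1]
  · rw [h.2.2.1 11 (by norm_num), hs'.2.2.1]
  · rw [h.2.2.1 a (by omega), hs'.2.2.2 a h11 ha]
  · omega

/-- Moves `n` times from a vertex to another one, using array `a`. -/
def searchProgram (a x : ℕ) : Program :=
  .block [.const 6 0, .move 19 4, .while (.lt 6 0)
    (.block [.load 19 a 19, .load 19 7 19, .add 6 6 3]), .move x 19]

/-- By the pigeonhole principle, `n` steps of a self-map of `n` points lead into a cycle. -/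
theorem iterate_card_mem_periodicPts (f : Fin n → Fin n) (x : Fin n) :
    f^[n] x ∈ Function.periodicPts f := by
  obtain ⟨a, b, hab, h⟩ := Fintype.exists_ne_map_eq_of_card_lt
    (fun k : Fin (n + 1) => f^[k] x) (by simp)
  wlog hlt : a < b generalizing a b
  · exact this b a hab.symm h.symm (lt_of_le_of_ne (not_lt.1 hlt) hab.symm)
  have hp : f^[a] x ∈ Function.periodicPts f := by
    refine ⟨b - a, by have : (a : ℕ) < b := hlt; omega, ?_⟩
    rw [Function.IsPeriodicPt, Function.IsFixedPt, ← Function.iterate_add_apply,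
      Nat.sub_add_cancel (le_of_lt hlt)]
    exact h.symm
  have e : f^[n] x = f^[n - a] (f^[a] x) := by
    rw [← Function.iterate_add_apply, Nat.sub_add_cancel (Nat.lt_succ_iff.1 a.2)]
  rw [e]
  obtain ⟨m, hm, hp⟩ := hp
  exact ⟨m, hm, hp.apply_iterate _⟩

theorem searchProgram_spec {O : Orbits G} (hW : n + 1 ≤ W) {a x : ℕ} (hx : 20 ≤ x)
    {g : Fin n → Fin n}
    {s : State} (hs : Tables O L i s) (hg : ∀ d : Fin n, s.mem a d = g d) :
    wp W (searchProgram a x) (fun s' t => t ≤ 6 * n + 10 ∧ Tables O L i s' ∧ s'.mem = s.mem ∧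
      (∃ v : Fin n, s'.reg x = v ∧ v ∈ Function.periodicPts fun d => L.lo i (g d)) ∧
      ∀ y ≠ x, 20 ≤ y → s'.reg y = s.reg y) s := by
  have hn : 0 < n := Fin.pos_iff_nonempty.2 G.nonempty
  let Inv (k : ℕ) (s' : State) : Prop := Tables O L i s' ∧ s'.mem = s.mem ∧ s'.reg 6 = k ∧
    s'.reg 19 = ((fun d => L.lo i (g d))^[k] ⟨0, hn⟩ : Fin n) ∧ ∀ y, 20 ≤ y → s'.reg y = s.reg y
  have hloop := fun s₀ (h0 : Inv 0 s₀) => wp_loop_const (W := W) (b := .lt 6 0)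
    (P := .block [.load 19 a 19, .load 19 7 19, .add 6 6 3]) Inv 4 n (s := s₀) ?_ ?_ h0
  · simp only [searchProgram, wp_block_cons, wp_block_nil, wp_const, wp_move]
    refine ⟨Nat.zero_le _, wp_mono (hloop _ ?_) ?_⟩
    · refine ⟨by simp [hs], rfl, rfl, ?_, ?_⟩
      · simp [hs.ready.zero]
      · intro y hy
        simp [show y ≠ 19 by omega, show y ≠ 6 by omega]
    · rintro s' t ⟨ht, h1, h2, h3, h4, h5⟩
      refine ⟨by omega, (tables_setReg (by omega)).2 h1, h2, ⟨_, ?_,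
        iterate_card_mem_periodicPts (fun d => L.lo i (g d)) ⟨0, hn⟩⟩, ?_⟩
      · rw [State.setReg_reg, if_pos rfl, h4]
      · intro y hy hy'
        rw [State.setReg_reg, if_neg hy, h5 y hy']
  · rintro j s ⟨h1, -, h2, -⟩
    simp [h1.ready.size, h2]
  · rintro k hk s' ⟨h1, h2, h3, h4, h5⟩
    simp [h3, h4, h2, hg, h1.ready.one]
    refine ⟨by omega, by simp [h1], h2, ?_, ?_, ?_⟩
    · simp
    · simp only [State.setReg_reg, Nat.reduceEqDiff, if_true, if_false]
      rw [hs.mem_lo, Function.iterate_succ_apply']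
    · intro y hy
      simp [show y ≠ 19 by omega, show y ≠ 6 by omega, h5 y hy]

end

/-! ### Programs that traverse the two extreme cycles. -/

/-- Marks the arcs of the cycle through the vertex in register `20` that always leaves a vertex
through the leftmost edge, and counts its crossings with the orbit. -/
def outCycleProgram : Program :=
  .block [.const 22 0, .const 23 0, .move 30 20, .const 18 1, .while (.eq 18 3)
    (.block [.store 9 30 3, .load 31 11 30, .add 22 22 31, .load 31 1 30, .load 32 11 31,
      .add 23 23 32, .load 30 7 31, .ite (.eq 30 20) (.const 18 0) .skip])]

/-- Follows backwards the cycle through the vertex in register `21` that always enters a vertex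
through the leftmost edge, stores its arcs, and counts its crossings with the orbit and
its arcs that join the first cycle. -/
def inCycleProgram : Program :=
  .block [.const 24 0, .const 25 0, .const 26 0, .move 30 21, .const 18 1, .while (.eq 18 3)
    (.block [.load 31 8 30, .load 32 7 31, .add 33 31 3, .store 10 32 33, .load 34 11 31,
      .add 24 24 34, .load 34 1 31, .load 34 11 34, .add 25 25 34, .load 35 9 31, .load 36 9 30,
      .ite (.lt 35 36) (.add 26 26 3) .skip, .move 30 32, .ite (.eq 30 21) (.const 18 0) .skip])]

section

variable {n W : ℕ} {G : TorusTriangulation (Fin n)} {L : REL G} {i : Fin 2}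

/-- Each crossing of the orbit is counted for at most one of the distinct darts. This keeps the
accumulated numbers within the word size. -/
theorem sum_count_le (O : Orbits G) (o : Fin 2) {j : ℕ} {h : ℕ → Fin n}
    (hinj : Set.InjOn h (Set.Iio j)) : ∑ k ∈ Finset.range j, O.count o (h k) ≤ O.len o := by
  rw [← Finset.sum_image (f := O.count o) (g := h) (by simpa using hinj)]
  refine (Finset.sum_le_univ_sum_of_nonneg fun _ => Nat.zero_le _).trans ?_
  unfold Orbits.count
  rw [← Finset.card_eq_sum_card_fiberwise (fun _ _ => Finset.mem_coe.2 (Finset.mem_univ _)),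
    Finset.card_range]

theorem minimalPeriod_le (f : Fin n → Fin n) (x : Fin n) : Function.minimalPeriod f x ≤ n := by
  conv_rhs => rw [← Fintype.card_fin n]
  rw [← Fintype.card_fin (Function.minimalPeriod f x)]
  exact Fintype.card_le_of_injective (fun k : Fin (Function.minimalPeriod f x) => f^[k] x)
    fun k l h => Fin.ext (Function.iterate_injOn_Iio_minimalPeriod k.2 l.2 h)

theorem outCycleProgram_spec {O : Orbits G} (hW : inputSize O ≤ W) {s : State}
    (hs : Tables O L i s) (h9 : ∀ k, s.mem 9 k = 0) {v : Fin n} (h20 : s.reg 20 = v)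
    (hv : v ∈ Function.periodicPts (L.succ i)) :
    wp W outCycleProgram (fun s' t => t ≤ 12 * n + 10 ∧ Tables O L i s' ∧
      (∀ a ≠ 9, s'.mem a = s.mem a) ∧ s'.reg 20 = v ∧ s'.reg 21 = s.reg 21 ∧
      (∀ d : Fin n, s'.mem 9 d =
        if ∃ k < Function.minimalPeriod (L.succ i) v, (L.succ i)^[k] v = d then 1 else 0) ∧
      s'.reg 22 = ∑ k ∈ Finset.range (Function.minimalPeriod (L.succ i) v),
        O.count i ((L.succ i)^[k] v) ∧
      s'.reg 23 = ∑ k ∈ Finset.range (Function.minimalPeriod (L.succ i) v),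
        O.count i (G.rev ((L.succ i)^[k] v))) s := by
  set f := L.succ i
  set T := Function.minimalPeriod f v with hTdef
  have hT : 0 < T := Function.minimalPeriod_pos_of_mem_periodicPts hv
  have hTn : T ≤ n := minimalPeriod_le f v
  have hN := le_inputSize O i
  have hlen := O.len_pos i
  have hb1 (j : ℕ) (hj : j ≤ T) : ∑ k ∈ Finset.range j, O.count i (f^[k] v) ≤ O.len i :=
    sum_count_le O i (Function.iterate_injOn_Iio_minimalPeriod.mono (Set.Iio_subset_Iio hj))
  have hb2 (j : ℕ) (hj : j ≤ T) : ∑ k ∈ Finset.range j, O.count i (G.rev (f^[k] v)) ≤ O.len i :=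
    sum_count_le O i (h := fun k => G.rev (f^[k] v)) (G.rev.injective.comp_injOn
      (Function.iterate_injOn_Iio_minimalPeriod.mono (Set.Iio_subset_Iio hj)))
  let Inv (j : ℕ) (s' : State) : Prop := Tables O L i s' ∧
      (∀ a ≠ 9, s'.mem a = s.mem a) ∧ s'.reg 20 = v ∧ s'.reg 21 = s.reg 21 ∧
      (∀ d : Fin n, s'.mem 9 d = if ∃ k < j, f^[k] v = d then 1 else 0) ∧
      s'.reg 22 = ∑ k ∈ Finset.range j, O.count i (f^[k] v) ∧
      s'.reg 23 = ∑ k ∈ Finset.range j, O.count i (G.rev (f^[k] v)) ∧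
      s'.reg 30 = (f^[j] v : Fin n) ∧ s'.reg 18 = if j < T then 1 else 0
  have hloop := fun s₀ (h0 : Inv 0 s₀) => wp_loop_const (W := W) (b := .eq 18 3)
    (P := .block [.store 9 30 3, .load 31 11 30, .add 22 22 31, .load 31 1 30, .load 32 11 31,
      .add 23 23 32, .load 30 7 31, .ite (.eq 30 20) (.const 18 0) .skip])
    Inv 11 T (s := s₀) ?_ ?_ h0
  · simp only [outCycleProgram, wp_block_cons, wp_block_nil, wp_const, wp_move]
    refine ⟨Nat.zero_le _, Nat.zero_le _, by omega, wp_mono (hloop _ ?_) ?_⟩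
    · refine ⟨?_, ?_, ?_, ?_, ?_, ?_, ?_, ?_, ?_⟩
      all_goals simp [hs, h20, h9, hT]
    · rintro s' t ⟨ht, h1, h2, h3, h4, h5, h6, h7, -⟩
      exact ⟨by omega, h1, h2, h3, h4, h5, h6, h7⟩
  · rintro j s ⟨h1, -, -, -, -, -, -, -, h2⟩
    simp only [Test.Holds, h1.ready.one, h2]
    split_ifs with h <;> simp [h]
  · rintro j hj s' ⟨h1, h2, h3, h4, h5, h6, h7, h8, h9⟩
    have e2 := hb1 (j + 1) hj
    have e3 := hb2 (j + 1) hj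
    rw [Finset.sum_range_succ] at e2 e3
    have hend : f^[j + 1] v = v ↔ ¬ j + 1 < T := iterate_succ_eq_self_iff hj
    have key (s'' : State) (k1 : Tables O L i s'') (hm : s''.mem =
        (s'.setMem 9 (f^[j] v : Fin n) 1).mem) (k2 : s''.reg 20 = v) (k3 : s''.reg 21 = s.reg 21)
        (k4 : s''.reg 22 = s'.reg 22 + O.count i (f^[j] v))
        (k5 : s''.reg 23 = s'.reg 23 + O.count i (G.rev (f^[j] v)))
        (k6 : s''.reg 30 = (f^[j + 1] v : Fin n)) (k7 : s''.reg 18 = if j + 1 < T then 1 else 0) :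
        Inv (j + 1) s'' := by
      refine ⟨k1, fun a ha => ?_, k2, k3, fun d => ?_, ?_, ?_, k6, k7⟩
      · rw [hm, State.setMem_mem, if_neg ha, h2 a ha]
      · rw [hm, State.setMem_mem, if_pos rfl, mem_update, h5]
        simp only [Nat.lt_succ_iff_lt_or_eq, or_and_right, exists_or, exists_eq_left]
        by_cases hd : f^[j] v = d
        · rw [if_pos hd.symm, if_pos (Or.inr hd)]
        · rw [if_neg (Ne.symm hd)]
          simp only [hd, or_false]
      · rw [k4, h6, Finset.sum_range_succ]
      · rw [k5, h7, Finset.sum_range_succ]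
    have hrev := h1.ready.mem_rev
    have hlo : L.lo i (G.rev (f^[j] v)) = f^[j + 1] v := by
      rw [Function.iterate_succ_apply']; rfl
    simp only [wp_block_cons, wp_block_nil, wp_ite, wp_add, wp_const, wp_load,
      wp_store, wp_skip, Test.Holds, State.setReg_reg, State.setReg_mem, State.setMem_reg,
      State.setMem_mem, Nat.reduceEqDiff, if_true, if_false, h8, h3, h1.mem_count, hrev,
      h1.mem_lo, h1.ready.one, h6, h7, Fin.val_inj, hlo, hend]
    refine ⟨by omega, by omega, fun hb => ⟨by omega, by norm_num, key _ ?_ ?_ ?_ ?_ ?_ ?_ ?_ ?_⟩,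
      fun hb => ⟨by norm_num, key _ ?_ ?_ ?_ ?_ ?_ ?_ ?_ ?_⟩⟩
    all_goals first | rfl | simp [h1, h3, h4, h6, h7, h9, hj]
    · simpa using hb
    · simpa using hb

/-- Array `10` stores each arc increased by one, so that 0 marks the vertices off the cycle.
Register `26` counts the arcs that join the first cycle, which is the intersection number of the two
cycles. -/
theorem inCycleProgram_spec {O : Orbits G} (hW : 2 * inputSize O ≤ W) {s : State}
    (hs : Tables O L i s) (h10 : ∀ k, s.mem 10 k = 0) {u : Fin n} (h21 : s.reg 21 = u)
    (hu : u ∈ Function.periodicPts (L.pred i)) {A : Fin n → Prop} [DecidablePred A]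
    (hA : ∀ d : Fin n, s.mem 9 d = if A d then 1 else 0) :
    wp W inCycleProgram (fun s' t => t ≤ 20 * n + 10 ∧ Tables O L i s' ∧
      (∀ a ≠ 10, s'.mem a = s.mem a) ∧ s'.reg 20 = s.reg 20 ∧ s'.reg 22 = s.reg 22 ∧
      s'.reg 23 = s.reg 23 ∧
      (∀ d : Fin n, (s'.mem 10 d = 0 ∧
          ∀ k < Function.minimalPeriod (L.pred i) u, (L.pred i)^[k + 1] u ≠ d) ∨
        ∃ k < Function.minimalPeriod (L.pred i) u, (L.pred i)^[k + 1] u = d ∧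
          s'.mem 10 d = L.li i ((L.pred i)^[k] u) + 1) ∧
      s'.reg 24 = ∑ k ∈ Finset.range (Function.minimalPeriod (L.pred i) u),
        O.count i (L.li i ((L.pred i)^[k] u)) ∧
      s'.reg 25 = ∑ k ∈ Finset.range (Function.minimalPeriod (L.pred i) u),
        O.count i (G.rev (L.li i ((L.pred i)^[k] u))) ∧
      s'.reg 26 = ∑ k ∈ Finset.range (Function.minimalPeriod (L.pred i) u),
        if A ((L.pred i)^[k] u) ∧ ¬ A (L.li i ((L.pred i)^[k] u)) then 1 else 0) s := by
  set f := L.pred i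
  set T := Function.minimalPeriod f u with hTdef
  have hT : 0 < T := Function.minimalPeriod_pos_of_mem_periodicPts hu
  have hTn : T ≤ n := minimalPeriod_le f u
  have hN := le_inputSize O i
  have hlen := O.len_pos i
  -- The arc determines its tail, which is the next vertex under `pred`, and `pred` is invertible on
  -- its cycle.
  have hinj (j : ℕ) (hj : j ≤ T) : Set.InjOn (fun k => L.li i (f^[k] u)) (Set.Iio j) := by
    intro k hk l hl h
    have h1 : f^[k + 1] u = f^[l + 1] u := by
      rw [Function.iterate_succ_apply', Function.iterate_succ_apply']
      exact congr_arg (L.lo i) h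
    have h2 (m : ℕ) : f^[T - 1] (f^[m + 1] u) = f^[m] u := by
      rw [← Function.iterate_add_apply, show T - 1 + (m + 1) = m + T by omega, hTdef,
        Function.iterate_add_minimalPeriod_eq]
    refine Function.iterate_injOn_Iio_minimalPeriod (hk.trans_le hj) (hl.trans_le hj)
      (?_ : f^[k] u = f^[l] u)
    rw [← h2, h1, h2]
  have hb1 (j : ℕ) (hj : j ≤ T) :
      ∑ k ∈ Finset.range j, O.count i (L.li i (f^[k] u)) ≤ O.len i := sum_count_le O i (hinj j hj)
  have hb2 (j : ℕ) (hj : j ≤ T) :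
      ∑ k ∈ Finset.range j, O.count i (G.rev (L.li i (f^[k] u))) ≤ O.len i :=
    sum_count_le O i (h := fun k => G.rev (L.li i (f^[k] u)))
      (G.rev.injective.comp_injOn (hinj j hj))
  have hb3 (j : ℕ) (hj : j ≤ T) : (∑ k ∈ Finset.range j,
      if A (f^[k] u) ∧ ¬ A (L.li i (f^[k] u)) then 1 else 0) ≤ n := by
    refine le_trans (Finset.sum_le_card_nsmul _ _ 1 fun k _ => ?_) ?_
    · split_ifs <;> norm_num
    · simp; omega
  let Inv (j : ℕ) (s' : State) : Prop := Tables O L i s' ∧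
      (∀ a ≠ 10, s'.mem a = s.mem a) ∧ (s'.reg 20 = s.reg 20 ∧ s'.reg 22 = s.reg 22 ∧
      s'.reg 23 = s.reg 23 ∧ s'.reg 21 = u) ∧
      (∀ d : Fin n, (s'.mem 10 d = 0 ∧ ∀ k < j, f^[k + 1] u ≠ d) ∨
        ∃ k < j, f^[k + 1] u = d ∧ s'.mem 10 d = L.li i (f^[k] u) + 1) ∧
      s'.reg 24 = ∑ k ∈ Finset.range j, O.count i (L.li i (f^[k] u)) ∧
      s'.reg 25 = ∑ k ∈ Finset.range j, O.count i (G.rev (L.li i (f^[k] u))) ∧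
      s'.reg 26 = (∑ k ∈ Finset.range j, if A (f^[k] u) ∧ ¬ A (L.li i (f^[k] u)) then 1 else 0) ∧
      s'.reg 30 = (f^[j] u : Fin n) ∧ s'.reg 18 = if j < T then 1 else 0
  have hloop := fun s₀ (h0 : Inv 0 s₀) => wp_loop_const (W := W) (b := .eq 18 3)
    (P := .block [.load 31 8 30, .load 32 7 31, .add 33 31 3, .store 10 32 33, .load 34 11 31,
      .add 24 24 34, .load 34 1 31, .load 34 11 34, .add 25 25 34, .load 35 9 31, .load 36 9 30,
      .ite (.lt 35 36) (.add 26 26 3) .skip, .move 30 32, .ite (.eq 30 21) (.const 18 0) .skip])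
    Inv 18 T (s := s₀) ?_ ?_ h0
  · simp only [inCycleProgram, wp_block_cons, wp_block_nil, wp_const, wp_move]
    refine ⟨Nat.zero_le _, Nat.zero_le _, Nat.zero_le _, by omega, wp_mono (hloop _ ?_) ?_⟩
    · refine ⟨?_, ?_, ?_, ?_, ?_, ?_, ?_, ?_, ?_⟩
      all_goals simp [hs, h21, h10, hT]
    · rintro s' t ⟨ht, h1, h2, ⟨h3, h4, h5, -⟩, h6, h7, h8, h9, -⟩
      exact ⟨by omega, h1, h2, h3, h4, h5, h6, h7, h8, h9⟩
  · rintro j s ⟨h1, -, -, -, -, -, -, -, h2⟩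
    simp only [Test.Holds, h1.ready.one, h2]
    split_ifs with h <;> simp [h]
  · rintro j hj s' ⟨h1, h2, h3, h4, h5, h6, h7, h8, h9⟩
    have e1 := hb1 (j + 1) hj
    have e2 := hb2 (j + 1) hj
    have e3 := hb3 (j + 1) hj
    rw [Finset.sum_range_succ] at e1 e2 e3
    have hend : f^[j + 1] u = u ↔ ¬ j + 1 < T := iterate_succ_eq_self_iff hj
    have key (s'' : State) (k1 : Tables O L i s'') (hm : s''.mem =
        (s'.setMem 10 (f^[j + 1] u : Fin n) (L.li i (f^[j] u) + 1)).mem)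
        (k2 : s''.reg 20 = s'.reg 20 ∧ s''.reg 22 = s'.reg 22 ∧ s''.reg 23 = s'.reg 23 ∧
          s''.reg 21 = s'.reg 21)
        (k4 : s''.reg 24 = s'.reg 24 + O.count i (L.li i (f^[j] u)))
        (k5 : s''.reg 25 = s'.reg 25 + O.count i (G.rev (L.li i (f^[j] u))))
        (k3 : s''.reg 26 = s'.reg 26 + if A (f^[j] u) ∧ ¬ A (L.li i (f^[j] u)) then 1 else 0)
        (k6 : s''.reg 30 = (f^[j + 1] u : Fin n)) (k7 : s''.reg 18 = if j + 1 < T then 1 else 0) :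
        Inv (j + 1) s'' := by
      refine ⟨k1, fun a ha => ?_, ?_, fun d => ?_, ?_, ?_, ?_, k6, k7⟩
      · rw [hm, State.setMem_mem, if_neg ha, h2 a ha]
      · rw [k2.1, k2.2.1, k2.2.2.1, k2.2.2.2]; exact h3
      · rw [hm, State.setMem_mem, if_pos rfl, mem_update]
        by_cases hd : d = f^[j + 1] u
        · rw [if_pos hd]
          exact Or.inr ⟨j, by omega, hd.symm, rfl⟩
        · rw [if_neg hd]
          rcases h4 d with ⟨h0, h⟩ | ⟨k, hk, h⟩
          · refine Or.inl ⟨h0, fun k hk => ?_⟩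
            rcases Nat.lt_succ_iff_lt_or_eq.1 hk with hk | rfl
            · exact h k hk
            · exact Ne.symm hd
          · exact Or.inr ⟨k, by omega, h⟩
      · rw [k4, h5, Finset.sum_range_succ]
      · rw [k5, h6, Finset.sum_range_succ]
      · rw [k3, h7, Finset.sum_range_succ]
    have hrev := h1.ready.mem_rev
    have hlo : L.lo i (L.li i (f^[j] u)) = f^[j + 1] u := by
      rw [Function.iterate_succ_apply']; rfl
    have hA' (d : Fin n) : s'.mem 9 d = if A d then 1 else 0 := by rw [h2 9 (by norm_num), hA]
    have hlt : ((if A (L.li i (f^[j] u)) then 1 else 0) < if A (f^[j] u) then 1 else 0) ↔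
        A (f^[j] u) ∧ ¬ A (L.li i (f^[j] u)) := by
      split_ifs <;> simp [*]
    simp only [wp_block_cons, wp_block_nil, wp_ite, wp_add, wp_const, wp_move, wp_load,
      wp_store, wp_skip, Test.Holds, State.setReg_reg, State.setReg_mem, State.setMem_reg,
      State.setMem_mem, Nat.reduceEqDiff, if_true, if_false, h8, h3.2.2.2, h1.mem_count, hrev,
      h1.mem_lo, h1.mem_li, h1.ready.one, h5, h6, h7, Fin.val_inj, hlo, hend, hA', hlt]
    have hval := (L.li i (f^[j] u)).2
    refine ⟨by omega, by omega, by omega, fun hb => ⟨by rw [if_pos hb] at e3; omega,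
        fun hc => ⟨by omega, ?_, key _ ?_ ?_ ?_ ?_ ?_
        ?_ ?_ ?_⟩, fun hc => ⟨by omega, key _ ?_ ?_ ?_ ?_ ?_ ?_ ?_ ?_⟩⟩,
      fun hb => ⟨fun hc => ⟨by omega, ?_, key _ ?_ ?_ ?_ ?_ ?_
        ?_ ?_ ?_⟩, fun hc => ⟨by omega, key _ ?_ ?_ ?_ ?_ ?_ ?_ ?_ ?_⟩⟩⟩
    all_goals first | rfl | simp [h1, h3, h5, h6, h7, h9, hj, if_pos hb]
    all_goals first | simpa using hc | simpa using hb

end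

/-! ### The traversed data describe a pair of strand cycles. -/

namespace REL

variable {D : Type} {G : TorusTriangulation D} (L : REL G) (i : Fin 2)

/-- The cycle through `v` that leaves vertices through leftmost edges, and the cycle through `u`
that enters vertices through leftmost edges. -/
noncomputable def strands {v u : D} (hv : v ∈ Function.periodicPts (L.succ i))
    (hu : u ∈ Function.periodicPts (L.pred i)) : Strands L i where
  a := L.leftOut i v hv
  b := L.leftIn i u hu
  ha := L.isCycle_leftOut i hv
  hb := L.isCycle_leftIn i hu
  lo_a := L.lo_leftOut i hv
  li_b := L.li_leftIn i hu

variable {L i} {v u : D} (hv : v ∈ Function.periodicPts (L.succ i))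
    (hu : u ∈ Function.periodicPts (L.pred i))

theorem inA_strands {d : D} : (L.strands i hv hu).InA d ↔
    ∃ k < Function.minimalPeriod (L.succ i) v, (L.succ i)^[k] v = d := by
  constructor
  · rintro ⟨k, rfl⟩
    exact (L.leftOut i v hv).exists_lt k
  · rintro ⟨k, -, h⟩
    exact ⟨k, h⟩

/-- The program follows `pred`, while the directed cycle runs the other way. Modulo the period `T`,
`(T - 1) * (k + 1)` is `T - 1 - k`. -/
theorem leftIn_dart {k : ℕ} (hk : k < Function.minimalPeriod (L.pred i) u) :
    (L.leftIn i u hu).dart k =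
      L.li i ((L.pred i)^[Function.minimalPeriod (L.pred i) u - 1 - k] u) := by
  change L.li i ((L.pred i)^[_] u) = _
  congr 1
  rw [← Function.iterate_mod_minimalPeriod_eq,
      ← Function.iterate_mod_minimalPeriod_eq (n := _ - 1 - k)]
  congr 1
  obtain ⟨m, hm⟩ := Nat.exists_eq_add_of_lt hk
  rw [hm]
  have e : (k + m + 1 - 1) * (k + 1) = k + m + 1 - 1 - k + (k + m + 1) * k := by
    rw [show k + m + 1 - 1 - k = m by omega, show k + m + 1 - 1 = k + m by omega]
    ring
  rw [e, Nat.add_mul_mod_self_left]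

theorem sum_leftIn {M : Type*} [AddCommMonoid M] (F : D → M) :
    ∑ k ∈ Finset.range (L.leftIn i u hu).len, F ((L.leftIn i u hu).dart k) =
      ∑ k ∈ Finset.range (Function.minimalPeriod (L.pred i) u), F (L.li i ((L.pred i)^[k] u)) := by
  rw [← Finset.sum_range_reflect (fun k => F (L.li i ((L.pred i)^[k] u)))]
  exact Finset.sum_congr rfl fun k hk => by rw [leftIn_dart hu (Finset.mem_range.1 hk)]

theorem onB_strands {d : D} : (L.strands i hv hu).OnB d ↔
    ∃ k < Function.minimalPeriod (L.pred i) u, (L.pred i)^[k + 1] u = d := by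
  constructor
  · rintro ⟨k, rfl⟩
    obtain ⟨m, hm, h⟩ := (L.leftIn i u hu).exists_lt k
    change _ < Function.minimalPeriod (L.pred i) u at hm
    refine ⟨Function.minimalPeriod (L.pred i) u - 1 - m, by omega, ?_⟩
    change _ = L.lo i ((L.leftIn i u hu).dart k)
    rw [← h, leftIn_dart hu hm, Function.iterate_succ_apply']
    rfl
  · rintro ⟨k, hk, rfl⟩
    refine ⟨Function.minimalPeriod (L.pred i) u - 1 - k, ?_⟩
    change L.lo i ((L.leftIn i u hu).dart _) = _
    rw [leftIn_dart hu (by omega), show Function.minimalPeriod (L.pred i) u - 1 -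
      (Function.minimalPeriod (L.pred i) u - 1 - k) = k by omega, Function.iterate_succ_apply']
    rfl

theorem bOut_strands {k : ℕ} (hk : k < Function.minimalPeriod (L.pred i) u) :
    (L.strands i hv hu).bOut ((L.pred i)^[k + 1] u) = L.li i ((L.pred i)^[k] u) := by
  have h : (L.strands i hv hu).InB (L.li i ((L.pred i)^[k] u)) := by
    refine ⟨Function.minimalPeriod (L.pred i) u - 1 - k, ?_⟩
    change (L.leftIn i u hu).dart _ = _
    rw [leftIn_dart hu (by omega), show Function.minimalPeriod (L.pred i) u - 1 -
      (Function.minimalPeriod (L.pred i) u - 1 - k) = k by omega]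
  rw [Function.iterate_succ_apply']
  exact h.bOut_eq

include hu in
theorem lo_iterate_pred (k : ℕ) : L.lo i ((L.pred i)^[k] u) = (L.pred i)^[k] u := by
  have h := Function.minimalPeriod_pos_of_mem_periodicPts hu
  rw [← Function.iterate_add_minimalPeriod_eq,
    show k + Function.minimalPeriod (L.pred i) u =
      k + (Function.minimalPeriod (L.pred i) u - 1) + 1 by omega,
    Function.iterate_succ_apply', pred, lo_lo]

-- By `push_a`, the pairing is the number of arcs of `b` that join `a`.
open Classical in
theorem pair_strands [DecidableEq D] [Fintype D] (O : Orbits G) :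
    (L.strands i hv hu).a.pair O (L.strands i hv hu).b =
    ((∑ k ∈ Finset.range (Function.minimalPeriod (L.pred i) u),
      if (L.strands i hv hu).InA ((L.pred i)^[k] u) ∧
        ¬ (L.strands i hv hu).InA (L.li i ((L.pred i)^[k] u)) then 1 else 0 : ℕ) : ℚ) := by
  rw [← (L.strands i hv hu).ha.sum_push O (L.strands i hv hu).hb.isWalk, Nat.cast_sum]
  refine (Finset.sum_congr rfl fun k _ => Strands.push_a (Or.inr ⟨k, rfl⟩)).trans ?_
  refine (sum_leftIn hu fun d => (if (L.strands i hv hu).InA (L.lo i (G.rev d)) ∧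
    ¬ (L.strands i hv hu).InA d then 1 else 0 : ℚ)).trans (Finset.sum_congr rfl fun k _ => ?_)
  rw [L.lo_eq i (L.sameVertex_li i _), lo_iterate_pred hu]
  split_ifs <;> simp

end REL

/-- Finds the two cycles. -/
def cyclesProgram : Program :=
  .seq (searchProgram 1 20) (.seq (searchProgram 8 21) (.seq outCycleProgram inCycleProgram))

section

open Classical

variable {n W : ℕ} {G : TorusTriangulation (Fin n)} {L : REL G} {i : Fin 2}

/-- The two cycles have been stored. -/
structure Marks (O : Orbits G) (S : Strands L i) (v : Fin n) (s : State) : Prop where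
  tables : Tables O L i s
  start : s.reg 20 = v
  inA : S.InA v
  mem_inA : ∀ d : Fin n, s.mem 9 d = if S.InA d then 1 else 0
  mem_bOut : ∀ d : Fin n, s.mem 10 d = if S.OnB d then (S.bOut d : ℕ) + 1 else 0

/-- The intersection numbers of the two cycles with each other and with the orbit. -/
structure Crossings (O : Orbits G) (S : Strands L i) (s : State) : Prop where
  a_eq : S.a.sum (O.crossing i) = (s.reg 22 : ℚ) - s.reg 23
  b_eq : - S.b.sum (O.crossing i) = (s.reg 25 : ℚ) - s.reg 24
  pair_eq : S.a.pair O S.b = s.reg 26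
  a_le : s.reg 22 ≤ O.len i
  b_le : s.reg 25 ≤ O.len i

theorem sum_crossing (O : Orbits G) (o : Fin 2) (m : ℕ) (h : ℕ → Fin n) :
    ∑ k ∈ Finset.range m, O.crossing o (h k) =
      ((∑ k ∈ Finset.range m, O.count o (h k) : ℕ) : ℚ) -
        (∑ k ∈ Finset.range m, O.count o (G.rev (h k)) : ℕ) := by
  rw [Nat.cast_sum, Nat.cast_sum, ← Finset.sum_sub_distrib]
  rfl

theorem cyclesProgram_spec {O : Orbits G} (hW : 2 * inputSize O ≤ W) {s : State}
    (hs : Tables O L i s) (h0 : ∀ a ≠ 11, 9 ≤ a → ∀ k, s.mem a k = 0) :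
    wp W cyclesProgram (fun s' t => t ≤ 50 * n + 40 ∧
      ∃ (S : Strands L i) (v : Fin n), Marks O S v s' ∧ Crossings O S s') s := by
  have hN := le_inputSize O i
  have hlen := O.len_pos i
  refine wp_mono (wp_seq_le (B := 44 * n + 30)
    (K := fun s' => ∃ (S : Strands L i) (v : Fin n), Marks O S v s' ∧ Crossings O S s')
    (searchProgram_spec (W := W) (by omega) le_rfl hs hs.ready.mem_rev)
    fun s₁ h₁ => ?_)
    fun s' t h => ⟨by omega, h.2⟩
  obtain ⟨k1, k2, ⟨v, k3, hv⟩, -⟩ := h₁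
  refine wp_mono (wp_seq_le (B := 32 * n + 20)
    (K := fun s' => ∃ (S : Strands L i) (v : Fin n), Marks O S v s' ∧ Crossings O S s')
    (searchProgram_spec (W := W) (by omega) (by norm_num) k1 k1.mem_li)
    fun s₂ h₂ => ?_)
    fun s' t h => ⟨by omega, h.2⟩
  obtain ⟨l1, l2, ⟨u, l3, hu⟩, l4⟩ := h₂
  rw [k2] at l2
  refine wp_mono (wp_seq_le (B := 20 * n + 10)
    (K := fun s' => ∃ (S : Strands L i) (v : Fin n), Marks O S v s' ∧ Crossings O S s')
    (outCycleProgram_spec (W := W) (by omega) l1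
    (by rw [l2]; exact h0 9 (by norm_num) (by norm_num)) ((l4 20 (by norm_num) le_rfl).trans k3) hv)
    fun s₃ h₃ => ?_)
    fun s' t h => ⟨by omega, h.2⟩
  obtain ⟨m1, m2, m3, m4, m5, m6, m7⟩ := h₃
  set S := L.strands i hv hu with hS
  have hA (d : Fin n) : s₃.mem 9 d = if S.InA d then 1 else 0 := by
    rw [m5]
    exact if_congr (REL.inA_strands hv hu).symm rfl rfl
  refine wp_mono (inCycleProgram_spec hW m1 (u := u) ?_ (m4.trans l3) hu hA) ?_
  · rw [m2 10 (by norm_num), l2]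
    exact h0 10 (by norm_num) (by norm_num)
  rintro s₄ t ⟨ht, n1, n2, n3, n4, n5, n6, n7, n8, n9⟩
  have hsum := fun h => sum_count_le O i (j := Function.minimalPeriod (L.succ i) v)
    (h := fun k => (L.succ i)^[k] v) h
  refine ⟨by omega, S, v, ⟨n1, n3.trans m3, ⟨0, rfl⟩, ?_, fun d => ?_⟩, ?_, ?_, ?_, ?_, ?_⟩
  · rw [n2 9 (by norm_num)]; exact hA
  · rcases n6 d with ⟨h, h'⟩ | ⟨k, hk, rfl, h'⟩
    · rw [h, if_neg fun hB => ?_]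
      obtain ⟨k, hk, e⟩ := (REL.onB_strands hv hu).1 hB
      exact h' k hk e
    · rw [h', if_pos ((REL.onB_strands hv hu).2 ⟨k, hk, rfl⟩), REL.bOut_strands hv hu hk]
  · rw [n4, n5, m6, m7]
    exact sum_crossing O i _ _
  · rw [n7, n8, neg_eq_iff_eq_neg, neg_sub, ← sum_crossing O i _ fun k => L.li i ((L.pred i)^[k] u)]
    exact REL.sum_leftIn hu _
  · rw [n9]
    exact REL.pair_strands hv hu O
  · rw [n4, m6]
    exact sum_count_le O i (Function.iterate_injOn_Iio_minimalPeriod)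
  · rw [n8, ← REL.sum_leftIn hu fun d => O.count i (G.rev d)]
    refine sum_count_le O i (h := fun k => G.rev ((L.leftIn i u hu).dart k))
      (G.rev.injective.comp_injOn fun k hk l hl h => ?_)
    refine (L.isCycle_leftIn i hu).2 k l hk hl ?_
    rw [h]
    exact Equiv.Perm.SameCycle.refl _ _

/-! ### Choosing the weights and following a strand. -/

/-- Decides how many copies of the two cycles are used. -/
def weightsProgram : Program :=
  -- Subtraction is truncated, so 0 stands for every nonpositive intersection number with the orbit.
  -- These cases keep the weights `p = q = 1`, as does a sum exceeding register `26`.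
  .block [.sub 29 22 23, .sub 30 25 24, .add 31 29 30, .const 27 1, .const 28 0,
    .ite (.eq 26 4) .skip (.block [.const 28 1, .ite (.lt 4 29) (.ite (.lt 4 30)
      (.ite (.lt 26 31) .skip (.block [.move 27 30, .move 28 29])) .skip) .skip])]

theorem weightsProgram_spec {O : Orbits G} (hW : 2 * inputSize O ≤ W) {S : Strands L i} {v : Fin n}
    {s : State} (hs : Marks O S v s) (hc : Crossings O S s) :
    wp W weightsProgram (fun s' t => t ≤ 30 ∧ s'.mem = s.mem ∧ Marks O S v s' ∧ ∃ p q,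
      S.Weights O p q ∧ s'.reg 27 = p ∧ s'.reg 28 = q ∧ 0 < p ∧ p + q ≤ W) s := by
  have hN := le_inputSize O i
  have hlen := O.len_pos i
  obtain ⟨c1, c2, c3, c4, c5⟩ := hc
  have hM (s' : State) (h1 : s'.mem = s.mem) (h2 : Tables O L i s') (h3 : s'.reg 20 = s.reg 20) :
      Marks O S v s' := by
    refine ⟨h2, h3.trans hs.start, hs.inA, ?_, ?_⟩
    · rw [h1]; exact hs.mem_inA
    · rw [h1]; exact hs.mem_bOut
  have hx : 0 < S.a.sum (O.crossing i) ↔ 0 < s.reg 22 - s.reg 23 := by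
    rw [c1, sub_pos, Nat.cast_lt]; omega
  have hy : 0 < - S.b.sum (O.crossing i) ↔ 0 < s.reg 25 - s.reg 24 := by
    rw [c2, sub_pos, Nat.cast_lt]; omega
  have hx' (h : 0 < s.reg 22 - s.reg 23) :
      S.a.sum (O.crossing i) = (s.reg 22 - s.reg 23 : ℕ) := by
    rw [c1, Nat.cast_sub (by omega)]
  have hy' (h : 0 < s.reg 25 - s.reg 24) :
      - S.b.sum (O.crossing i) = (s.reg 25 - s.reg 24 : ℕ) := by
    rw [c2, Nat.cast_sub (by omega)]
  have h0 : S.a.pair O S.b = 0 ↔ s.reg 26 = 0 := by rw [c3, Nat.cast_eq_zero]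
  simp only [weightsProgram, wp_block_cons, wp_block_nil, wp_ite, wp_add, wp_sub, wp_const, wp_move,
    wp_skip, Test.Holds, State.setReg_reg, Nat.reduceEqDiff, if_true, if_false,
    hs.tables.ready.zero]
  refine ⟨by omega, by omega, by omega, fun hb => ?_, fun hb => ⟨by omega, fun h1 => ⟨fun h2 =>
    ⟨fun h3 => ?_, fun h3 => ?_⟩, fun h2 => ?_⟩, fun h1 => ?_⟩⟩
  · refine ⟨by omega, rfl, hM _ rfl (by simp [hs.tables]) (by simp), 1, 0,
      Or.inl ⟨h0.2 hb, rfl, rfl⟩,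
      by simp, by simp, by norm_num, by omega⟩
  · refine ⟨by omega, rfl, hM _ rfl (by simp [hs.tables]) (by simp), 1, 1, Or.inr (Or.inl
      ⟨mt h0.1 hb, rfl, rfl, fun h => ?_⟩), by simp, by simp, by norm_num, by omega⟩
    have h4 := h.2.2
    rw [hx' h1, hy' h2, c3] at h4
    have : s.reg 22 - s.reg 23 + (s.reg 25 - s.reg 24) ≤ s.reg 26 := by exact_mod_cast h4
    omega
  · refine ⟨by omega, rfl, hM _ rfl (by simp [hs.tables]) (by simp), s.reg 25 - s.reg 24,
      s.reg 22 - s.reg 23, Or.inr (Or.inr ⟨mt h0.1 hb, h2, h1, hx' h1, hy' h2, ?_⟩),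
      by simp, by simp,
      h2, by omega⟩
    rw [c3]
    have : s.reg 25 - s.reg 24 + (s.reg 22 - s.reg 23) ≤ s.reg 26 := by omega
    exact_mod_cast this
  · refine ⟨by omega, rfl, hM _ rfl (by simp [hs.tables]) (by simp), 1, 1, Or.inr (Or.inl
      ⟨mt h0.1 hb, rfl, rfl, fun h => h2 (hy.1 h.2.1)⟩), by simp, by simp, by norm_num, by omega⟩
  · refine ⟨by omega, rfl, hM _ rfl (by simp [hs.tables]) (by simp), 1, 1, Or.inr (Or.inl
      ⟨mt h0.1 hb, rfl, rfl, fun h => h1 (hx.1 h.1)⟩), by simp, by simp, by norm_num, by omega⟩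

end

/-- Finds the arc on which the strand leaves the current vertex. -/
def leaveProgram : Program :=
  .block [.load 31 10 30, .ite (.lt 4 31) (.ite (.lt 29 28) (.sub 32 31 3)
    -- When the arc of `b` is itself the leftmost one, all strands leave together and none is lost.
    (.block [.move 32 30, .sub 33 31 3, .ite (.eq 33 30) .skip (.sub 29 29 28)])) (.move 32 30)]

/-- Follows a strand. -/
def walkProgram : Program :=
  .block [.move 30 20, .const 29 0, .const 6 0, .const 18 1, .while (.eq 18 3)
    (.block [leaveProgram, .store 6 6 32, .add 6 6 3, .load 33 1 32, .load 30 7 33,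
      .load 34 9 32, .load 35 9 30, .ite (.lt 34 35) (.add 29 29 27) .skip,
      -- The walk closes only when both the vertex and the number of strands on the right agree with
      -- the initial state `(v, 0)`.
      .ite (.eq 30 20) (.ite (.eq 29 4) (.const 18 0) .skip) .skip]), .move 0 6]

section

open Classical

variable {n W : ℕ} {G : TorusTriangulation (Fin n)} {L : REL G} {i : Fin 2} {O : Orbits G}
  {S : Strands L i} {v : Fin n} {p q : ℕ}

theorem leaveProgram_spec {s : State} {x : Fin n × ℕ} (hs : Marks O S v s) (h28 : s.reg 28 = q)
    (h30 : s.reg 30 = x.1) (h29 : s.reg 29 = x.2) :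
    wp W leaveProgram (fun s' t => t ≤ 10 ∧ Marks O S v s' ∧ s'.mem = s.mem ∧
      (s'.reg 6 = s.reg 6 ∧ s'.reg 18 = s.reg 18 ∧ s'.reg 27 = s.reg 27 ∧ s'.reg 28 = s.reg 28) ∧
      s'.reg 32 = S.out q x ∧ s'.reg 29 = x.2 - S.loss q x.1 (S.out q x)) s := by
  have hM (s' : State) (h1 : s'.mem = s.mem) (h2 : Tables O L i s') (h3 : s'.reg 20 = s.reg 20) :
      Marks O S v s' := by
    refine ⟨h2, h3.trans hs.start, hs.inA, ?_, ?_⟩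
    · rw [h1]; exact hs.mem_inA
    · rw [h1]; exact hs.mem_bOut
  simp only [leaveProgram, wp_block_cons, wp_block_nil, wp_ite, wp_sub, wp_move, wp_load,
    wp_skip, Test.Holds, State.setReg_reg, State.setReg_mem, Nat.reduceEqDiff, if_true, if_false,
    hs.tables.ready.zero, hs.tables.ready.one, h28, h29, h30, hs.mem_bOut]
  by_cases hB : S.OnB x.1
  · simp only [if_pos hB, Nat.add_sub_cancel, Fin.val_inj, Nat.succ_pos, not_true, forall_const,
      IsEmpty.forall_iff, and_true]
    refine ⟨fun hq => ?_, fun hq => ⟨fun hb => ?_, fun hb => ?_⟩⟩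
    · have ho : S.out q x = S.bOut x.1 := if_pos ⟨hB, hq⟩
      have hl : S.loss q x.1 (S.out q x) = 0 := if_neg fun h => h.2 ho
      refine ⟨by omega, hM _ rfl (by simp [hs.tables]) (by simp), by simp, by simp, ?_, ?_⟩
      · simp [ho]
      · simp [hl]
    · have ho : S.out q x = x.1 := if_neg fun h => hq h.2
      have hl : S.loss q x.1 (S.out q x) = 0 := if_neg fun h => h.2 (ho.trans hb.symm)
      refine ⟨by omega, hM _ rfl (by simp [hs.tables]) (by simp), by simp, by simp, ?_, ?_⟩
      · simp [ho]
      · simp [hl]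
    · have ho : S.out q x = x.1 := if_neg fun h => hq h.2
      have hl : S.loss q x.1 (S.out q x) = q := if_pos ⟨hB, fun h => hb (h.symm.trans ho)⟩
      refine ⟨by omega, hM _ rfl (by simp [hs.tables]) (by simp), by simp, by simp, ?_, ?_⟩
      · simp [ho]
      · simp [hl]
  · have ho : S.out q x = x.1 := if_neg fun h => hB h.1
    have hl : S.loss q x.1 (S.out q x) = 0 := if_neg fun h => hB h.1
    simp only [if_neg hB, lt_irrefl]
    refine ⟨False.elim, fun _ => ⟨by omega, hM _ rfl (by simp [hs.tables]) (by simp), by simp,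
      by simp, ?_, ?_⟩⟩
    · simp [ho]
    · simp [hl]

theorem walkProgram_spec (hW : 2 * n + 2 ≤ W) (hpq : p + q ≤ W) {s : State} (hs : Marks O S v s)
    (h27 : s.reg 27 = p) (h28 : s.reg 28 = q) (hv : S.Valid p q (v, 0))
    (hlen : (Strands.walk hv).len ≤ 2 * n) :
    wp W walkProgram (fun s' t => t ≤ 60 * n + 20 ∧ s'.Outputs (Strands.walk hv)) s := by
  set f := S.step p q
  set T := Function.minimalPeriod f (v, 0) with hTdef
  change T ≤ 2 * n at hlen
  have hT : 0 < T := (Strands.walk hv).len_pos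
  let Inv (j : ℕ) (s' : State) : Prop := Marks O S v s' ∧ s'.reg 27 = p ∧ s'.reg 28 = q ∧
    s'.reg 30 = (f^[j] (v, 0)).1 ∧ s'.reg 29 = (f^[j] (v, 0)).2 ∧ s'.reg 6 = j ∧
    (∀ m < j, s'.mem 6 m = S.out q (f^[m] (v, 0))) ∧ s'.reg 18 = if j < T then 1 else 0
  have hloop := fun s₀ (h0 : Inv 0 s₀) => wp_loop_const (W := W) (b := .eq 18 3)
    (P := .block [leaveProgram, .store 6 6 32, .add 6 6 3, .load 33 1 32, .load 30 7 33,
      .load 34 9 32, .load 35 9 30, .ite (.lt 34 35) (.add 29 29 27) .skip,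
      .ite (.eq 30 20) (.ite (.eq 29 4) (.const 18 0) .skip) .skip]) Inv 25 T (s := s₀) ?_ ?_ h0
  · simp only [walkProgram, wp_block_cons, wp_block_nil, wp_const, wp_move]
    refine ⟨Nat.zero_le _, Nat.zero_le _, by omega, wp_mono (hloop _ ?_) ?_⟩
    · refine ⟨⟨?_, ?_, hs.inA, hs.mem_inA, hs.mem_bOut⟩, ?_, ?_, ?_, ?_, ?_, ?_, ?_⟩
      all_goals simp [hs.tables, hs.start, h27, h28, hT]
    · rintro s' t ⟨ht, h1, h2, h3, h4, h5, h6, h7, h8⟩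
      refine ⟨by omega, ?_, h7⟩
      rw [State.setReg_reg, if_pos rfl, h6]
      rfl
  · rintro j s ⟨h1, -, -, -, -, -, -, h2⟩
    simp only [Test.Holds, h1.tables.ready.one, h2]
    split_ifs with h <;> simp [h]
  · rintro j hj s' ⟨h1, h2, h3, h4, h5, h6, h7, h8⟩
    set x := f^[j] (v, 0) with hx
    have hvalid : S.Valid p q x := Strands.valid_iterate hv j
    have hend : f^[j + 1] (v, 0) = (v, 0) ↔ ¬ j + 1 < T := iterate_succ_eq_self_iff hj
    have hstep : f^[j + 1] (v, 0) = (L.lo i (G.rev (S.out q x)),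
        x.2 - S.loss q x.1 (S.out q x) + S.gain p (S.out q x)) := by
      rw [Function.iterate_succ_apply', ← hx]
      rfl
    -- Validity bounds the new number of strands on the right by `p + q`, so the addition stays
    -- within the word size.
    have hnext := (Strands.valid_iterate hv (j + 1)).lt
    change (f^[j + 1] (v, 0)).2 < p + q at hnext
    rw [hstep] at hnext
    rw [hstep, Prod.mk_inj] at hend
    rw [wp_block_cons]
    refine wp_mono (leaveProgram_spec h1 h3 h4 h5) ?_
    rintro s₁ t ⟨ht, k1, k2, ⟨k3, k4, k5, k6⟩, k7, k8⟩
    have key (s'' : State) (l1 : Tables O L i s'') (hm : s''.mem =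
        (s₁.setMem 6 j (S.out q x)).mem) (l2 : s''.reg 20 = s₁.reg 20)
        (l3 : s''.reg 27 = s₁.reg 27) (l4 : s''.reg 28 = s₁.reg 28)
        (l5 : s''.reg 30 = L.lo i (G.rev (S.out q x)))
        (l6 : s''.reg 29 = x.2 - S.loss q x.1 (S.out q x) + S.gain p (S.out q x))
        (l7 : s''.reg 6 = j + 1) (l8 : s''.reg 18 = if j + 1 < T then 1 else 0) :
        Inv (j + 1) s'' := by
      refine ⟨⟨l1, l2.trans k1.start, k1.inA, ?_, ?_⟩, ?_, ?_, ?_, ?_, l7, fun m hm' => ?_, l8⟩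
      · rw [hm]; exact k1.mem_inA
      · rw [hm]; exact k1.mem_bOut
      · rw [l3, k5, h2]
      · rw [l4, k6, h3]
      · rw [l5, hstep]
      · rw [l6, hstep]
      · rw [hm, State.setMem_mem, if_pos rfl]
        rcases Nat.lt_succ_iff_lt_or_eq.1 hm' with hm' | rfl
        · rw [Function.update_of_ne (by omega), k2, h7 m hm']
        · rw [Function.update_self]
    have hgain : S.gain p (S.out q x) =
        if S.InA (L.lo i (G.rev (S.out q x))) ∧ ¬ S.InA (S.out q x) then p else 0 := rfl
    have hlt : ((if S.InA (S.out q x) then 1 else 0) <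
        if S.InA (L.lo i (G.rev (S.out q x))) then 1 else 0) ↔
        S.InA (L.lo i (G.rev (S.out q x))) ∧ ¬ S.InA (S.out q x) := by
      by_cases hA : S.InA (S.out q x) <;> by_cases hA' : S.InA (L.lo i (G.rev (S.out q x))) <;>
      simp [hA, hA']
    simp only [wp_block_cons, wp_block_nil, wp_ite, wp_add, wp_const, wp_load,
      wp_store, wp_skip, Test.Holds, State.setReg_reg, State.setReg_mem, State.setMem_reg,
      State.setMem_mem, Nat.reduceEqDiff, if_true, if_false, k1.tables.ready.one,
      k1.tables.ready.zero, k1.tables.ready.mem_rev, k1.tables.mem_lo, k1.mem_inA, k7, k8, k3, h6,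
      k5, h2, k1.start, Fin.val_inj]
    refine ⟨by omega, fun hb => ?_, fun hb => ?_⟩
    · rw [if_pos (hlt.1 hb)] at hgain
      rw [hgain] at hnext hend
      refine ⟨by omega, fun hv => ⟨fun hr => ⟨by omega, by omega, key _ ?_ ?_ ?_ ?_ ?_ ?_ ?_ ?_ ?_⟩,
        fun hr => ⟨by omega, key _ ?_ ?_ ?_ ?_ ?_ ?_ ?_ ?_ ?_⟩⟩,
        fun hv => ⟨by omega, key _ ?_ ?_ ?_ ?_ ?_ ?_ ?_ ?_ ?_⟩⟩
      all_goals first | rfl | simp [k1.tables, k4, h8, hj, hgain]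
      · exact not_lt.1 (hend.1 ⟨hv, hr⟩)
      · exact not_not.1 (mt hend.2 fun h => hr h.2)
      · exact not_not.1 (mt hend.2 fun h => hv h.1)
    · rw [if_neg (mt hlt.2 hb)] at hgain
      rw [hgain] at hnext hend
      refine ⟨fun hv => ⟨fun hr => ⟨by omega, by omega, key _ ?_ ?_ ?_ ?_ ?_ ?_ ?_ ?_ ?_⟩,
        fun hr => ⟨by omega, key _ ?_ ?_ ?_ ?_ ?_ ?_ ?_ ?_ ?_⟩⟩,
        fun hv => ⟨by omega, key _ ?_ ?_ ?_ ?_ ?_ ?_ ?_ ?_ ?_⟩⟩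
      all_goals first | rfl | simp [k1.tables, k4, k8, h8, hj, hgain]
      · exact not_lt.1 (hend.1 ⟨hv, hr⟩)
      · exact not_not.1 (mt hend.2 fun h => hr h.2)
      · exact not_not.1 (mt hend.2 fun h => hv h.1)

end

/-- The program that finds a feedback closed walk. -/
def feedbackProgram (i : Fin 2) : Program :=
  .seq (tablesProgram i) (.seq cyclesProgram (.seq weightsProgram walkProgram))

theorem feedbackProgram_spec {n : ℕ} {G : TorusTriangulation (Fin n)} (O : Orbits G) {L : REL G}
    (hL : L.Realizable) (i : Fin 2) :
    wp (500 * inputSize O) (feedbackProgram i) (fun s t => t ≤ 500 * inputSize O ∧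
      ∃ C, s.Outputs C ∧ L.IsFeedback O i C ∧
        (L.Orbital O → C.IsSimple G ∧ O.homotopyClass C = Orbits.orbitClass i))
      (inputState O L) := by
  have hN := le_inputSize O i
  have hlen := O.len_pos i
  have hn : 0 < n := Fin.pos_iff_nonempty.2 G.nonempty
  refine wp_mono (wp_seq_le (tablesProgram_spec (W := 500 * inputSize O) O (by omega)) fun s₁ h₁ =>
    wp_seq_le (cyclesProgram_spec (by omega) h₁.1 h₁.2) fun s₂ ⟨S, v, hM, hC⟩ =>
      wp_seq_le (B := 60 * n + 20)
        (R := fun s => ∃ p q, Marks O S v s ∧ S.Weights O p q ∧ s.reg 27 = p ∧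
          s.reg 28 = q ∧ 0 < p ∧ p + q ≤ 500 * inputSize O)
        (wp_mono (weightsProgram_spec (by omega) hM hC) fun s t h => ⟨h.1, ?_⟩) ?_)
    fun s t h => ⟨?_, h.2⟩
  · obtain ⟨-, -, h2, p, q, h3, h4, h5, h6, h7⟩ := h
    exact ⟨p, q, h2, h3, h4, h5, h6, h7⟩
  · rintro s₃ ⟨p, q, h2, h3, h4, h5, h6, h7⟩
    -- The rightmost strand at a vertex of `a`; it exists because `p` is positive.
    have hv : S.Valid p q (v, 0) := by
      refine ⟨?_, ?_⟩
      · exact h2.inA.lo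
      · change 0 < @ite ℕ (S.InA v) (Classical.propDecidable _) p 0 + _
        rw [if_pos h2.inA]
        omega
    obtain ⟨k1, k2, k3⟩ := Strands.feedback_of_weights h3 hv hL
    rw [Fintype.card_fin] at k2
    exact wp_mono (walkProgram_spec (by omega) h7 h2 h4 h5 hv k2)
      fun s' t h => ⟨h.1, _, h.2, k1, k3⟩
  -- The stages take at most `120 * inputSize O`, `50 * n + 40`, `30` and `60 * n + 20` steps; 500
  -- leaves ample room.
  · omega

end TorusREL

theorem mainTheorem8 (i : Fin 2) :
    ∃ (P : TorusREL.Program) (c : ℕ),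
      ∀ (n : ℕ) (G : TorusREL.TorusTriangulation (Fin n)) (O : TorusREL.Orbits G)
        (L : TorusREL.REL G), O.IsPTT → L.Realizable →
        ∃ (s : TorusREL.State) (t : ℕ) (C : TorusREL.ClosedSeq (Fin n)),
          TorusREL.Exec (c * TorusREL.inputSize O) P (TorusREL.inputState O L) s t ∧
          t ≤ c * TorusREL.inputSize O ∧
          s.Outputs C ∧
          L.IsFeedback O i C ∧
          (L.Orbital O → C.IsSimple G ∧ O.homotopyClass C = TorusREL.Orbits.orbitClass i) := by
  refine ⟨TorusREL.feedbackProgram i, 500, fun n G O L _ hL => ?_⟩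
  obtain ⟨s, t, h1, h2, C, h3⟩ := TorusREL.feedbackProgram_spec O hL i
  exact ⟨s, t, C, h1, h2, h3⟩
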